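/- **Construction.** Let $BW_1=\mathbb Z^2$ be the square lattice and let $R_1$ be its isometry group, which is dihedral of order $8$. Let $d\ge 2$ and suppose that $M=L_{d-1}$ and $Q=R_{d-1}$ are already given (with $L_1=BW_1$). Let $f\in Q$ be a fourvolution ($f^2=-1$), write $M[k]=(1-f)^kM$ for $k\in\mathbb Z$, and let $r\in\{0,1\}$, $r\equiv d \pmod 2$ (this is the number with $M^*=M[-r]$). Let $\psi_1,\psi_2$ be isometries of the ambient space of $M$ onto orthogonal subspaces $V_1,V_2$ of the Euclidean space $V=V_1\perp V_2$ of dimension $2^d$. For an additive subgroup $S$ put $S_i=\psi_i(S)$, $S_{12}=\{\psi_1x+\psi_2x: x\in S\}$, $S_{12'}=\{\psi_1x-\psi_2x: x\in S\}$. Then $$L_d:=M_1[1-r]+M_2[1-r]+M_{12}[-r]$$ and $R_d:=\langle Q_{12},t_1,t_2,t_{12},t_{12'}\rangle$, where $Q_{12}$ is $Q$ acting diagonally on $V_1\perp V_2$, and $t_1,t_2,t_{12},t_{12'}$ are the orthogonal involutions that are $-1$ on $M_1[1-r]$, $M_2[1-r]$, $M_{12}[-r]$, $M_{12'}[-r]$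 respectively, and $1$ on the orthogonal complement. The group $R_d$ is called the lower group. **Groups.** $2^{1+2d}_+$ denotes the extraspecial group of plus type of order $2^{1+2d}$. $\Omega^+(2d,2)$ denotes the kernel of the Dickson invariant on the orthogonal group of a nondegenerate quadratic form of maximal Witt index on $\mathbb F_2^{2d}$; it consists of the isometries $g$ for which $g-1$ has even rank. For a field $F$ of characteristic $0$, the Bolt–Room–Wall group $BRW^0(2^d,+)$ is, for $d\ge3$, the derived subgroup of the normalizer in $GL(2^d,F)$ of the standard $2^{1+2d}_+$, which is generated on the $F$-valued functions on $\mathbb F_2^d$ by the translations $\varphi(x)\mapsto\varphi(x+a)$ and the sign changes $\varphi(x)\mapsto(-1)^{b\cdot x}\varphi(x)$. For $d\leq 2$ it is the group of all $g\in GL(2^d,F)$ with $g\otimes 1\in BRW^0(2^{d+3},+)$. **Theorem.** Let $d\ge 2$ and let $F$ be a field of characteristic $0$. Pairs $(L_d,R_d)$ as above exist. Let $(L_d,R_d)$ be any such pair, obtained with any choices of the fourvolutions and isometries. Then $R_d\le Aut(L_d)$ and $R_d\cong 2^{1+2d}_+$, and the normalizer $G_d:=N_{Aut(L_d)}(R_d)$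 satisfies $$G_d\;\cong\; BRW^0(2^d,+)\;\cong\; 2^{1+2d}_+.\Omega^+(2d,2).$$ Precisely: (i) there is an isomorphism of $G_d$ onto $BRW^0(2^d,+)$ that carries $R_d$ onto the standard $2^{1+2d}_+$; (ii) $R_d/Z(R_d)$ can be identified with $\mathbb F_2^{2d}$ in such a way that the quadratic form induced by squaring becomes the standard form $\sum_i a_ib_i$, and conjugation on $R_d/Z(R_d)$ induces an epimorphism $G_d\to\Omega^+(2d,2)$ with kernel $R_d$. -/

import Mathlib

noncomputable section

namespace BarnesWall

/-! ### Extraspecial groups and the groups `Ω⁺(2d,2)` -/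

/-- `P` is an extraspecial group of plus type `2^{1+2d}_+`: its order is `2^(1+2d)`, its centre has
order 2 and equals the derived subgroup, all squares are central, and (plus type) it has an
elementary abelian subgroup of the maximal conceivable order `2^(1+d)`. -/
def IsExtraspecialPlus (d : ℕ) (P : Type*) [Group P] : Prop :=
  Nat.card P = 2 ^ (1 + 2 * d) ∧
  Nat.card (Subgroup.center P) = 2 ∧
  commutator P = Subgroup.center P ∧
  (∀ x : P, x ^ 2 ∈ Subgroup.center P) ∧
  ∃ A : Subgroup P, Nat.card A = 2 ^ (1 + d) ∧ ∀ x ∈ A, x ^ 2 = 1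

/-- The space `𝔽₂^{2d}`. -/
abbrev QSpace (d : ℕ) : Type := (Fin d → ZMod 2) × (Fin d → ZMod 2)

/-- The nondegenerate quadratic form `∑ aᵢ bᵢ` of maximal Witt index on `𝔽₂^{2d}`. -/
def hypForm (d : ℕ) (v : QSpace d) : ZMod 2 := ∑ i, v.1 i * v.2 i

/-- `Ω⁺(2d,2)`: the kernel of the Dickson invariant on the orthogonal group `O⁺(2d,2)` of
`hypForm d`. The Dickson invariant of `g` is the parity of the rank of `g - 1`. (The set below is
already closed under products; the closure is only taken to have a subgroup at hand.
For `d = 2` this is the group of order 36.) -/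
def OmegaPlus (d : ℕ) : Subgroup (QSpace d ≃ₗ[ZMod 2] QSpace d) :=
  Subgroup.closure
    {g | (∀ v, hypForm d (g v) = hypForm d v) ∧
      Even (Module.finrank (ZMod 2)
        (LinearMap.range ((g : QSpace d →ₗ[ZMod 2] QSpace d) - LinearMap.id)))}

/-! ### The Bolt-Room-Wall groups -/

section BRW

variable (F : Type*) [Field F]

/-- The space of `F`-valued functions on `𝔽₂^ι`; its dimension is `2^d` where `d = |ι|`. -/
abbrev FunSpace (ι : Type*) : Type _ := (ι → ZMod 2) → F

/-- The translation `φ ↦ (x ↦ φ (x + a))`. -/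
def translation (ι : Type*) (a : ι → ZMod 2) : FunSpace F ι ≃ₗ[F] FunSpace F ι :=
  LinearEquiv.funCongrLeft F F (Equiv.addRight a)

/-- The sign change `φ ↦ (x ↦ (-1)^{b·x} φ x)`. -/
def signChange (ι : Type*) [Fintype ι] (b : ι → ZMod 2) : FunSpace F ι ≃ₗ[F] FunSpace F ι :=
  LinearEquiv.piCongrRight fun x =>
    LinearEquiv.smulOfUnit ((-1 : Fˣ) ^ (∑ i, b i * x i : ZMod 2).val)

/-- The standard extraspecial subgroup `2^{1+2d}_+` of `GL(2^d, F)`, where `d = |ι|`. -/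
def stdLower (ι : Type*) [Fintype ι] : Subgroup (FunSpace F ι ≃ₗ[F] FunSpace F ι) :=
  Subgroup.closure (Set.range (translation F ι) ∪ Set.range (signChange F ι))

/-- The derived subgroup `N'` of the normalizer `N` of the standard `2^{1+2d}_+` in
`GL(2^d, F)`. -/
def derivedNormalizer (ι : Type*) [Fintype ι] :
    Subgroup (FunSpace F ι ≃ₗ[F] FunSpace F ι) :=
  ⁅Subgroup.normalizer (stdLower F ι : Set (FunSpace F ι ≃ₗ[F] FunSpace F ι)),
    Subgroup.normalizer (stdLower F ι : Set (FunSpace F ι ≃ₗ[F] FunSpace F ι))⁆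

/-- `g ⊗ 1` acting on the functions on `𝔽₂^ι × 𝔽₂^κ`. -/
def tensorOneEquiv (ι κ : Type*) (g : FunSpace F ι ≃ₗ[F] FunSpace F ι) :
    FunSpace F (ι ⊕ κ) ≃ₗ[F] FunSpace F (ι ⊕ κ) where
  toFun φ z := g (fun x => φ (Sum.elim x (z ∘ Sum.inr))) (z ∘ Sum.inl)
  invFun φ z := g.symm (fun x => φ (Sum.elim x (z ∘ Sum.inr))) (z ∘ Sum.inl)
  map_add' φ ψ := by
    funext z
    exact congrFun (g.map_add (fun x => φ (Sum.elim x (z ∘ Sum.inr)))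
      (fun x => ψ (Sum.elim x (z ∘ Sum.inr)))) (z ∘ Sum.inl)
  map_smul' c φ := by
    funext z
    exact congrFun (g.map_smul c (fun x => φ (Sum.elim x (z ∘ Sum.inr)))) (z ∘ Sum.inl)
  left_inv φ := by
    funext z
    have h : (fun x => g (fun x' => φ (Sum.elim x' ((Sum.elim x (z ∘ Sum.inr)) ∘ Sum.inr)))
        ((Sum.elim x (z ∘ Sum.inr)) ∘ Sum.inl)) =
        g (fun x' => φ (Sum.elim x' (z ∘ Sum.inr))) := by
      funext x
      simp
    simp only [h, LinearEquiv.symm_apply_apply, Sum.elim_comp_inl_inr]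
  right_inv φ := by
    funext z
    have h : (fun x => g.symm (fun x' => φ (Sum.elim x' ((Sum.elim x (z ∘ Sum.inr)) ∘ Sum.inr)))
        ((Sum.elim x (z ∘ Sum.inr)) ∘ Sum.inl)) =
        g.symm (fun x' => φ (Sum.elim x' (z ∘ Sum.inr))) := by
      funext x
      simp
    simp only [h, LinearEquiv.apply_symm_apply, Sum.elim_comp_inl_inr]

/-- The homomorphism `g ↦ g ⊗ 1` of general linear groups. -/
def tensorOne (ι κ : Type*) :
    (FunSpace F ι ≃ₗ[F] FunSpace F ι) →*
      (FunSpace F (ι ⊕ κ) ≃ₗ[F] FunSpace F (ι ⊕ κ)) where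
  toFun := tensorOneEquiv F ι κ
  map_one' := by
    ext φ z
    change φ (Sum.elim (z ∘ Sum.inl) (z ∘ Sum.inr)) = φ z
    rw [Sum.elim_comp_inl_inr]
  map_mul' g h := by
    apply LinearEquiv.ext
    intro φ
    funext z
    change g (h (fun x => φ (Sum.elim x (z ∘ Sum.inr)))) (z ∘ Sum.inl) =
      g (fun x => h (fun x' => φ (Sum.elim x' ((Sum.elim x (z ∘ Sum.inr)) ∘ Sum.inr)))
        ((Sum.elim x (z ∘ Sum.inr)) ∘ Sum.inl)) (z ∘ Sum.inl)
    congr 2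

/-- The Bolt-Room-Wall group `BRW⁰(2^d,+)` over the field `F` of characteristic 0. For `d ≥ 3` it
is the derived subgroup of the normalizer in `GL(2^d, F)` of the standard `2^{1+2d}_+`. For smaller
`d` it is the corresponding tensor factor subgroup of such a group for larger `d`, consisting of
the `g ∈ GL(2^d, F)` with `g ⊗ 1 ∈ BRW⁰(2^{d+3},+)`. -/
def BRW0 (d : ℕ) : Subgroup (FunSpace F (Fin d) ≃ₗ[F] FunSpace F (Fin d)) :=
  if 3 ≤ d then derivedNormalizer F (Fin d)
  else (derivedNormalizer F (Fin d ⊕ Fin 3)).comap (tensorOne F (Fin d) (Fin 3))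

end BRW

/-! ### Lattices -/

section Lattice

variable {E V : Type*} [NormedAddCommGroup E] [InnerProductSpace ℝ E]
  [NormedAddCommGroup V] [InnerProductSpace ℝ V]

/-- The group `Aut(L)` of isometries of a lattice `L` that spans the Euclidean space `E`. -/
def latAut (L : Submodule ℤ E) : Subgroup (E ≃ₗᵢ[ℝ] E) where
  carrier := {g | ∀ x, g x ∈ L ↔ x ∈ L}
  mul_mem' {g h} hg hh x := (hg (h x)).trans (hh x)
  one_mem' _ := Iff.rfl
  inv_mem' {g} hg x := by
    have h := hg (g⁻¹ x)
    rw [show g (g⁻¹ x) = x from g.apply_symm_apply x] at h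
    exact h.symm

/-- A fourvolution is an isometry whose square is `-1`. -/
def IsFourvolution (f : E ≃ₗᵢ[ℝ] E) : Prop := ∀ x, f (f x) = -x

/-- The map `1 - f`. -/
def sultry (f : E ≃ₗᵢ[ℝ] E) : E →ₗ[ℝ] E :=
  LinearMap.id - (f.toLinearEquiv : E →ₗ[ℝ] E)

/-- The sultry twist `S[k] = (1 - f)^k S`, where `k ∈ ℤ` and `f` is a fourvolution (so `1 - f`
is invertible and its negative powers may be applied by taking preimages). -/
def sultryTwist (f : E ≃ₗᵢ[ℝ] E) (S : Submodule ℤ E) : ℤ → Submodule ℤ E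
  | Int.ofNat n => S.map (((sultry f) ^ n).restrictScalars ℤ)
  | Int.negSucc n => S.comap (((sultry f) ^ (n + 1)).restrictScalars ℤ)

/-- The involution `t_S` attached to a sublattice `S`: it is `-1` on `S` and `1` on `Sᗮ`. -/
def ssdInvolution [FiniteDimensional ℝ V] (S : Submodule ℤ V) : V ≃ₗᵢ[ℝ] V :=
  ((Submodule.span ℝ (S : Set V))ᗮ).reflection

/-- `S₁ = ψ₁ S`, `S₂ = ψ₂ S` for an isometric embedding `ψ`. -/
def copy (ψ : E →ₗᵢ[ℝ] V) (S : Submodule ℤ E) : Submodule ℤ V :=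
  S.map (ψ.toLinearMap.restrictScalars ℤ)

/-- `S₁₂ = {ψ₁ x + ψ₂ x | x ∈ S}`. -/
def diagCopy (ψ₁ ψ₂ : E →ₗᵢ[ℝ] V) (S : Submodule ℤ E) : Submodule ℤ V :=
  S.map ((ψ₁.toLinearMap + ψ₂.toLinearMap).restrictScalars ℤ)

/-- `S₁₂' = {ψ₁ x - ψ₂ x | x ∈ S}`. -/
def antidiagCopy (ψ₁ ψ₂ : E →ₗᵢ[ℝ] V) (S : Submodule ℤ E) : Submodule ℤ V :=
  S.map ((ψ₁.toLinearMap - ψ₂.toLinearMap).restrictScalars ℤ)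

/-- The lattice `M₁[1-r] + M₂[1-r] + M₁₂[-r]`. -/
def nextLattice (ψ₁ ψ₂ : E →ₗᵢ[ℝ] V) (f : E ≃ₗᵢ[ℝ] E) (r : ℤ) (M : Submodule ℤ E) :
    Submodule ℤ V :=
  copy ψ₁ (sultryTwist f M (1 - r)) ⊔ copy ψ₂ (sultryTwist f M (1 - r)) ⊔
    diagCopy ψ₁ ψ₂ (sultryTwist f M (-r))

/-- The group generated by the diagonal copy `Q₁₂` of `Q` and by the involutions `t₁`, `t₂`,
`t₁₂`, `t₁₂'` attached to `M₁[1-r]`, `M₂[1-r]`, `M₁₂[-r]`, `M₁₂'[-r]`. -/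
def nextLower [FiniteDimensional ℝ V] (ψ₁ ψ₂ : E →ₗᵢ[ℝ] V) (f : E ≃ₗᵢ[ℝ] E) (r : ℤ)
    (M : Submodule ℤ E) (Q : Subgroup (E ≃ₗᵢ[ℝ] E)) : Subgroup (V ≃ₗᵢ[ℝ] V) :=
  Subgroup.closure
    ({g | ∃ h ∈ Q, ∀ x, g (ψ₁ x) = ψ₁ (h x) ∧ g (ψ₂ x) = ψ₂ (h x)} ∪
      {ssdInvolution (copy ψ₁ (sultryTwist f M (1 - r))),
        ssdInvolution (copy ψ₂ (sultryTwist f M (1 - r))),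
        ssdInvolution (diagCopy ψ₁ ψ₂ (sultryTwist f M (-r))),
        ssdInvolution (antidiagCopy ψ₁ ψ₂ (sultryTwist f M (-r)))})

end Lattice

/-- Euclidean space of dimension `2^d`. -/
abbrev Euc (d : ℕ) : Type := EuclideanSpace ℝ (Fin (2 ^ d))

/-- `IsBWPair d L R`: the lattice `L` in Euclidean `2^d`-space is a Barnes-Wall lattice `L_d`
and `R` is its lower group `R_d`, as obtained by iterating the successor procedure.
The start, `d = 1`, is the square lattice `ℤ²` with its full isometry group (dihedral of
order 8). For `d ≥ 2`, from a pair `(M, Q)` for `d - 1`, any fourvolution `f ∈ Q`, and any two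
isometric embeddings `ψ₁, ψ₂` of the space of `M` with orthogonal images, one passes to
`L = M₁[1-r] + M₂[1-r] + M₁₂[-r]` and `R = ⟨Q₁₂, t₁, t₂, t₁₂, t₁₂'⟩`, where `r ∈ {0,1}` is the
duality level of `M` (that is, `M* = M[-r]`), which is the residue of `d` modulo 2. -/
def IsBWPair : (d : ℕ) → Submodule ℤ (Euc d) → Subgroup (Euc d ≃ₗᵢ[ℝ] Euc d) → Prop
  | 0, _, _ => False
  | 1, L, R =>
      (∃ b : OrthonormalBasis (Fin (2 ^ 1)) ℝ (Euc 1), L = Submodule.span ℤ (Set.range b)) ∧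
        R = latAut L
  | d + 2, L, R =>
      ∃ (M : Submodule ℤ (Euc (d + 1))) (Q : Subgroup (Euc (d + 1) ≃ₗᵢ[ℝ] Euc (d + 1)))
        (f : Euc (d + 1) ≃ₗᵢ[ℝ] Euc (d + 1)) (ψ₁ ψ₂ : Euc (d + 1) →ₗᵢ[ℝ] Euc (d + 2)),
        IsBWPair (d + 1) M Q ∧ f ∈ Q ∧ IsFourvolution f ∧
        (∀ x y, inner ℝ (ψ₁ x) (ψ₂ y) = 0) ∧
        L = nextLattice ψ₁ ψ₂ f (((d + 2) % 2 : ℕ) : ℤ) M ∧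
        R = nextLower ψ₁ ψ₂ f (((d + 2) % 2 : ℕ) : ℤ) M Q

/-- `N_{Aut(L)}(R)`. -/
def autNormalizer {E : Type*} [NormedAddCommGroup E] [InnerProductSpace ℝ E]
    (L : Submodule ℤ E) (R : Subgroup (E ≃ₗᵢ[ℝ] E)) : Subgroup (E ≃ₗᵢ[ℝ] E) :=
  latAut L ⊓ Subgroup.normalizer (R : Set (E ≃ₗᵢ[ℝ] E))

end BarnesWall

end

/-! In suitable orthonormal coordinates the lower group is the standard extraspecial group on real
functions on `𝔽₂^d`. Its elements are `±D_v` with `v` in the quadratic space `𝔽₂^{2d}`; the square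
of `D_v` is `(-1)^{q(v)}`, and `D_v`, `D_w` commute up to `(-1)^{B(v,w)}`. Whatever normalizes this
group acts on the quadratic space by isometries, and by Schur's lemma the elements acting trivially
are the scalar multiples of the `D_v`. The theorem therefore asks which orthogonal transformations
are induced by automorphisms of the lattice, and whether the Bolt-Room-Wall group induces the same
ones.

The orthogonal group is generated by transvections and Siegel transformations. The transvection
along a nonsingular `v` is induced by `1 - D_v`, which multiplies the bilinear form by 2. The Siegel
transformation along orthogonal singular `x`, `w` is induced by the isometry `1 - (1 - D_x)(1 -
D_w)/2`. The kernel of the Dickson invariant is generated by Siegel transformations and products of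
two transvections (`closure_evenGens`), and the latter have the isometric lifts `(1 - D_v)(1 -
D_w)⁻¹ = (1 - D_v)(1 + D_w)/2`. These lifts and the `D_v` generate `brwGroup`, which consists of all
linear isometries inducing an even transformation (`mem_brwGroup_iff`). Commutator computations
(`derivedNormalizer_eq`) and, in small rank, a descent along `g ↦ g ⊗ 1` identify it with the
Bolt-Room-Wall group (`BRW0_eq`). Since the generators are rational, it is the same group over every
field of characteristic 0.

The lattice enters through one property, `SquareStable`: `(1 - g)(1 - h) L ⊆ 2 L` for all `g, h` in
the lower group. As the lower group contains `-D` along with `D`, this says exactly that the lifts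
above preserve the lattice. The property holds for the square lattice and passes to the successor
(`squareStable_gluedLattice`). Conversely, suppose an automorphism `g` in the normalizer induced an
odd transformation. Comparing `(1 - D_v) g` with the lift of an even transformation gives `(1 - p) g
= c b` with automorphisms `p`, `b` and `c² = 2`, which is impossible because inner products on the
lattice are rational. So the normalizer is `brwGroup` in coordinates
(`SquareStable.map_autNormalizer`). -/

namespace BarnesWall

set_option linter.unusedSectionVars false

/-! ### The quadratic space `𝔽₂^ι × 𝔽₂^ι` -/

section QuadraticSpace

variable {ι : Type*} [Fintype ι]

/-- The space `𝔽₂^ι × 𝔽₂^ι`. -/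
abbrev QS (ι : Type*) : Type _ := (ι → ZMod 2) × (ι → ZMod 2)

/-- The quadratic form `∑ aᵢ bᵢ`. -/
def qf (v : QS ι) : ZMod 2 := ∑ i, v.1 i * v.2 i

/-- The polar form of `qf`. -/
def bf : QS ι →ₗ[ZMod 2] QS ι →ₗ[ZMod 2] ZMod 2 :=
  LinearMap.mk₂ (ZMod 2) (fun v w => ∑ i, (v.1 i * w.2 i + w.1 i * v.2 i))
    (fun v v' w => by
      rw [← Finset.sum_add_distrib]; refine Finset.sum_congr rfl fun i _ => ?_
      simp only [Prod.fst_add, Prod.snd_add, Pi.add_apply]; ring)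
    (fun c v w => by
      rw [smul_eq_mul, Finset.mul_sum]; refine Finset.sum_congr rfl fun i _ => ?_
      simp only [Prod.smul_fst, Prod.smul_snd, Pi.smul_apply, smul_eq_mul]; ring)
    (fun v w w' => by
      rw [← Finset.sum_add_distrib]; refine Finset.sum_congr rfl fun i _ => ?_
      simp only [Prod.fst_add, Prod.snd_add, Pi.add_apply]; ring)
    (fun c v w => by
      rw [smul_eq_mul, Finset.mul_sum]; refine Finset.sum_congr rfl fun i _ => ?_
      simp only [Prod.smul_fst, Prod.smul_snd, Pi.smul_apply, smul_eq_mul]; ring)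

theorem bf_apply (v w : QS ι) : bf v w = ∑ i, (v.1 i * w.2 i + w.1 i * v.2 i) := rfl

theorem bf_comm (v w : QS ι) : bf v w = bf w v := by
  simp only [bf_apply]; exact Finset.sum_congr rfl fun i _ => by ring

theorem zmod_two_add_self (a : ZMod 2) : a + a = 0 := CharTwo.add_self_eq_zero a

theorem zmod_two_eq_zero_or_one (a : ZMod 2) : a = 0 ∨ a = 1 := by
  revert a; decide

theorem zmod_two_ne_zero {a : ZMod 2} (h : a ≠ 0) : a = 1 :=
  (zmod_two_eq_zero_or_one a).resolve_left h

theorem qs_add_self (v : QS ι) : v + v = 0 := by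
  ext i <;> exact zmod_two_add_self _

theorem qs_add_add_self (v w : QS ι) : v + w + w = v := by
  rw [add_assoc, qs_add_self, add_zero]

@[simp] theorem bf_self (v : QS ι) : bf v v = 0 := by
  rw [bf_apply]; exact Finset.sum_eq_zero fun i _ => zmod_two_add_self _

theorem qf_add (v w : QS ι) : qf (v + w) = qf v + qf w + bf v w := by
  simp only [qf, bf_apply, ← Finset.sum_add_distrib]
  refine Finset.sum_congr rfl fun i _ => ?_
  simp only [Prod.fst_add, Prod.snd_add, Pi.add_apply]; ring

@[simp] theorem qf_zero : qf (0 : QS ι) = 0 := by simp [qf]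

/-- The orthogonal group of `qf`. -/
def orthGroup (ι : Type*) [Fintype ι] : Subgroup (QS ι ≃ₗ[ZMod 2] QS ι) where
  carrier := {g | ∀ v, qf (g v) = qf v}
  mul_mem' {g h} hg hh v := (hg (h v)).trans (hh v)
  one_mem' _ := rfl
  inv_mem' {g} hg v := by
    have h := hg (g⁻¹ v)
    rw [show g (g⁻¹ v) = v from g.apply_symm_apply v] at h
    exact h.symm

theorem bf_map_of_mem_orthGroup {g : QS ι ≃ₗ[ZMod 2] QS ι} (hg : g ∈ orthGroup ι) (v w : QS ι) :
    bf (g v) (g w) = bf v w := by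
  have h := qf_add (g v) (g w)
  rw [← map_add, hg, hg, hg, qf_add] at h
  exact (add_left_cancel h).symm

variable [DecidableEq ι]

/-- The standard vectors of the first and of the second kind. -/
def eVec (i : ι) : QS ι := (Pi.single i 1, 0)

/-- The standard vectors of the second kind. -/
def fVec (i : ι) : QS ι := (0, Pi.single i 1)

@[simp] theorem bf_eVec (v : QS ι) (i : ι) : bf v (eVec i) = v.2 i := by
  simp [bf_apply, eVec, Pi.single_apply, ite_mul]

@[simp] theorem bf_fVec (v : QS ι) (i : ι) : bf v (fVec i) = v.1 i := by
  simp [bf_apply, fVec, Pi.single_apply, mul_ite]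

@[simp] theorem qf_eVec (i : ι) : qf (eVec i : QS ι) = 0 := by simp [qf, eVec]

@[simp] theorem qf_fVec (i : ι) : qf (fVec i : QS ι) = 0 := by simp [qf, fVec]

theorem linearMap_ext_eVec_fVec {M : Type*} [AddCommGroup M] [Module (ZMod 2) M]
    {g h : QS ι →ₗ[ZMod 2] M} (he : ∀ i, g (eVec i) = h (eVec i))
    (hf : ∀ i, g (fVec i) = h (fVec i)) : g = h := by
  refine LinearMap.prod_ext ?_ ?_ <;> refine LinearMap.pi_ext' fun i => LinearMap.ext_ring ?_
  · exact he i
  · exact hf i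

theorem bf_nondegenerate (x : QS ι) (hx : ∀ y, bf x y = 0) : x = 0 := by
  ext i
  · simpa using hx (fVec i)
  · simpa using hx (eVec i)

theorem exists_bf_eq (φ : QS ι →ₗ[ZMod 2] ZMod 2) : ∃ x : QS ι, ∀ y, φ y = bf x y := by
  refine ⟨(fun i => φ (fVec i), fun i => φ (eVec i)), fun y => ?_⟩
  have h : φ = bf ((fun i => φ (fVec i), fun i => φ (eVec i)) : QS ι) :=
    linearMap_ext_eVec_fVec (fun i => by rw [bf_eVec]) (fun i => by rw [bf_fVec])
  exact LinearMap.congr_fun h y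

/-- The transvection `u ↦ u + B(u,v) v`. -/
def transvec (v : QS ι) : QS ι ≃ₗ[ZMod 2] QS ι :=
  LinearEquiv.ofInvolutive (LinearMap.id + (bf v).smulRight v) fun u => by
    simp [add_assoc, qs_add_self]

theorem transvec_apply (v u : QS ι) : transvec v u = u + bf v u • v := rfl

theorem transvec_mul_self (v : QS ι) : transvec v * transvec v = 1 :=
  LinearEquiv.ext fun u => (transvec v).symm_apply_apply u

theorem transvec_inv (v : QS ι) : (transvec v)⁻¹ = transvec v :=
  inv_eq_of_mul_eq_one_left (transvec_mul_self v)

theorem transvec_mem {v : QS ι} (hv : qf v = 1) : transvec v ∈ orthGroup ι := fun u => by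
  rw [transvec_apply]
  rcases zmod_two_eq_zero_or_one (bf v u) with h | h
  · simp [h]
  · rw [h, one_smul, qf_add, bf_comm, h, hv, add_assoc, zmod_two_add_self, add_zero]

/-- The Siegel transformation `u ↦ u + B(u,x) w + B(u,w) x` attached to orthogonal vectors
`x`, `w`. -/
def siegel (x w : QS ι) (h : bf x w = 0) : QS ι ≃ₗ[ZMod 2] QS ι :=
  LinearEquiv.ofInvolutive (LinearMap.id + (bf x).smulRight w + (bf w).smulRight x) fun u => by
    have h' : bf w x = 0 := by rw [bf_comm, h]
    have key : ∀ a b c : QS ι, a + b + c + b + c = a := fun a b c => by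
      rw [add_right_comm (a + b) c b, qs_add_add_self, qs_add_add_self]
    simp [h, h', key]

theorem siegel_apply (x w : QS ι) (h : bf x w = 0) (u : QS ι) :
    siegel x w h u = u + bf x u • w + bf w u • x := rfl

theorem siegel_mem {x w : QS ι} (h : bf x w = 0) (hx : qf x = 0) (hw : qf w = 0) :
    siegel x w h ∈ orthGroup ι := fun u => by
  rw [siegel_apply]
  have h' : bf w x = 0 := by rw [bf_comm, h]
  rcases zmod_two_eq_zero_or_one (bf x u) with h1 | h1 <;>
  rcases zmod_two_eq_zero_or_one (bf w u) with h2 | h2 <;>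
  simp [h1, h2, qf_add, hx, hw, bf_comm u, h']
  rw [add_assoc, zmod_two_add_self, add_zero]

/-- The transvections and Siegel transformations of the quadratic space. -/
def orthGens (ι : Type*) [Fintype ι] : Set (QS ι ≃ₗ[ZMod 2] QS ι) :=
  {g | ∃ v, qf v = 1 ∧ g = transvec v} ∪
    {g | ∃ x w, ∃ h : bf x w = 0, qf x = 0 ∧ qf w = 0 ∧ g = siegel x w h}

theorem orthGens_subset : orthGens ι ⊆ orthGroup ι := by
  rintro g (⟨v, hv, rfl⟩ | ⟨x, w, h, hx, hw, rfl⟩)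
  · exact transvec_mem hv
  · exact siegel_mem h hx hw

/-- The vectors with vanishing coordinates over `S`. -/
def offSub (S : Finset ι) : Submodule (ZMod 2) (QS ι) where
  carrier := {v | ∀ i ∈ S, bf v (eVec i) = 0 ∧ bf v (fVec i) = 0}
  add_mem' {v w} hv hw i hi := by
    rw [map_add, LinearMap.add_apply, LinearMap.add_apply, (hv i hi).1, (hv i hi).2,
      (hw i hi).1, (hw i hi).2]
    exact ⟨rfl, rfl⟩
  zero_mem' i _ := by simp
  smul_mem' c v hv i hi := by
    rw [map_smul, LinearMap.smul_apply, LinearMap.smul_apply, (hv i hi).1, (hv i hi).2]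
    simp

theorem eVec_mem_offSub {S : Finset ι} {j : ι} (hj : j ∉ S) : eVec j ∈ offSub S := fun i hi => by
  have : i ≠ j := fun h => hj (h ▸ hi)
  rw [bf_eVec, bf_fVec]; simp [eVec, this]

theorem fVec_mem_offSub {S : Finset ι} {j : ι} (hj : j ∉ S) : fVec j ∈ offSub S := fun i hi => by
  have : i ≠ j := fun h => hj (h ▸ hi)
  rw [bf_eVec, bf_fVec]; simp [fVec, this]

/-- The form stays nondegenerate on `offSub S`: a member is orthogonal to the standard vectors over
`S` anyway, so if it were orthogonal to the others too it would lie in the radical. -/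
theorem exists_bf_eq_one_of_mem_offSub {S : Finset ι} {x : QS ι} (hx : x ∈ offSub S) (h0 : x ≠ 0) :
    ∃ z ∈ offSub S, bf x z = 1 := by
  by_contra! h
  refine h0 (bf_nondegenerate x fun y => ?_)
  have : bf x = 0 := by
    refine linearMap_ext_eVec_fVec (fun i => ?_) (fun i => ?_)
    · by_cases hi : i ∈ S
      · exact (hx i hi).1
      · exact (zmod_two_eq_zero_or_one _).resolve_right (h _ (eVec_mem_offSub hi))
    · by_cases hi : i ∈ S
      · exact (hx i hi).2
      · exact (zmod_two_eq_zero_or_one _).resolve_right (h _ (fVec_mem_offSub hi))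
  rw [this]; rfl

theorem exists_bf_eq_one_both {S : Finset ι} {x y : QS ι} (hx : x ∈ offSub S) (hx0 : x ≠ 0)
    (hy : y ∈ offSub S) (hy0 : y ≠ 0) : ∃ z ∈ offSub S, bf x z = 1 ∧ bf y z = 1 := by
  obtain ⟨z, hz, hxz⟩ := exists_bf_eq_one_of_mem_offSub hx hx0
  obtain ⟨z', hz', hyz'⟩ := exists_bf_eq_one_of_mem_offSub hy hy0
  rcases zmod_two_eq_zero_or_one (bf y z) with h | h
  · rcases zmod_two_eq_zero_or_one (bf x z') with h' | h'
    · exact ⟨z + z', add_mem hz hz', by rw [map_add, hxz, h', add_zero],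
        by rw [map_add, h, hyz', zero_add]⟩
    · exact ⟨z', hz', h', hyz'⟩
  · exact ⟨z, hz, hxz, h⟩

/-- The subgroup generated by the transvections and Siegel transformations along vectors of
`offSub S`. -/
def localGroup (S : Finset ι) : Subgroup (QS ι ≃ₗ[ZMod 2] QS ι) :=
  Subgroup.closure ({g | ∃ v ∈ offSub S, qf v = 1 ∧ g = transvec v} ∪
    {g | ∃ x ∈ offSub S, ∃ w ∈ offSub S, ∃ h : bf x w = 0, qf x = 0 ∧ qf w = 0 ∧ g = siegel x w h})

theorem transvec_mem_localGroup {S : Finset ι} {v : QS ι} (hv : v ∈ offSub S) (h : qf v = 1) :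
    transvec v ∈ localGroup S :=
  Subgroup.subset_closure (Or.inl ⟨v, hv, h, rfl⟩)

theorem localGroup_le_closure (S : Finset ι) :
    localGroup S ≤ Subgroup.closure (orthGens ι) := by
  refine Subgroup.closure_mono ?_
  rintro g (⟨v, -, hv, rfl⟩ | ⟨x, -, w, -, h, hx, hw, rfl⟩)
  · exact Or.inl ⟨v, hv, rfl⟩
  · exact Or.inr ⟨x, w, h, hx, hw, rfl⟩

/-- A generator changes `u` only by multiples of vectors of `offSub S`, with coefficients that are
pairings of `u` with such vectors. This lets a new hyperbolic pair be corrected without disturbing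
those already fixed. -/
theorem localGroup_fixes {S : Finset ι} {g : QS ι ≃ₗ[ZMod 2] QS ι} (hg : g ∈ localGroup S)
    {u : QS ι} (hu : ∀ v ∈ offSub S, bf v u = 0) : g u = u := by
  have hle : localGroup S ≤ MulAction.stabilizer (QS ι ≃ₗ[ZMod 2] QS ι) u := by
    refine (Subgroup.closure_le _).2 ?_
    rintro g (⟨v, hv, -, rfl⟩ | ⟨x, hx, w, hw, h, -, -, rfl⟩) <;>
      rw [SetLike.mem_coe, MulAction.mem_stabilizer_iff]
    · change transvec v u = u
      rw [transvec_apply, hu v hv, zero_smul, add_zero]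
    · change siegel x w h u = u
      rw [siegel_apply, hu x hx, hu w hw, zero_smul, zero_smul, add_zero, add_zero]
  exact hle hg

theorem transvec_add_apply {x y : QS ι} (h : bf x y = 1) : transvec (x + y) x = y := by
  rw [transvec_apply, map_add, LinearMap.add_apply, bf_self, bf_comm y x, h, zero_add, one_smul,
    ← add_assoc, qs_add_self, zero_add]

theorem qf_add_eq_one {x y : QS ι} (hxy : qf x = qf y) (h : bf x y = 1) : qf (x + y) = 1 := by
  rw [qf_add, hxy, h, zmod_two_add_self, zero_add]

theorem exists_singular_bf_eq_one_both {S : Finset ι} {x y : QS ι} (hx : x ∈ offSub S)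
    (hx0 : x ≠ 0) (hy : y ∈ offSub S) (hy0 : y ≠ 0) (hqx : qf x = 0) (hxy : bf x y = 0) :
    ∃ z ∈ offSub S, qf z = 0 ∧ bf x z = 1 ∧ bf y z = 1 := by
  obtain ⟨z, hz, hxz, hyz⟩ := exists_bf_eq_one_both hx hx0 hy hy0
  rcases zmod_two_eq_zero_or_one (qf z) with h | h
  · exact ⟨z, hz, h, hxz, hyz⟩
  · refine ⟨z + x, add_mem hz hx, ?_, ?_, ?_⟩
    · rw [qf_add, h, hqx, bf_comm, hxz]; rfl
    · rw [map_add, hxz, bf_self, add_zero]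
    · rw [map_add, hyz, bf_comm y x, hxy, add_zero]

/-- Singular vectors with pairing 1 are exchanged by the transvection along their sum, which is
nonsingular. Orthogonal ones are joined through a third singular vector that pairs to 1 with both.
-/
theorem localGroup_transitive_singular {S : Finset ι} {x y : QS ι} (hx : x ∈ offSub S)
    (hx0 : x ≠ 0) (hy : y ∈ offSub S) (hy0 : y ≠ 0) (hqx : qf x = 0) (hqy : qf y = 0) :
    ∃ g ∈ localGroup S, g x = y := by
  rcases zmod_two_eq_zero_or_one (bf x y) with h | h
  · obtain ⟨z, hz, hqz, hxz, hyz⟩ := exists_singular_bf_eq_one_both hx hx0 hy hy0 hqx h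
    refine ⟨transvec (z + y) * transvec (x + z), mul_mem
      (transvec_mem_localGroup (add_mem hz hy) ?_) (transvec_mem_localGroup (add_mem hx hz) ?_), ?_⟩
    · exact qf_add_eq_one (hqz.trans hqy.symm) (by rw [bf_comm, hyz])
    · exact qf_add_eq_one (hqx.trans hqz.symm) hxz
    · change transvec (z + y) (transvec (x + z) x) = y
      rw [transvec_add_apply hxz, transvec_add_apply (by rw [bf_comm, hyz])]
  · exact ⟨_, transvec_mem_localGroup (add_mem hx hy)
      (qf_add_eq_one (hqx.trans hqy.symm) h), transvec_add_apply h⟩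

/-- The vector `y + f` is orthogonal to `e`. If it is nonsingular, its transvection does the job; if
it is singular, a transvection is not available and the Siegel transformation along `e` and `y + f`
takes its place. -/
theorem localGroup_transitive_pairs {S : Finset ι} {e f y : QS ι} (he : e ∈ offSub S)
    (hf : f ∈ offSub S) (hy : y ∈ offSub S) (hqe : qf e = 0) (hqf : qf f = 0) (hqy : qf y = 0)
    (hef : bf e f = 1) (hey : bf e y = 1) :
    ∃ g ∈ localGroup S, g e = e ∧ g y = f := by
  rcases zmod_two_eq_zero_or_one (bf y f) with h | h
  · have hew : bf e (y + f) = 0 := by rw [map_add, hef, hey]; rfl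
    refine ⟨siegel e (y + f) hew, Subgroup.subset_closure
      (Or.inr ⟨e, he, y + f, add_mem hy hf, hew, hqe, ?_, rfl⟩), ?_, ?_⟩
    · rw [qf_add, hqy, hqf, h]; rfl
    · rw [siegel_apply, bf_comm (y + f) e, hew]; simp
    · rw [siegel_apply, hey, map_add, LinearMap.add_apply, bf_self, bf_comm f y, h]
      simp [← add_assoc, qs_add_self]
  · refine ⟨transvec (y + f), transvec_mem_localGroup (add_mem hy hf)
      (qf_add_eq_one (hqy.trans hqf.symm) h), ?_, transvec_add_apply h⟩
    rw [transvec_apply, bf_comm, map_add, hef, hey]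
    simp [zmod_two_add_self]

/-- Witt's argument: hyperbolic pairs are brought back to the standard ones one at a time, each
correction taken from `localGroup S` with `S` the set of pairs already treated. -/
theorem exists_mul_fixes {g : QS ι ≃ₗ[ZMod 2] QS ι} (hg : g ∈ orthGroup ι) (S : Finset ι) :
    ∃ h ∈ Subgroup.closure (orthGens ι), ∀ i ∈ S, (h * g) (eVec i) = eVec i ∧
      (h * g) (fVec i) = fVec i := by
  induction S using Finset.induction_on with
  | empty => exact ⟨1, one_mem _, by simp⟩
  | insert j S hj ih =>
    obtain ⟨h, hh, hfix⟩ := ih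
    set k := h * g with hk
    have hkO : k ∈ orthGroup ι :=
      mul_mem (((Subgroup.closure_le _).2 orthGens_subset) hh) hg
    -- An isometry fixing the standard pairs over `S` preserves their orthogonal complement.
    have hoff : ∀ v ∈ offSub S, k v ∈ offSub S := fun v hv i hi => by
      constructor
      · rw [← (hfix i hi).1, bf_map_of_mem_orthGroup hkO]; exact (hv i hi).1
      · rw [← (hfix i hi).2, bf_map_of_mem_orthGroup hkO]; exact (hv i hi).2
    have hej : (eVec j : QS ι) ≠ 0 := fun h0 => by
      have := congrFun (congrArg Prod.fst h0) j
      simp [eVec] at this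
    have hef : bf (eVec j : QS ι) (fVec j) = 1 := by simp [eVec]
    obtain ⟨g1, hg1, h1⟩ := localGroup_transitive_singular (S := S)
      (hoff _ (eVec_mem_offSub hj)) (k.map_ne_zero_iff.2 hej) (eVec_mem_offSub hj) hej
      ((hkO _).trans (qf_eVec j)) (qf_eVec j)
    have hlocO : localGroup S ≤ orthGroup ι :=
      (localGroup_le_closure S).trans ((Subgroup.closure_le _).2 orthGens_subset)
    have hfixS : ∀ (l) (_ : l ∈ localGroup S), ∀ i ∈ S, l (eVec i) = eVec i ∧ l (fVec i) = fVec i :=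
      fun l hl i hi => ⟨localGroup_fixes hl fun v hv => (hv i hi).1,
        localGroup_fixes hl fun v hv => (hv i hi).2⟩
    have hy : g1 (k (fVec j)) ∈ offSub S := fun i hi => by
      have h := hoff _ (fVec_mem_offSub hj) i hi
      constructor
      · rw [← (hfixS g1 hg1 i hi).1, bf_map_of_mem_orthGroup (hlocO hg1)]; exact h.1
      · rw [← (hfixS g1 hg1 i hi).2, bf_map_of_mem_orthGroup (hlocO hg1)]; exact h.2
    obtain ⟨g2, hg2, h2, h3⟩ := localGroup_transitive_pairs (S := S) (eVec_mem_offSub hj)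
      (fVec_mem_offSub hj) hy (qf_eVec j) (qf_fVec j)
      ((hlocO hg1 _).trans ((hkO _).trans (qf_fVec j))) hef
      (by rw [← h1, bf_map_of_mem_orthGroup (hlocO hg1), bf_map_of_mem_orthGroup hkO, hef])
    refine ⟨g2 * g1 * h, mul_mem (mul_mem (localGroup_le_closure S hg2)
      (localGroup_le_closure S hg1)) hh, fun i hi => ?_⟩
    have hmul : ∀ u, (g2 * g1 * h * g) u = g2 (g1 (k u)) := fun u => rfl
    rw [hmul, hmul]
    rcases Finset.mem_insert.1 hi with rfl | hi
    · exact ⟨by rw [h1, h2], h3⟩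
    · have := hfix i hi
      rw [this.1, this.2, (hfixS g1 hg1 i hi).1, (hfixS g1 hg1 i hi).2]
      exact hfixS g2 hg2 i hi

/-- The orthogonal group is generated by transvections and Siegel transformations. -/
theorem closure_orthGens : Subgroup.closure (orthGens ι) = orthGroup ι := by
  refine le_antisymm ((Subgroup.closure_le _).2 orthGens_subset) fun g hg => ?_
  obtain ⟨h, hh, hfix⟩ := exists_mul_fixes hg Finset.univ
  have h1 : h * g = 1 := LinearEquiv.toLinearMap_injective (linearMap_ext_eVec_fVec
    (fun i => (hfix i (Finset.mem_univ i)).1) fun i => (hfix i (Finset.mem_univ i)).2)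
  rw [← inv_eq_of_mul_eq_one_right h1]
  exact inv_mem hh

end QuadraticSpace

/-! ### The Dickson invariant as a homomorphism, and generators of its kernel. -/

section Dickson

variable {ι : Type*} [Fintype ι] [DecidableEq ι]

theorem bf_isRefl : (bf : LinearMap.BilinForm (ZMod 2) (QS ι)).IsRefl := fun x y h => by
  rw [bf_comm, h]

theorem bf_nondeg : (bf : LinearMap.BilinForm (ZMod 2) (QS ι)).Nondegenerate := by
  refine ⟨fun x hx => bf_nondegenerate x hx, fun x hx => bf_nondegenerate x fun y => ?_⟩
  rw [bf_comm, hx]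

theorem finrank_qs : Module.finrank (ZMod 2) (QS ι) = 2 * Fintype.card ι := by
  simp [Module.finrank_prod, two_mul]

/-- If `|ι| ≥ 3`, the orthogonal complement of two vectors is not totally isotropic. -/
theorem exists_orthogonal_bf_eq_one (h3 : 3 ≤ Fintype.card ι) (v w : QS ι) :
    ∃ a b : QS ι, bf v a = 0 ∧ bf w a = 0 ∧ bf v b = 0 ∧ bf w b = 0 ∧ bf a b = 1 := by
  by_contra! h
  let W : Submodule (ZMod 2) (QS ι) := Submodule.span (ZMod 2) {v, w}
  have hW : Module.finrank (ZMod 2) W ≤ 2 := by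
    refine (finrank_span_le_card _).trans ?_
    classical
    rw [← Set.ncard_eq_toFinset_card']
    exact (Set.ncard_insert_le _ _).trans (by simp)
  have hfin := LinearMap.BilinForm.finrank_orthogonal bf_nondeg W
  -- A totally isotropic complement would lie in its own complement, which is `W` of dimension at
  -- most 2, whereas its dimension is at least `6 - 2`.
  have hle : LinearMap.BilinForm.orthogonal bf W ≤ W := by
    intro b hb
    rw [← LinearMap.BilinForm.orthogonal_orthogonal bf_nondeg bf_isRefl W]
    refine LinearMap.BilinForm.mem_orthogonal_iff.2 fun a ha => ?_
    have hv : v ∈ W := Submodule.subset_span (by simp)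
    have hw : w ∈ W := Submodule.subset_span (by simp)
    exact (zmod_two_eq_zero_or_one _).resolve_right
      (h a b (ha v hv) (ha w hw) (hb v hv) (hb w hw))
  have := Submodule.finrank_mono hle
  rw [finrank_qs] at hfin
  omega

/-- The form `qf + l` has the same polar form as `qf`, so its values at `a`, `b` and `a + b` sum to
`bf a b = 1` and one of them is 1. The linear term accommodates the shift `qf (z + u) = qf z + qf u
+ bf z u`. -/
theorem exists_orthogonal_quadratic_eq_one (h3 : 3 ≤ Fintype.card ι) (v w : QS ι)
    (l : QS ι →ₗ[ZMod 2] ZMod 2) : ∃ u : QS ι, qf u + l u = 1 ∧ bf v u = 0 ∧ bf w u = 0 := by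
  obtain ⟨a, b, hva, hwa, hvb, hwb, hab⟩ := exists_orthogonal_bf_eq_one h3 v w
  rcases zmod_two_eq_zero_or_one (qf a + l a) with ha | ha
  · rcases zmod_two_eq_zero_or_one (qf b + l b) with hb | hb
    · refine ⟨a + b, ?_, by rw [map_add, hva, hvb, add_zero], by rw [map_add, hwa, hwb, add_zero]⟩
      rw [qf_add, map_add, hab]
      linear_combination ha + hb
    · exact ⟨b, hb, hvb, hwb⟩
  · exact ⟨a, ha, hva, hwa⟩

theorem exists_orthogonal_nonsingular (h3 : 3 ≤ Fintype.card ι) (v w : QS ι) :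
    ∃ u : QS ι, qf u = 1 ∧ bf v u = 0 ∧ bf w u = 0 := by
  simpa using exists_orthogonal_quadratic_eq_one h3 v w 0

/-- Both sides add to `z` a combination of `u`, `x`, `w` whose coefficients depend only on the
pairings of `z` with these three vectors, so eight cases and a coordinatewise check over `𝔽₂`
suffice. -/
theorem siegel_eq_mul_transvec {x w u : QS ι} (h : bf x w = 0) (hx : bf x u = 0)
    (hw : bf w u = 0) : siegel x w h =
      transvec u * transvec (u + x) * (transvec (u + w) * transvec (u + x + w)) := by
  refine LinearEquiv.ext fun z => ?_
  have h' : bf w x = 0 := by rw [bf_comm, h]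
  have hx' : bf u x = 0 := by rw [bf_comm, hx]
  have hw' : bf u w = 0 := by rw [bf_comm, hw]
  change _ = transvec u (transvec (u + x) (transvec (u + w) (transvec (u + x + w) z)))
  simp only [siegel_apply, transvec_apply, map_add, LinearMap.add_apply, map_smul, bf_self, h, h',
    hx, hx', hw, hw', add_zero]
  generalize bf x z = a
  generalize bf w z = b
  generalize bf u z = c
  rcases zmod_two_eq_zero_or_one a with rfl | rfl <;>
  rcases zmod_two_eq_zero_or_one b with rfl | rfl <;>
  rcases zmod_two_eq_zero_or_one c with rfl | rfl <;>
  ext i <;> simp only [Prod.fst_add, Prod.snd_add, Pi.add_apply, Prod.smul_fst, Prod.smul_snd,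
    Pi.smul_apply, smul_eq_mul]
  all_goals first
    | (generalize u.1 i = a; generalize x.1 i = b; generalize w.1 i = c; generalize z.1 i = d
       revert a b c d; decide)
    | (generalize u.2 i = a; generalize x.2 i = b; generalize w.2 i = c; generalize z.2 i = d
       revert a b c d; decide)

/-- For `|ι| ≥ 3` a Siegel transformation is a product of four transvections. -/
theorem exists_siegel_eq (h3 : 3 ≤ Fintype.card ι) {x w : QS ι} (h : bf x w = 0)
    (hx : qf x = 0) (hw : qf w = 0) : ∃ a b c d : QS ι, qf a = 1 ∧ qf b = 1 ∧ qf c = 1 ∧ qf d = 1 ∧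
      siegel x w h = transvec a * transvec b * (transvec c * transvec d) := by
  obtain ⟨u, hu, hxu, hwu⟩ := exists_orthogonal_nonsingular h3 x w
  have hux : bf u x = 0 := by rw [bf_comm, hxu]
  have huw : bf u w = 0 := by rw [bf_comm, hwu]
  refine ⟨u, u + x, u + w, u + x + w, hu, ?_, ?_, ?_, siegel_eq_mul_transvec h hxu hwu⟩ <;>
    simp [qf_add, hu, hx, hw, hux, huw, h]

/-- As for singular vectors: pairing 1 is settled by one transvection, pairing 0 by a nonsingular
vector that pairs to 1 with both. Transitivity later turns quotients of transvection lifts into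
commutators. -/
theorem exists_map_eq_of_nonsingular (h3 : 3 ≤ Fintype.card ι) {v w : QS ι} (hv : qf v = 1)
    (hw : qf w = 1) : ∃ g ∈ orthGroup ι, g v = w := by
  have step : ∀ {v w : QS ι}, qf v = 1 → qf w = 1 → bf v w = 1 → ∃ g ∈ orthGroup ι, g v = w :=
    fun {v w} hv hw h => ⟨transvec (v + w), transvec_mem (qf_add_eq_one (hv.trans hw.symm) h),
      transvec_add_apply h⟩
  rcases zmod_two_eq_zero_or_one (bf v w) with h | h
  · rcases eq_or_ne v w with rfl | hne
    · exact ⟨1, one_mem _, rfl⟩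
    have hne0 : ∀ {v : QS ι}, qf v = 1 → v ≠ 0 := fun {v} hv h0 => by
      rw [h0, qf_zero] at hv; exact zero_ne_one hv
    obtain ⟨z, -, hvz, hwz⟩ := exists_bf_eq_one_both (S := ∅) (x := v) (y := w)
      (fun i hi => absurd hi (Finset.notMem_empty i)) (hne0 hv)
      (fun i hi => absurd hi (Finset.notMem_empty i)) (hne0 hw)
    have : ∃ z : QS ι, qf z = 1 ∧ bf v z = 1 ∧ bf w z = 1 := by
      rcases zmod_two_eq_zero_or_one (qf z) with hz | hz
      · obtain ⟨u, hu, hvu, hwu⟩ := exists_orthogonal_quadratic_eq_one h3 v w (bf z)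
        exact ⟨z + u, by rw [qf_add, hz, zero_add, hu], by rw [map_add, hvz, hvu, add_zero],
          by rw [map_add, hwz, hwu, add_zero]⟩
      · exact ⟨z, hz, hvz, hwz⟩
    obtain ⟨z, hz, hvz, hwz⟩ := this
    obtain ⟨g, hg, hgv⟩ := step hv hz hvz
    obtain ⟨g', hg', hgz⟩ := step hz hw (by rw [bf_comm, hwz])
    exact ⟨g' * g, mul_mem hg' hg, by change g' (g v) = w; rw [hgv, hgz]⟩
  · exact step hv hw h

/-! ### The Dickson invariant -/

/-- The parity of the rank of `g - 1`. -/
noncomputable def dickson (g : QS ι ≃ₗ[ZMod 2] QS ι) : ZMod 2 :=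
  (Module.finrank (ZMod 2) (LinearMap.range ((g : QS ι →ₗ[ZMod 2] QS ι) - LinearMap.id)) : ZMod 2)

/-- The fixed space of `g`. -/
def fixedSpace (g : QS ι ≃ₗ[ZMod 2] QS ι) : Submodule (ZMod 2) (QS ι) :=
  LinearMap.ker ((g : QS ι →ₗ[ZMod 2] QS ι) - LinearMap.id)

theorem mem_fixedSpace {g : QS ι ≃ₗ[ZMod 2] QS ι} {x : QS ι} : x ∈ fixedSpace g ↔ g x = x := by
  simp [fixedSpace, sub_eq_zero]

/-- The ambient dimension is even, so rank and nullity of `g - 1` have the same parity. -/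
theorem dickson_eq (g : QS ι ≃ₗ[ZMod 2] QS ι) :
    dickson g = (Module.finrank (ZMod 2) (fixedSpace g) : ZMod 2) := by
  have h := LinearMap.finrank_range_add_finrank_ker
    ((g : QS ι →ₗ[ZMod 2] QS ι) - LinearMap.id)
  rw [finrank_qs] at h
  have h2 := congrArg (Nat.cast : ℕ → ZMod 2) h
  push_cast at h2
  rw [show (2 : ZMod 2) = 0 from rfl, zero_mul] at h2
  exact eq_of_sub_eq_zero (by rw [CharTwo.sub_eq_add]; exact h2)

theorem finrank_inf_ker {V : Type*} [AddCommGroup V] [Module (ZMod 2) V]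
    [FiniteDimensional (ZMod 2) V] (K : Submodule (ZMod 2) V) (l : V →ₗ[ZMod 2] ZMod 2) {x : V}
    (hx : x ∈ K) (hl : l x = 1) :
    Module.finrank (ZMod 2) K = Module.finrank (ZMod 2) (K ⊓ LinearMap.ker l : Submodule _ _) + 1 := by
  have h := LinearMap.finrank_range_add_finrank_ker (l.domRestrict K)
  have hr : LinearMap.range (l.domRestrict K) = ⊤ := by
    refine LinearMap.range_eq_top.2 fun c => ⟨c • ⟨x, hx⟩, ?_⟩
    simp [hl]
  rw [hr, finrank_top, Module.finrank_self] at h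
  have hk : LinearMap.ker (l.domRestrict K) = (K ⊓ LinearMap.ker l).comap K.subtype := by
    ext y; simp
  rw [hk, (Submodule.comapSubtypeEquivOfLe (inf_le_left : K ⊓ LinearMap.ker l ≤ K)).finrank_eq] at h
  omega

/-- If the transvection moved `h y`, then `h y + v = y`. Pairing with the `h`-fixed vector `x` gives
`bf (h y) x + 1 = bf y x`, contrary to `bf (h y) x = bf (h y) (h x) = bf y x`. -/
theorem fixedSpace_transvec_mul {h : QS ι ≃ₗ[ZMod 2] QS ι} (hh : h ∈ orthGroup ι) {v x : QS ι}
    (hx : h x = x) (hv : bf v x = 1) :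
    fixedSpace (transvec v * h) = fixedSpace h ⊓ LinearMap.ker (bf v) := by
  ext y
  rw [Submodule.mem_inf, mem_fixedSpace, mem_fixedSpace, LinearMap.mem_ker]
  change transvec v (h y) = y ↔ _
  rw [transvec_apply]
  rcases zmod_two_eq_zero_or_one (bf v (h y)) with h0 | h0
  · rw [h0, zero_smul, add_zero]
    exact ⟨fun e => ⟨e, by rw [← e, h0]⟩, fun e => e.1⟩
  · rw [h0, one_smul]
    constructor
    · intro e
      exfalso
      have e2 : bf (h y + v) x = bf y x := by rw [e]
      rw [map_add, LinearMap.add_apply, hv] at e2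
      nth_rewrite 1 [← hx] at e2
      rw [bf_map_of_mem_orthGroup hh] at e2
      exact one_ne_zero (add_eq_left.1 e2)
    · rintro ⟨e1, e2⟩
      rw [e1, e2] at h0
      exact absurd h0 zero_ne_one

theorem dickson_transvec_mul_aux {h : QS ι ≃ₗ[ZMod 2] QS ι} (hh : h ∈ orthGroup ι) {v x : QS ι}
    (hx : h x = x) (hv : bf v x = 1) : dickson h = dickson (transvec v * h) + 1 := by
  rw [dickson_eq, dickson_eq, fixedSpace_transvec_mul hh hx hv,
    finrank_inf_ker _ (bf v) (mem_fixedSpace.2 hx) hv]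
  push_cast; rfl

/-- Either some fixed vector of `g` is not orthogonal to `v`, and multiplication by the transvection
cuts the fixed space down by a hyperplane; or `v` lies in the image of `g - 1`, and then the same
applies with the roles of `g` and `transvec v * g` exchanged. -/
theorem dickson_transvec_mul {g : QS ι ≃ₗ[ZMod 2] QS ι} (hg : g ∈ orthGroup ι) {v : QS ι}
    (hv : qf v = 1) : dickson (transvec v * g) = dickson g + 1 := by
  by_cases hfix : ∃ x, g x = x ∧ bf v x = 1
  · obtain ⟨x, hx, hvx⟩ := hfix
    rw [dickson_transvec_mul_aux hg hx hvx, add_assoc, zmod_two_add_self, add_zero]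
  · push Not at hfix
    -- A functional vanishing on the image of `g - 1` but not at `v` is the pairing with a fixed
    -- vector of `g`, which was excluded.
    have hrange : v ∈ LinearMap.range ((g : QS ι →ₗ[ZMod 2] QS ι) - LinearMap.id) := by
      by_contra hn
      obtain ⟨l, hl, hle⟩ := Submodule.exists_le_ker_of_notMem hn
      obtain ⟨x, hx⟩ := exists_bf_eq l
      have hxg : ∀ y, bf x (g y) = bf x y := fun y => by
        have := hle ⟨y, rfl⟩
        rw [LinearMap.mem_ker, LinearMap.sub_apply, map_sub, hx, hx, sub_eq_zero] at this
        exact this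
      have hgx : g x = x := by
        refine sub_eq_zero.1 (bf_nondegenerate _ fun y => ?_)
        obtain ⟨y, rfl⟩ := g.surjective y
        rw [map_sub, LinearMap.sub_apply, bf_map_of_mem_orthGroup hg, hxg, sub_self]
      refine hfix x hgx ?_
      rw [bf_comm, ← hx]
      exact zmod_two_ne_zero hl
    obtain ⟨x, hx⟩ := hrange
    have hgx : g x = x + v := by
      rw [← hx]; simp
    -- Since `g x = x + v` has the same value of `qf` as `x`, the terms `qf v = 1` and `bf x v` must
    -- cancel.
    have h1 : bf v x = 1 := by
      have := hg x
      rw [hgx, qf_add, hv, add_assoc, add_eq_left, bf_comm] at this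
      rw [← zmod_two_add_self 1] at this
      exact add_left_cancel this
    have hTg : (transvec v * g) x = x := by
      change transvec v (g x) = x
      rw [hgx, transvec_apply, map_add, h1, bf_self, add_zero, one_smul, qs_add_add_self]
    have := dickson_transvec_mul_aux (mul_mem (transvec_mem hv) hg) hTg h1
    rwa [← mul_assoc, transvec_mul_self, one_mul] at this

@[simp] theorem dickson_one : dickson (1 : QS ι ≃ₗ[ZMod 2] QS ι) = 0 := by
  have : ((1 : QS ι ≃ₗ[ZMod 2] QS ι) : QS ι →ₗ[ZMod 2] QS ι) - LinearMap.id = 0 := sub_self _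
  rw [dickson, this, LinearMap.range_zero, finrank_bot, Nat.cast_zero]

theorem dickson_transvec {v : QS ι} (hv : qf v = 1) : dickson (transvec v) = 1 := by
  have := dickson_transvec_mul (one_mem (orthGroup ι)) hv
  rwa [mul_one, dickson_one, zero_add] at this

theorem closure_transvec (h3 : 3 ≤ Fintype.card ι) :
    Subgroup.closure {g | ∃ v : QS ι, qf v = 1 ∧ g = transvec v} = orthGroup ι := by
  rw [← closure_orthGens, orthGens]
  refine le_antisymm (Subgroup.closure_mono Set.subset_union_left) ((Subgroup.closure_le _).2 ?_)
  have hT : ∀ {v : QS ι}, qf v = 1 → transvec v ∈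
      Subgroup.closure {g | ∃ v : QS ι, qf v = 1 ∧ g = transvec v} :=
    fun {v} hv => Subgroup.subset_closure ⟨v, hv, rfl⟩
  rintro g (hg | ⟨x, w, h, hx, hw, rfl⟩)
  · exact Subgroup.subset_closure hg
  · obtain ⟨a, b, c, d, ha, hb, hc, hd, e⟩ := exists_siegel_eq h3 h hx hw
    rw [e]
    exact mul_mem (mul_mem (hT ha) (hT hb)) (mul_mem (hT hc) (hT hd))

theorem dickson_mul_of_card (h3 : 3 ≤ Fintype.card ι) {g h : QS ι ≃ₗ[ZMod 2] QS ι}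
    (hg : g ∈ orthGroup ι) (hh : h ∈ orthGroup ι) : dickson (g * h) = dickson g + dickson h := by
  have hg' := hg
  rw [← closure_transvec h3] at hg'
  induction hg' using Subgroup.closure_induction_left generalizing h with
  | one => rw [one_mul, dickson_one, zero_add]
  | mul_left x hx y hy ih =>
    obtain ⟨v, hv, rfl⟩ := hx
    rw [closure_transvec h3] at hy
    rw [mul_assoc, dickson_transvec_mul (mul_mem hy hh) hv, ih hy hh, dickson_transvec_mul hy hv]
    ring
  | inv_mul_cancel x hx y hy ih =>
    obtain ⟨v, hv, rfl⟩ := hx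
    rw [closure_transvec h3] at hy
    rw [transvec_inv, mul_assoc, dickson_transvec_mul (mul_mem hy hh) hv, ih hy hh,
      dickson_transvec_mul hy hv]
    ring

variable {κ : Type*} [Fintype κ] [DecidableEq κ]

/-- The decomposition of the quadratic space over a disjoint union. -/
def splitQS (ι κ : Type*) : QS (ι ⊕ κ) ≃ₗ[ZMod 2] QS ι × QS κ where
  toFun v := ((v.1 ∘ Sum.inl, v.2 ∘ Sum.inl), (v.1 ∘ Sum.inr, v.2 ∘ Sum.inr))
  invFun p := (Sum.elim p.1.1 p.2.1, Sum.elim p.1.2 p.2.2)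
  map_add' _ _ := rfl
  map_smul' _ _ := rfl
  left_inv v := by simp only [Sum.elim_comp_inl_inr]
  right_inv p := rfl

theorem splitQS_symm_apply (p : QS ι × QS κ) :
    (splitQS ι κ).symm p = (Sum.elim p.1.1 p.2.1, Sum.elim p.1.2 p.2.2) := rfl

theorem qf_splitQS_symm (p : QS ι × QS κ) : qf ((splitQS ι κ).symm p) = qf p.1 + qf p.2 := by
  simp [qf, splitQS_symm_apply]

/-- The extension of `g` by the identity. -/
def extQS (κ : Type*) (g : QS ι ≃ₗ[ZMod 2] QS ι) : QS (ι ⊕ κ) ≃ₗ[ZMod 2] QS (ι ⊕ κ) :=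
  (splitQS ι κ).trans ((g.prodCongr (LinearEquiv.refl _ _)).trans (splitQS ι κ).symm)

theorem extQS_apply (g : QS ι ≃ₗ[ZMod 2] QS ι) (p : QS ι × QS κ) :
    extQS κ g ((splitQS ι κ).symm p) = (splitQS ι κ).symm (g p.1, p.2) := rfl

theorem extQS_mul (g h : QS ι ≃ₗ[ZMod 2] QS ι) : extQS κ (g * h) = extQS κ g * extQS κ h := rfl

theorem extQS_mem {g : QS ι ≃ₗ[ZMod 2] QS ι} :
    extQS κ g ∈ orthGroup (ι ⊕ κ) ↔ g ∈ orthGroup ι := by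
  constructor
  · intro h v
    have := h ((splitQS ι κ).symm (v, 0))
    rw [extQS_apply, qf_splitQS_symm, qf_splitQS_symm] at this
    exact add_right_cancel this
  · intro h v
    obtain ⟨p, rfl⟩ := (splitQS ι κ).symm.surjective v
    rw [extQS_apply, qf_splitQS_symm, qf_splitQS_symm]
    exact congrArg (· + qf p.2) (h p.1)

theorem dickson_extQS (g : QS ι ≃ₗ[ZMod 2] QS ι) : dickson (extQS κ g) = dickson g := by
  let l : QS ι →ₗ[ZMod 2] QS (ι ⊕ κ) := (splitQS ι κ).symm.toLinearMap ∘ₗ LinearMap.inl _ _ _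
  have h : ((extQS κ g : QS (ι ⊕ κ) →ₗ[ZMod 2] QS (ι ⊕ κ)) - LinearMap.id) =
      (l ∘ₗ ((g : QS ι →ₗ[ZMod 2] QS ι) - LinearMap.id)) ∘ₗ
        (LinearMap.fst _ _ _ ∘ₗ (splitQS ι κ).toLinearMap) := by
    refine LinearMap.ext fun v => ?_
    obtain ⟨p, rfl⟩ := (splitQS ι κ).symm.surjective v
    change extQS κ g ((splitQS ι κ).symm p) - (splitQS ι κ).symm p =
      (splitQS ι κ).symm (g p.1 - p.1, 0)
    rw [extQS_apply, ← map_sub]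
    exact congrArg _ (Prod.ext rfl (sub_self _))
  have hl : Function.Injective l :=
    (splitQS ι κ).symm.injective.comp LinearMap.inl_injective
  have hs : LinearMap.range (LinearMap.fst (ZMod 2) (QS ι) (QS κ) ∘ₗ
      (splitQS ι κ).toLinearMap) = ⊤ :=
    LinearMap.range_eq_top.2 (Prod.fst_surjective.comp (splitQS ι κ).surjective)
  rw [dickson, dickson, h, LinearMap.range_comp_of_range_eq_top _ hs, LinearMap.range_comp,
    (Submodule.equivMapOfInjective l hl _).symm.finrank_eq]

/-- Adding three hyperbolic planes on which `g` is the identity leaves the rank of `g - 1` unchanged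
and reaches the range in which transvections are known to generate. -/
theorem dickson_mul {g h : QS ι ≃ₗ[ZMod 2] QS ι} (hg : g ∈ orthGroup ι) (hh : h ∈ orthGroup ι) :
    dickson (g * h) = dickson g + dickson h := by
  rw [← dickson_extQS (κ := Fin 3), ← dickson_extQS (κ := Fin 3) g, ← dickson_extQS (κ := Fin 3) h,
    extQS_mul, dickson_mul_of_card (by simp) (extQS_mem.2 hg) (extQS_mem.2 hh)]

theorem dickson_inv {g : QS ι ≃ₗ[ZMod 2] QS ι} (hg : g ∈ orthGroup ι) :
    dickson g⁻¹ = dickson g := by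
  have := dickson_mul hg (inv_mem hg)
  rw [mul_inv_cancel, dickson_one] at this
  rw [← add_zero (dickson g), this, ← add_assoc, zmod_two_add_self, zero_add]

/-- After the same enlargement the transformation is still a Siegel transformation, now a product of
four transvections. -/
theorem dickson_siegel {x w : QS ι} (h : bf x w = 0) (hx : qf x = 0) (hw : qf w = 0) :
    dickson (siegel x w h) = 0 := by
  let i : QS ι → QS (ι ⊕ Fin 3) := fun v => (splitQS ι (Fin 3)).symm (v, 0)
  have hq : ∀ v, qf (i v) = qf v := fun v => by
    rw [qf_splitQS_symm, qf_zero, add_zero]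
  have hb : ∀ (v : QS ι) (p : QS ι × QS (Fin 3)),
      bf (i v) ((splitQS ι (Fin 3)).symm p) = bf v p.1 := fun v p => by
    simp [bf_apply, i, splitQS_symm_apply]
  have h' : bf (i x) (i w) = 0 := by rw [hb, h]
  have hext : extQS (Fin 3) (siegel x w h) = siegel (i x) (i w) h' := by
    refine LinearEquiv.ext fun v => ?_
    obtain ⟨p, rfl⟩ := (splitQS ι (Fin 3)).symm.surjective v
    rw [extQS_apply, siegel_apply, siegel_apply, hb, hb, ← map_smul, ← map_smul, ← map_add,
      ← map_add]
    exact congrArg _ (Prod.ext rfl (by simp))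
  obtain ⟨a, b, c, d, ha, hb, hc, hd, e⟩ := exists_siegel_eq (by simp) h'
    ((hq x).trans hx) ((hq w).trans hw)
  rw [← dickson_extQS (κ := Fin 3), hext, e,
    dickson_mul (mul_mem (transvec_mem ha) (transvec_mem hb))
      (mul_mem (transvec_mem hc) (transvec_mem hd)),
    dickson_mul (transvec_mem ha) (transvec_mem hb),
    dickson_mul (transvec_mem hc) (transvec_mem hd), dickson_transvec ha, dickson_transvec hb,
    dickson_transvec hc, dickson_transvec hd]
  rfl

/-- The kernel of the Dickson invariant. -/
def evenGroup (ι : Type*) [Fintype ι] [DecidableEq ι] : Subgroup (QS ι ≃ₗ[ZMod 2] QS ι) where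
  carrier := {g | g ∈ orthGroup ι ∧ dickson g = 0}
  mul_mem' {g h} hg hh := ⟨mul_mem hg.1 hh.1, by rw [dickson_mul hg.1 hh.1, hg.2, hh.2, add_zero]⟩
  one_mem' := ⟨one_mem _, dickson_one⟩
  inv_mem' {g} hg := ⟨inv_mem hg.1, by rw [dickson_inv hg.1, hg.2]⟩

theorem mem_evenGroup {g : QS ι ≃ₗ[ZMod 2] QS ι} :
    g ∈ evenGroup ι ↔ g ∈ orthGroup ι ∧ dickson g = 0 := Iff.rfl

theorem omegaPlus_eq (d : ℕ) : OmegaPlus d = evenGroup (Fin d) := by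
  have : {g : QSpace d ≃ₗ[ZMod 2] QSpace d | (∀ v, hypForm d (g v) = hypForm d v) ∧
      Even (Module.finrank (ZMod 2)
        (LinearMap.range ((g : QSpace d →ₗ[ZMod 2] QSpace d) - LinearMap.id)))} =
      evenGroup (Fin d) := by
    ext g
    exact and_congr Iff.rfl (ZMod.natCast_eq_zero_iff_even).symm
  rw [OmegaPlus, this, Subgroup.closure_eq]

theorem transvec_mul_siegel {v x w : QS ι} (hv : qf v = 1) (h : bf x w = 0) :
    transvec v * siegel x w h = siegel (transvec v x) (transvec v w)
      (by rw [bf_map_of_mem_orthGroup (transvec_mem hv), h]) * transvec v := by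
  refine LinearEquiv.ext fun u => ?_
  rw [LinearEquiv.mul_apply, LinearEquiv.mul_apply, siegel_apply, siegel_apply, bf_map_of_mem_orthGroup (transvec_mem hv),
    bf_map_of_mem_orthGroup (transvec_mem hv), map_add, map_add, map_smul, map_smul]

/-- Siegel transformations and products of two transvections. -/
def evenGens (ι : Type*) [Fintype ι] : Set (QS ι ≃ₗ[ZMod 2] QS ι) :=
  {g | ∃ v w : QS ι, qf v = 1 ∧ qf w = 1 ∧ g = transvec v * transvec w} ∪
    {g | ∃ x w, ∃ h : bf x w = 0, qf x = 0 ∧ qf w = 0 ∧ g = siegel x w h}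

/-- The two parities are proved together because a leading transvection in a word switches between
them. A leading Siegel transformation is moved past a transvection by conjugation. -/
theorem mem_closure_evenGens_aux {g : QS ι ≃ₗ[ZMod 2] QS ι} (hg : g ∈ orthGroup ι) :
    (dickson g = 0 → g ∈ Subgroup.closure (evenGens ι)) ∧
      (dickson g = 1 → ∀ v, qf v = 1 → transvec v * g ∈ Subgroup.closure (evenGens ι)) := by
  have hT : ∀ (v) (hv : qf v = 1) (y) (_ : y ∈ orthGroup ι),
      ((dickson y = 0 → y ∈ Subgroup.closure (evenGens ι)) ∧
        (dickson y = 1 → ∀ v, qf v = 1 → transvec v * y ∈ Subgroup.closure (evenGens ι))) →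
      (dickson (transvec v * y) = 0 → transvec v * y ∈ Subgroup.closure (evenGens ι)) ∧
        (dickson (transvec v * y) = 1 → ∀ u, qf u = 1 →
          transvec u * (transvec v * y) ∈ Subgroup.closure (evenGens ι)) := by
    intro v hv y hy ih
    rw [dickson_transvec_mul hy hv]
    refine ⟨fun h => ih.2 ?_ v hv, fun h u hu => ?_⟩
    · rw [← zero_add (1 : ZMod 2), ← h, add_assoc, zmod_two_add_self, add_zero]
    · rw [← mul_assoc]
      exact mul_mem (Subgroup.subset_closure (Or.inl ⟨u, v, hu, hv, rfl⟩))
        (ih.1 (add_eq_right.1 h))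
  have hS : ∀ (x w) (h : bf x w = 0) (_ : qf x = 0) (_ : qf w = 0) (y) (_ : y ∈ orthGroup ι),
      ((dickson y = 0 → y ∈ Subgroup.closure (evenGens ι)) ∧
        (dickson y = 1 → ∀ v, qf v = 1 → transvec v * y ∈ Subgroup.closure (evenGens ι))) →
      (dickson (siegel x w h * y) = 0 → siegel x w h * y ∈ Subgroup.closure (evenGens ι)) ∧
        (dickson (siegel x w h * y) = 1 → ∀ u, qf u = 1 →
          transvec u * (siegel x w h * y) ∈ Subgroup.closure (evenGens ι)) := by
    intro x w h hx hw y hy ih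
    rw [dickson_mul (siegel_mem h hx hw) hy, dickson_siegel h hx hw, zero_add]
    refine ⟨fun e => mul_mem (Subgroup.subset_closure (Or.inr ⟨x, w, h, hx, hw, rfl⟩)) (ih.1 e),
      fun e u hu => ?_⟩
    rw [← mul_assoc, transvec_mul_siegel hu, mul_assoc]
    exact mul_mem (Subgroup.subset_closure (Or.inr ⟨_, _, _, (transvec_mem hu x).trans hx,
      (transvec_mem hu w).trans hw, rfl⟩)) (ih.2 e u hu)
  have hg' := hg
  rw [← closure_orthGens] at hg'
  induction hg' using Subgroup.closure_induction_left with
  | one => exact ⟨fun _ => one_mem _, fun h => absurd (dickson_one.symm.trans h) zero_ne_one⟩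
  | mul_left x hx y hy ih =>
    rw [closure_orthGens] at hy
    rcases hx with ⟨v, hv, rfl⟩ | ⟨x, w, h, hx, hw, rfl⟩
    · exact hT v hv y hy (ih hy)
    · exact hS x w h hx hw y hy (ih hy)
  | inv_mul_cancel x hx y hy ih =>
    rw [closure_orthGens] at hy
    rcases hx with ⟨v, hv, rfl⟩ | ⟨x, w, h, hx, hw, rfl⟩
    · exact hT v hv y hy (ih hy)
    · exact hS x w h hx hw y hy (ih hy)

/-- The kernel of the Dickson invariant is generated by Siegel transformations and by products of
two transvections. -/
theorem closure_evenGens : Subgroup.closure (evenGens ι) = evenGroup ι := by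
  refine le_antisymm ((Subgroup.closure_le _).2 ?_) fun g hg =>
    (mem_closure_evenGens_aux hg.1).1 hg.2
  rintro g (⟨v, w, hv, hw, rfl⟩ | ⟨x, w, h, hx, hw, rfl⟩)
  · refine ⟨mul_mem (transvec_mem hv) (transvec_mem hw), ?_⟩
    rw [dickson_mul (transvec_mem hv) (transvec_mem hw), dickson_transvec hv, dickson_transvec hw]
    rfl
  · exact ⟨siegel_mem h hx hw, dickson_siegel h hx hw⟩

end Dickson

/-! ### The standard extraspecial group -/

section Heisenberg

variable (k : Type*) [Field k]

/-- The character `t ↦ (-1)^t` of `𝔽₂`. -/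
def sg (t : ZMod 2) : k := if t = 0 then 1 else -1

@[simp] theorem sg_zero : sg k 0 = 1 := rfl

@[simp] theorem sg_one : sg k 1 = -1 := if_neg one_ne_zero

theorem sg_add (s t : ZMod 2) : sg k (s + t) = sg k s * sg k t := by
  rcases zmod_two_eq_zero_or_one s with rfl | rfl <;>
  rcases zmod_two_eq_zero_or_one t with rfl | rfl <;> simp [zmod_two_add_self]

theorem sg_mul_self (t : ZMod 2) : sg k t * sg k t = 1 := by
  rw [← sg_add, zmod_two_add_self, sg_zero]

theorem sg_ne_zero (t : ZMod 2) : sg k t ≠ 0 := fun h => by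
  have := sg_mul_self k t; rw [h, zero_mul] at this; exact zero_ne_one this

theorem sg_injective [CharZero k] : Function.Injective (sg k) := fun s t h => by
  have h2 : (1 : k) ≠ -1 := fun h => two_ne_zero (by linear_combination h : (2 : k) = 0)
  rcases zmod_two_eq_zero_or_one s with rfl | rfl <;>
  rcases zmod_two_eq_zero_or_one t with rfl | rfl <;> simp_all

variable {ι : Type*} [Fintype ι]

open Matrix in
/-- The element `φ ↦ (x ↦ (-1)^(t + b·x) φ(x + a))` of the standard extraspecial group, for
`v = (a, b)`. -/
def hs (t : ZMod 2) (v : QS ι) : FunSpace k ι ≃ₗ[k] FunSpace k ι where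
  toFun φ x := sg k (t + v.2 ⬝ᵥ x) * φ (x + v.1)
  -- The square of this operator is the scalar `(-1)^(qf v)`, so the inverse differs from it by that
  -- sign.
  invFun φ x := sg k (t + qf v + v.2 ⬝ᵥ x) * φ (x + v.1)
  map_add' φ ψ := by ext x; simp [mul_add]
  map_smul' c φ := by ext x; simp [mul_left_comm]
  left_inv φ := by
    ext x
    have h : x + v.1 + v.1 = x := by ext i; simp [add_assoc, zmod_two_add_self]
    have hq : v.2 ⬝ᵥ v.1 = qf v := dotProduct_comm _ _
    change sg k (t + qf v + v.2 ⬝ᵥ x) * (sg k (t + v.2 ⬝ᵥ (x + v.1)) * φ (x + v.1 + v.1)) = φ x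
    rw [← mul_assoc, ← sg_add, h, dotProduct_add, hq,
      show t + qf v + v.2 ⬝ᵥ x + (t + (v.2 ⬝ᵥ x + qf v)) =
        (t + t) + (qf v + qf v) + (v.2 ⬝ᵥ x + v.2 ⬝ᵥ x) by ring]
    simp [zmod_two_add_self]
  right_inv φ := by
    ext x
    have h : x + v.1 + v.1 = x := by ext i; simp [add_assoc, zmod_two_add_self]
    have hq : v.2 ⬝ᵥ v.1 = qf v := dotProduct_comm _ _
    change sg k (t + v.2 ⬝ᵥ x) * (sg k (t + qf v + v.2 ⬝ᵥ (x + v.1)) * φ (x + v.1 + v.1)) = φ x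
    rw [← mul_assoc, ← sg_add, h, dotProduct_add, hq,
      show t + v.2 ⬝ᵥ x + (t + qf v + (v.2 ⬝ᵥ x + qf v)) =
        (t + t) + (qf v + qf v) + (v.2 ⬝ᵥ x + v.2 ⬝ᵥ x) by ring]
    simp [zmod_two_add_self]

open Matrix

theorem hs_apply (t : ZMod 2) (v : QS ι) (φ : FunSpace k ι) (x : ι → ZMod 2) :
    hs k t v φ x = sg k (t + v.2 ⬝ᵥ x) * φ (x + v.1) := rfl

theorem hs_mul (s t : ZMod 2) (v w : QS ι) :
    hs k s v * hs k t w = hs k (s + t + w.2 ⬝ᵥ v.1) (v + w) := by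
  ext φ x
  rw [LinearEquiv.mul_apply, hs_apply, hs_apply, hs_apply, ← mul_assoc, ← sg_add, dotProduct_add,
    Prod.snd_add, add_dotProduct, Prod.fst_add, add_assoc x]
  congr 2
  ring

@[simp] theorem hs_zero : hs k 0 (0 : QS ι) = 1 := by
  ext φ x
  simp [hs_apply]

theorem hs_apply_eq_smul (t : ZMod 2) (v : QS ι) (φ : FunSpace k ι) :
    hs k t v φ = sg k t • hs k 0 v φ := by
  ext x
  rw [Pi.smul_apply, hs_apply, hs_apply, zero_add, sg_add, smul_eq_mul, mul_assoc]

theorem hs_inv (t : ZMod 2) (v : QS ι) : (hs k t v)⁻¹ = hs k (t + qf v) v  := by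
  refine inv_eq_of_mul_eq_one_right ?_
  rw [hs_mul, qs_add_self, ← hs_zero]
  have hq : v.2 ⬝ᵥ v.1 = qf v := dotProduct_comm _ _
  congr 1
  rw [hq, ← add_assoc, zmod_two_add_self, zero_add, zmod_two_add_self]

/-- The action of the square of an element. -/
theorem hs_hs_self (v : QS ι) (φ : FunSpace k ι) :
    hs k 0 v (hs k 0 v φ) = sg k (qf v) • φ := by
  rw [← LinearEquiv.mul_apply, hs_mul, qs_add_self, hs_apply_eq_smul, hs_zero]
  congr 2
  rw [zero_add, zero_add]; exact dotProduct_comm _ _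

/-- The cocycle of `hs_mul` is not symmetric; its symmetrization is the polar form, which therefore
governs commutators. -/
theorem dotProduct_add_dotProduct_comm (v w : QS ι) :
    w.2 ⬝ᵥ v.1 + v.2 ⬝ᵥ w.1 = bf v w := by
  rw [bf_apply, Finset.sum_add_distrib, dotProduct_comm, dotProduct_comm v.2]; rfl

theorem hs_commute (v w : QS ι) (φ : FunSpace k ι) :
    hs k 0 v (hs k 0 w φ) = sg k (bf v w) • hs k 0 w (hs k 0 v φ) := by
  rw [← LinearEquiv.mul_apply, ← LinearEquiv.mul_apply, hs_mul, hs_mul, hs_apply_eq_smul,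
    hs_apply_eq_smul k (0 + 0 + v.2 ⬝ᵥ w.1), smul_smul, ← sg_add, add_comm w v,
    ← dotProduct_add_dotProduct_comm]
  congr 2
  rw [zero_add, zero_add, zero_add, add_assoc, zmod_two_add_self, add_zero]

theorem translation_eq (a : ι → ZMod 2) : translation k ι a = hs k 0 (a, 0) := by
  ext φ x
  rw [hs_apply]
  simp [translation, LinearMap.funLeft]

theorem signChange_eq (b : ι → ZMod 2) : signChange k ι b = hs k 0 (0, b) := by
  ext φ x
  rw [hs_apply, zero_add, add_zero]
  change ((((-1 : kˣ) ^ (∑ i, b i * x i : ZMod 2).val : kˣ) : k)) * φ x = _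
  congr 1
  change _ = sg k (∑ i, b i * x i)
  rcases zmod_two_eq_zero_or_one (∑ i, b i * x i) with h | h <;> rw [h]
  · simp
  · rw [ZMod.val_one, sg_one]; simp

variable [DecidableEq ι]

theorem mem_stdLower {g : FunSpace k ι ≃ₗ[k] FunSpace k ι} [Nonempty ι] :
    g ∈ stdLower k ι ↔ ∃ t v, g = hs k t v := by
  constructor
  · intro hg
    induction hg using Subgroup.closure_induction with
    | mem x hx =>
      rcases hx with ⟨a, rfl⟩ | ⟨b, rfl⟩
      · exact ⟨_, _, translation_eq k a⟩
      · exact ⟨_, _, signChange_eq k b⟩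
    | one => exact ⟨0, 0, (hs_zero k).symm⟩
    | mul x y _ _ hx hy =>
      obtain ⟨t, v, rfl⟩ := hx
      obtain ⟨t', v', rfl⟩ := hy
      exact ⟨_, _, hs_mul k _ _ _ _⟩
    | inv x _ hx =>
      obtain ⟨t, v, rfl⟩ := hx
      exact ⟨_, _, hs_inv k _ _⟩
  · rintro ⟨t, v, rfl⟩
    have hX : ∀ a, hs k 0 (a, 0) ∈ stdLower k ι := fun a =>
      Subgroup.subset_closure (Or.inl ⟨a, translation_eq k a⟩)
    have hZ : ∀ b, hs k 0 (0, b) ∈ stdLower k ι := fun b =>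
      Subgroup.subset_closure (Or.inr ⟨b, signChange_eq k b⟩)
    obtain ⟨i⟩ := ‹Nonempty ι›
    -- The scalar `-1` is the square of a translation times a sign change along the same coordinate;
    -- this needs a coordinate to exist.
    have h1 : hs k 1 (0 : QS ι) ∈ stdLower k ι := by
      have := mul_mem (mul_mem (hX (Pi.single i 1)) (hZ (Pi.single i 1)))
        (mul_mem (hX (Pi.single i 1)) (hZ (Pi.single i 1)))
      rw [hs_mul, hs_mul, qs_add_self] at this
      convert this using 2
      simp [zmod_two_add_self]
    have ht : hs k t (0 : QS ι) ∈ stdLower k ι := by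
      rcases zmod_two_eq_zero_or_one t with rfl | rfl
      · rw [hs_zero]; exact one_mem _
      · exact h1
    have := mul_mem ht (mul_mem (hZ v.2) (hX v.1))
    rw [hs_mul, hs_mul] at this
    convert this using 2
    · simp
    · ext i <;> simp

theorem hs_injective [CharZero k] {s t : ZMod 2} {v w : QS ι} (h : hs k s v = hs k t w) :
    s = t ∧ v = w := by
  have h1 : ∀ x, hs k s v (Pi.single w.1 1) x = hs k t w (Pi.single w.1 1) x := fun x => by rw [h]
  have ha : v.1 = w.1 := by
    by_contra hne
    have := h1 0
    rw [hs_apply, hs_apply, zero_add, zero_add, Pi.single_eq_same, Pi.single_eq_of_ne hne, mul_zero,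
      mul_one] at this
    exact sg_ne_zero k _ this.symm
  have h2 : ∀ x, s + v.2 ⬝ᵥ x = t + w.2 ⬝ᵥ x := fun x => by
    have := congrFun (congrArg (fun g : FunSpace k ι ≃ₗ[k] FunSpace k ι => g (fun _ => 1)) h) x
    simp only [hs_apply, mul_one] at this
    exact sg_injective k this
  have hst : s = t := by simpa using h2 0
  refine ⟨hst, Prod.ext ha (funext fun i => ?_)⟩
  have := h2 (Pi.single i 1)
  rw [hst] at this
  simpa using this

/-- A linear map commuting with the standard extraspecial group is a scalar. -/
theorem exists_smul_of_commute [CharZero k] (g : FunSpace k ι →ₗ[k] FunSpace k ι)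
    (hg : ∀ v φ, g (hs k 0 v φ) = hs k 0 v (g φ)) : ∃ c : k, ∀ φ, g φ = c • φ := by
  have hδ : ∀ v : QS ι, hs k 0 v (Pi.single v.1 1) = Pi.single 0 1 := fun v => by
    ext x
    rw [hs_apply]
    by_cases hx : x = 0
    · subst hx; simp
    · rw [Pi.single_eq_of_ne hx, Pi.single_eq_of_ne, mul_zero]
      intro h; exact hx (add_eq_right.1 h)
  -- The sign changes separate points, so their common fixed line is spanned by the delta function
  -- at 0. Translations then carry the resulting scalar to every other delta function.
  have h0 : ∀ x, x ≠ 0 → g (Pi.single 0 1) x = 0 := fun x hx => by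
    obtain ⟨i, hi⟩ := Function.ne_iff.1 hx
    have h := hg (0, Pi.single i 1) (Pi.single 0 1)
    have e := hδ (0, Pi.single i 1)
    simp only at e
    rw [e] at h
    have := congrFun h x
    rw [hs_apply, add_zero, zero_add, single_one_dotProduct, zmod_two_ne_zero hi, sg_one] at this
    have h2 : (2 : k) * g (Pi.single 0 1) x = 0 := by linear_combination this
    exact (mul_eq_zero.1 h2).resolve_left two_ne_zero
  refine ⟨g (Pi.single 0 1) 0, fun φ => ?_⟩
  have key : g = (g (Pi.single 0 1) 0) • LinearMap.id := by
    refine LinearMap.pi_ext' fun a => LinearMap.ext_ring ?_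
    have hinj := (hs k 0 ((a, 0) : QS ι)).injective
    apply hinj
    have e := hδ (a, 0)
    simp only at e
    change hs k 0 (a, 0) (g (Pi.single a 1)) = hs k 0 (a, 0) (g (Pi.single 0 1) 0 • Pi.single a 1)
    rw [← hg, map_smul, e]
    ext x
    by_cases hx : x = 0
    · subst hx; simp
    · rw [h0 x hx, Pi.smul_apply, Pi.single_eq_of_ne hx, smul_zero]
  rw [key]; simp

end Heisenberg

/-! ### The normalizer of the standard extraspecial group and its action on the quadratic space. -/

section Normalizer

variable (k : Type*) [Field k] [CharZero k] {ι : Type*} [Fintype ι] [DecidableEq ι]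

open Matrix

/-- `g` normalizes the standard extraspecial group, and conjugation by `g` induces `A` on the
quadratic space. -/
def Induces (g : FunSpace k ι ≃ₗ[k] FunSpace k ι) (A : QS ι ≃ₗ[ZMod 2] QS ι) : Prop :=
  ∀ v, ∃ t, ∀ φ, g (hs k 0 v φ) = sg k t • hs k 0 (A v) (g φ)

variable {k}

theorem Induces.mul {g h : FunSpace k ι ≃ₗ[k] FunSpace k ι} {A B : QS ι ≃ₗ[ZMod 2] QS ι}
    (hg : Induces k g A) (hh : Induces k h B) : Induces k (g * h) (A * B) := fun v => by
  obtain ⟨t, ht⟩ := hh v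
  obtain ⟨s, hs'⟩ := hg (B v)
  refine ⟨t + s, fun φ => ?_⟩
  rw [LinearEquiv.mul_apply, ht, map_smul, hs', smul_smul, ← sg_add]; rfl

theorem Induces.inv {g : FunSpace k ι ≃ₗ[k] FunSpace k ι} {A : QS ι ≃ₗ[ZMod 2] QS ι}
    (hg : Induces k g A) : Induces k g⁻¹ A⁻¹ := fun v => by
  obtain ⟨t, ht⟩ := hg (A⁻¹ v)
  refine ⟨t, fun φ => ?_⟩
  apply g.injective
  rw [map_smul, ht, smul_smul, sg_mul_self, one_smul]
  have h1 : ∀ ψ, g (g⁻¹ ψ) = ψ := g.apply_symm_apply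
  have h2 : A (A⁻¹ v) = v := A.apply_symm_apply v
  rw [h1, h1, h2]

theorem induces_hs (t : ZMod 2) (v : QS ι) : Induces k (hs k t v) 1 := fun w => by
  refine ⟨bf v w, fun φ => ?_⟩
  rw [hs_apply_eq_smul, hs_commute, hs_apply_eq_smul k t v φ, map_smul, smul_comm]; rfl

theorem Induces.unique {g : FunSpace k ι ≃ₗ[k] FunSpace k ι} {A B : QS ι ≃ₗ[ZMod 2] QS ι}
    (hA : Induces k g A) (hB : Induces k g B) : A = B := by
  refine LinearEquiv.ext fun v => ?_
  obtain ⟨s, hs'⟩ := hA v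
  obtain ⟨t, ht⟩ := hB v
  refine (hs_injective k (s := s) (t := t) (LinearEquiv.ext fun ψ => ?_)).2
  obtain ⟨φ, rfl⟩ := g.surjective ψ
  rw [hs_apply_eq_smul, hs_apply_eq_smul k t, ← hs', ht]

/-- The form is visible in the group: the square of `hs k 0 v` is the scalar `(-1)^(qf v)`, and
conjugation fixes scalars. -/
theorem Induces.mem_orthGroup {g : FunSpace k ι ≃ₗ[k] FunSpace k ι} {A : QS ι ≃ₗ[ZMod 2] QS ι}
    (hA : Induces k g A) : A ∈ orthGroup ι := fun v => by
  obtain ⟨t, ht⟩ := hA v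
  have h := hs_hs_self k (A v) (g (fun _ => 1))
  have h2 : g (hs k 0 v (hs k 0 v (fun _ => 1))) = hs k 0 (A v) (hs k 0 (A v) (g (fun _ => 1))) := by
    rw [ht, ht, map_smul, smul_smul, sg_mul_self, one_smul]
  rw [h, hs_hs_self, map_smul] at h2
  have h0 : g (fun _ => 1) ≠ 0 := g.map_ne_zero_iff.2 fun h => one_ne_zero (congrFun h 0)
  exact (sg_injective k (smul_left_injective k h0 h2)).symm

/-- The signs by which `g` fails to commute with the group form an additive character, hence are
pairings with some `x`. Then `hs k 0 x * g` commutes with the whole group and is a scalar by Schur's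
lemma. -/
theorem Induces.exists_eq_smul {g : FunSpace k ι ≃ₗ[k] FunSpace k ι} (hg : Induces k g 1) :
    ∃ (c : k) (v : QS ι), ∀ φ, g φ = c • hs k 0 v φ := by
  choose t ht using hg
  have hadd : ∀ v w, t (v + w) = t v + t w := fun v w => by
    have e : ∀ φ, hs k 0 v (hs k 0 w φ) = sg k (w.2 ⬝ᵥ v.1) • hs k 0 (v + w) φ := fun φ => by
      rw [← LinearEquiv.mul_apply, hs_mul, hs_apply_eq_smul, zero_add, zero_add]
    have h1 : g (hs k 0 v (hs k 0 w (fun _ => 1))) =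
        sg k (t v + t w) • hs k 0 v (hs k 0 w (g (fun _ => 1))) := by
      rw [ht, ht, LinearEquiv.coe_one, id, id, map_smul, smul_smul, ← sg_add]
    rw [e, e, map_smul, ht, smul_comm, smul_smul, smul_smul, mul_comm,
      LinearEquiv.coe_one, id] at h1
    have h0 : hs k 0 (v + w) (g (fun _ => 1)) ≠ 0 := (LinearEquiv.map_ne_zero_iff _).2
      (g.map_ne_zero_iff.2 fun h => one_ne_zero (congrFun h 0))
    have h2 := smul_left_injective k h0 h1
    exact sg_injective k (mul_left_cancel₀ (sg_ne_zero k _) (by rw [h2, mul_comm]))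
  obtain ⟨x, hx⟩ := exists_bf_eq ((AddMonoidHom.mk' t hadd).toZModLinearMap 2)
  have hx' : ∀ v, t v = bf x v := hx
  obtain ⟨c, hc⟩ := exists_smul_of_commute k ((hs k 0 x * g : FunSpace k ι ≃ₗ[k] FunSpace k ι) :
    FunSpace k ι →ₗ[k] FunSpace k ι) fun v φ => by
      change hs k 0 x (g (hs k 0 v φ)) = hs k 0 v (hs k 0 x (g φ))
      rw [ht, map_smul, LinearEquiv.coe_one, id, hs_commute k x v, hx', smul_smul, sg_mul_self,
        one_smul]
  refine ⟨sg k (qf x) * c, x, fun φ => ?_⟩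
  have h1 : hs k 0 x (g φ) = c • φ := hc φ
  rw [mul_smul, ← map_smul, ← h1, hs_hs_self, smul_smul, sg_mul_self, one_smul]

/-- Conjugation fixes the scalars `±1` and so descends to the quotient, where it is additive and
injective, hence a linear automorphism. -/
theorem mem_normalizer_iff_exists_induces [Nonempty ι] {g : FunSpace k ι ≃ₗ[k] FunSpace k ι} :
    g ∈ Subgroup.normalizer (stdLower k ι : Set (FunSpace k ι ≃ₗ[k] FunSpace k ι)) ↔
      ∃ A, Induces k g A := by
  constructor
  · intro hg
    have h1 : ∀ v, ∃ t w, g * hs k 0 v * g⁻¹ = hs k t w := fun v =>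
      (mem_stdLower k).1 ((Subgroup.mem_normalizer_iff.1 hg _).1 ((mem_stdLower k).2 ⟨0, v, rfl⟩))
    choose t w h using h1
    have hadd : ∀ v v', w (v + v') = w v + w v' := fun v v' => by
      have e : hs k (v'.2 ⬝ᵥ v.1) 0 * hs k 0 (v + v') = hs k 0 v * hs k 0 v' := by
        rw [hs_mul, hs_mul]; simp
      have hc : ∀ s, g * hs k s 0 * g⁻¹ = hs k s 0 := fun s => by
        have : ∀ φ : FunSpace k ι, hs k s 0 φ = sg k s • φ := fun φ => by
          rw [hs_apply_eq_smul, hs_zero]; rfl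
        rw [mul_inv_eq_iff_eq_mul]
        exact LinearEquiv.ext fun φ => by
          rw [LinearEquiv.mul_apply, LinearEquiv.mul_apply, this, this, map_smul]
      have e2 : (g * hs k (v'.2 ⬝ᵥ v.1) 0 * g⁻¹) * (g * hs k 0 (v + v') * g⁻¹) =
          (g * hs k 0 v * g⁻¹) * (g * hs k 0 v' * g⁻¹) := by
        have : ∀ a b : FunSpace k ι ≃ₗ[k] FunSpace k ι,
            (g * a * g⁻¹) * (g * b * g⁻¹) = g * (a * b) * g⁻¹ := fun a b => by group
        rw [this, this, e]
      rw [hc, h, h, h, hs_mul, hs_mul, zero_add] at e2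
      exact (hs_injective k e2).2
    let l : QS ι →ₗ[ZMod 2] QS ι := (AddMonoidHom.mk' w hadd).toZModLinearMap 2
    have hl : Function.Injective l := by
      refine (injective_iff_map_eq_zero l).2 fun v hv => ?_
      have hv' : w v = 0 := hv
      have := h v
      rw [hv', mul_inv_eq_iff_eq_mul] at this
      refine (hs_injective k (s := 0) (t := t v) (w := 0) (LinearEquiv.ext fun φ => ?_)).2
      apply g.injective
      have h3 := LinearEquiv.congr_fun this φ
      rw [LinearEquiv.mul_apply, LinearEquiv.mul_apply] at h3
      rw [h3, hs_apply_eq_smul, hs_apply_eq_smul k (t v), map_smul, hs_zero]; rfl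
    refine ⟨LinearEquiv.ofInjectiveEndo l hl, fun v => ⟨t v, fun φ => ?_⟩⟩
    have h3 := h v
    rw [mul_inv_eq_iff_eq_mul] at h3
    have h4 := LinearEquiv.congr_fun h3 φ
    rw [LinearEquiv.mul_apply, LinearEquiv.mul_apply, hs_apply_eq_smul k (t v)] at h4
    exact h4
  · rintro ⟨A, hA⟩
    have key : ∀ {g : FunSpace k ι ≃ₗ[k] FunSpace k ι} {A}, Induces k g A →
        ∀ x ∈ stdLower k ι, g * x * g⁻¹ ∈ stdLower k ι := by
      intro g A hA x hx
      obtain ⟨s, v, rfl⟩ := (mem_stdLower k).1 hx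
      obtain ⟨t, ht⟩ := hA v
      refine (mem_stdLower k).2 ⟨s + t, A v, ?_⟩
      rw [mul_inv_eq_iff_eq_mul]
      refine LinearEquiv.ext fun φ => ?_
      rw [LinearEquiv.mul_apply, LinearEquiv.mul_apply, hs_apply_eq_smul, map_smul, ht,
        hs_apply_eq_smul k (s + t), sg_add, mul_smul]
    refine Subgroup.mem_normalizer_iff.2 fun x => ⟨key hA x, fun hx => ?_⟩
    have := key hA.inv _ hx
    simpa [mul_assoc] using this

/-! ### Adjoints -/

theorem hs_dotProduct (v : QS ι) (φ ψ : FunSpace k ι) :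
    hs k 0 v φ ⬝ᵥ ψ = sg k (qf v) * (φ ⬝ᵥ hs k 0 v ψ) := by
  rw [dotProduct, dotProduct, Finset.mul_sum]
  refine Fintype.sum_equiv (Equiv.addRight v.1) _ _ fun x => ?_
  have h : x + v.1 + v.1 = x := by ext i; simp [add_assoc, zmod_two_add_self]
  have hq : v.2 ⬝ᵥ v.1 = qf v := dotProduct_comm _ _
  rw [Equiv.coe_addRight, hs_apply, hs_apply, h, zero_add, zero_add, dotProduct_add, hq, sg_add]
  linear_combination -(sg k (v.2 ⬝ᵥ x) * φ (x + v.1) * ψ x) * sg_mul_self k (qf v)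

theorem hs_dotProduct_hs (t : ZMod 2) (v : QS ι) (φ ψ : FunSpace k ι) :
    hs k t v φ ⬝ᵥ hs k t v ψ = φ ⬝ᵥ ψ := by
  rw [hs_apply_eq_smul, hs_apply_eq_smul k t v ψ, smul_dotProduct, dotProduct_smul, hs_dotProduct,
    hs_hs_self, dotProduct_smul, smul_smul, smul_eq_mul, smul_eq_mul, sg_mul_self, one_mul,
    ← mul_assoc, sg_mul_self, one_mul]

/-- Schur's lemma applied to `gᵀ g`, which is the map `h` below. It commutes with the group because
each element is its own adjoint up to a sign, and that sign depends only on `qf`, which is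
preserved. -/
theorem Induces.exists_multiplier {g : FunSpace k ι ≃ₗ[k] FunSpace k ι} {A : QS ι ≃ₗ[ZMod 2] QS ι}
    (hA : Induces k g A) : ∃ c : k, c ≠ 0 ∧ ∀ φ ψ, g φ ⬝ᵥ g ψ = c * (φ ⬝ᵥ ψ) := by
  let h : FunSpace k ι →ₗ[k] FunSpace k ι :=
    { toFun := fun φ x => g φ ⬝ᵥ g (Pi.single x 1)
      map_add' := fun φ ψ => by ext x; simp
      map_smul' := fun c φ => by ext x; simp }
  have hh : ∀ φ ψ, h φ ⬝ᵥ ψ = g φ ⬝ᵥ g ψ := fun φ ψ => by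
    have e : (dotProductBilin k k (h φ)) =
        (dotProductBilin k k (g φ)) ∘ₗ (g : FunSpace k ι →ₗ[k] FunSpace k ι) := by
      refine LinearMap.pi_ext' fun a => LinearMap.ext_ring ?_
      change h φ ⬝ᵥ Pi.single a 1 = g φ ⬝ᵥ g (Pi.single a 1)
      rw [dotProduct_single_one]; rfl
    exact LinearMap.congr_fun e ψ
  obtain ⟨c, hc⟩ := exists_smul_of_commute k h fun v φ => by
    refine dotProduct_eq _ _ fun ψ => ?_
    obtain ⟨t, ht⟩ := hA v
    have e : hs k 0 (A v) (g ψ) = sg k t • g (hs k 0 v ψ) := by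
      rw [ht, smul_smul, sg_mul_self, one_smul]
    rw [hh, ht, smul_dotProduct, hs_dotProduct, hA.mem_orthGroup, hs_dotProduct, hh, e,
      dotProduct_smul, smul_eq_mul, smul_eq_mul]
    linear_combination (sg k (qf v) * (g φ ⬝ᵥ g (hs k 0 v ψ))) * sg_mul_self k t
  have hm : ∀ φ ψ, g φ ⬝ᵥ g ψ = c * (φ ⬝ᵥ ψ) := fun φ ψ => by
    rw [← hh, hc, smul_dotProduct, smul_eq_mul]
  refine ⟨c, fun h0 => ?_, hm⟩
  obtain ⟨φ, hφ⟩ := g.surjective (Pi.single 0 1)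
  have := hm φ φ
  rw [hφ, h0, zero_mul, dotProduct_single_one, Pi.single_eq_same] at this
  exact one_ne_zero this

end Normalizer

/-! ### Lifts of orthogonal transformations and the derived subgroup of the normalizer. -/

section Lifts

variable (k : Type*) [Field k] [CharZero k] {ι : Type*} [Fintype ι] [DecidableEq ι]

open Matrix
open scoped commutatorElement

/-- The lift `1 - D` of the transvection along the nonsingular vector `v`. -/
def transvecLift (v : QS ι) (hv : qf v = 1) : FunSpace k ι ≃ₗ[k] FunSpace k ι where
  toFun φ := φ - hs k 0 v φ
  -- For nonsingular `v` the operator `D` has square `-1`, so `(1 - D)(1 + D) = 2`.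
  invFun φ := (2⁻¹ : k) • (φ + hs k 0 v φ)
  map_add' φ ψ := by rw [map_add]; abel
  map_smul' c φ := by rw [map_smul, RingHom.id_apply, smul_sub]
  left_inv φ := by
    change (2⁻¹ : k) • (φ - hs k 0 v φ + hs k 0 v (φ - hs k 0 v φ)) = φ
    rw [map_sub, hs_hs_self, hv, sg_one]; module
  right_inv φ := by
    change (2⁻¹ : k) • (φ + hs k 0 v φ) - hs k 0 v ((2⁻¹ : k) • (φ + hs k 0 v φ)) = φ
    rw [map_smul, map_add, hs_hs_self, hv, sg_one]; module

theorem transvecLift_apply (v : QS ι) (hv : qf v = 1) (φ : FunSpace k ι) :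
    transvecLift k v hv φ = φ - hs k 0 v φ := rfl

/-- The lift `(1 + D + D' - D D') / 2` of the Siegel transformation. -/
def siegelLift (x w : QS ι) (h : bf x w = 0) (hx : qf x = 0) (hw : qf w = 0) :
    FunSpace k ι ≃ₗ[k] FunSpace k ι :=
  -- The operator is `1 - 2P`, where `P = (1 - D)(1 - D')/4` projects onto the common
  -- `(-1)`-eigenspace of the commuting involutions `D` and `D'`.
  LinearEquiv.ofInvolutive
    { toFun := fun φ => (2⁻¹ : k) • (φ + hs k 0 x φ + hs k 0 w φ - hs k 0 x (hs k 0 w φ))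
      map_add' := fun φ ψ => by simp only [map_add]; module
      map_smul' := fun c φ => by simp only [map_smul, RingHom.id_apply]; module } fun φ => by
    have e1 : ∀ ψ, hs k 0 x (hs k 0 x ψ) = ψ := fun ψ => by
      rw [hs_hs_self, hx, sg_zero, one_smul]
    have e2 : ∀ ψ, hs k 0 w (hs k 0 w ψ) = ψ := fun ψ => by
      rw [hs_hs_self, hw, sg_zero, one_smul]
    have e3 : ∀ ψ, hs k 0 w (hs k 0 x ψ) = hs k 0 x (hs k 0 w ψ) := fun ψ => by
      rw [hs_commute, bf_comm, h, sg_zero, one_smul]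
    simp only [LinearMap.coe_mk, AddHom.coe_mk, map_smul, map_add, map_sub, e1, e2, e3]
    module

variable {k}

theorem siegelLift_apply (x w : QS ι) (h : bf x w = 0) (hx : qf x = 0) (hw : qf w = 0)
    (φ : FunSpace k ι) : siegelLift k x w h hx hw φ =
      (2⁻¹ : k) • (φ + hs k 0 x φ + hs k 0 w φ - hs k 0 x (hs k 0 w φ)) := rfl

theorem hs_add_apply (v w : QS ι) (φ : FunSpace k ι) :
    hs k 0 (v + w) φ = sg k (w.2 ⬝ᵥ v.1) • hs k 0 v (hs k 0 w φ) := by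
  rw [← LinearEquiv.mul_apply, hs_mul, hs_apply_eq_smul k (0 + 0 + w.2 ⬝ᵥ v.1), zero_add, zero_add,
    smul_smul, sg_mul_self, one_smul]

/-- If `D_u` anticommutes with `D`, then `(1 - D) D_u = D_u (1 + D)`, and `1 + D = D (1 - D)`
because the square of `D` is `-1`. So conjugation turns `D_u` into `D_u D`, which is `±D_{u+v}`. -/
theorem induces_transvecLift (v : QS ι) (hv : qf v = 1) :
    Induces k (transvecLift k v hv) (transvec v) := fun u => by
  rw [transvec_apply]
  rcases zmod_two_eq_zero_or_one (bf v u) with h | h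
  · refine ⟨0, fun φ => ?_⟩
    rw [h, zero_smul, add_zero, transvecLift_apply, transvecLift_apply, hs_commute, h, map_sub]
    simp
  · refine ⟨v.2 ⬝ᵥ u.1, fun φ => ?_⟩
    rw [h, one_smul, transvecLift_apply, transvecLift_apply, hs_commute, h, hs_add_apply,
      smul_smul, sg_mul_self, map_sub, map_sub, hs_hs_self, hv, sg_one, map_smul]
    module

/-- The factor 2 cancels in a quotient of two lifts. It is also what rules out odd transformations
for a rational lattice. -/
theorem transvecLift_dotProduct (v : QS ι) (hv : qf v = 1) (φ ψ : FunSpace k ι) :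
    transvecLift k v hv φ ⬝ᵥ transvecLift k v hv ψ = 2 * (φ ⬝ᵥ ψ) := by
  rw [transvecLift_apply, transvecLift_apply, sub_dotProduct, dotProduct_sub, dotProduct_sub,
    hs_dotProduct_hs, hs_dotProduct, hv, sg_one]
  ring

theorem induces_siegelLift (x w : QS ι) (h : bf x w = 0) (hx : qf x = 0) (hw : qf w = 0) :
    Induces k (siegelLift k x w h hx hw) (siegel x w h) := fun u => by
  have e1 : ∀ ψ, hs k 0 x (hs k 0 x ψ) = ψ := fun ψ => by
    rw [hs_hs_self, hx, sg_zero, one_smul]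
  have e2 : ∀ ψ, hs k 0 w (hs k 0 w ψ) = ψ := fun ψ => by
    rw [hs_hs_self, hw, sg_zero, one_smul]
  have e3 : ∀ ψ, hs k 0 w (hs k 0 x ψ) = hs k 0 x (hs k 0 w ψ) := fun ψ => by
    rw [hs_commute, bf_comm, h, sg_zero, one_smul]
  rw [siegel_apply]
  rcases zmod_two_eq_zero_or_one (bf x u) with h1 | h1 <;>
  rcases zmod_two_eq_zero_or_one (bf w u) with h2 | h2
  · refine ⟨0, fun φ => ?_⟩
    have e4 := hs_commute k x u
    have e5 := hs_commute k w u
    simp only [h1, h2, sg_zero, one_smul] at e4 e5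
    rw [h1, h2, zero_smul, zero_smul, add_zero, add_zero, siegelLift_apply, siegelLift_apply]
    simp only [map_smul, map_add, map_sub, e4, e5, sg_zero, one_smul]
  · refine ⟨x.2 ⬝ᵥ u.1, fun φ => ?_⟩
    have e4 := hs_commute k x u
    have e5 := hs_commute k w u
    simp only [h1, h2, sg_zero, sg_one, one_smul] at e4 e5
    rw [h1, h2, zero_smul, one_smul, add_zero, siegelLift_apply, siegelLift_apply, hs_add_apply,
      smul_smul, sg_mul_self, one_smul]
    simp only [map_smul, map_add, map_sub, e4, e5, e1]
    module
  · refine ⟨w.2 ⬝ᵥ u.1, fun φ => ?_⟩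
    have e4 := hs_commute k x u
    have e5 := hs_commute k w u
    simp only [h1, h2, sg_zero, sg_one, one_smul] at e4 e5
    rw [h1, h2, zero_smul, one_smul, add_zero, siegelLift_apply, siegelLift_apply, hs_add_apply,
      smul_smul, sg_mul_self, one_smul]
    simp only [map_smul, map_add, map_sub, e4, e5, e2, e3]
    module
  -- The bracket undoes the cocycle incurred in splitting `u + w + x`; the leading 1 is the sign
  -- left over when `D_u` anticommutes with both involutions.
  · refine ⟨1 + (x.2 ⬝ᵥ (u + w).1 + w.2 ⬝ᵥ u.1), fun φ => ?_⟩
    have e4 := hs_commute k x u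
    have e5 := hs_commute k w u
    simp only [h1, h2, sg_one] at e4 e5
    rw [h1, h2, one_smul, one_smul, siegelLift_apply, siegelLift_apply, hs_add_apply, hs_add_apply,
      smul_smul, smul_smul, ← sg_add, ← sg_add, add_assoc (1 + _), add_assoc 1, zmod_two_add_self,
      add_zero, sg_one]
    simp only [map_smul, map_add, map_sub, e4, e5, e1, e2, e3]
    module

/-- For singular vectors the operators are self-adjoint and commute, so the lift is a self-adjoint
involution. -/
theorem siegelLift_dotProduct (x w : QS ι) (h : bf x w = 0) (hx : qf x = 0) (hw : qf w = 0)
    (φ ψ : FunSpace k ι) :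
    siegelLift k x w h hx hw φ ⬝ᵥ siegelLift k x w h hx hw ψ = φ ⬝ᵥ ψ := by
  have e1 : ∀ φ ψ : FunSpace k ι, hs k 0 x φ ⬝ᵥ ψ = φ ⬝ᵥ hs k 0 x ψ := fun φ ψ => by
    rw [hs_dotProduct, hx, sg_zero, one_mul]
  have e2 : ∀ φ ψ : FunSpace k ι, hs k 0 w φ ⬝ᵥ ψ = φ ⬝ᵥ hs k 0 w ψ := fun φ ψ => by
    rw [hs_dotProduct, hw, sg_zero, one_mul]
  have e3 : ∀ ψ : FunSpace k ι, hs k 0 w (hs k 0 x ψ) = hs k 0 x (hs k 0 w ψ) := fun ψ => by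
    rw [hs_commute, bf_comm, h, sg_zero, one_smul]
  have e4 : ∀ φ ψ, siegelLift k x w h hx hw φ ⬝ᵥ ψ = φ ⬝ᵥ siegelLift k x w h hx hw ψ :=
    fun φ ψ => by
      rw [siegelLift_apply, siegelLift_apply]
      simp only [smul_dotProduct, dotProduct_smul, add_dotProduct, sub_dotProduct, dotProduct_add,
        dotProduct_sub, e1, e2, e3]
  rw [e4]
  congr 1
  exact (siegelLift k x w h hx hw).symm_apply_apply ψ

variable (k ι)

/-- The group generated by the standard extraspecial group, the quotients of two lifts of
transvections and the lifts of Siegel transformations. -/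
def brwGroup : Subgroup (FunSpace k ι ≃ₗ[k] FunSpace k ι) :=
  Subgroup.closure ({g | ∃ t v, g = hs k t v} ∪
    {g | ∃ v w, ∃ (hv : qf v = 1) (hw : qf w = 1),
      g = transvecLift k v hv * (transvecLift k w hw)⁻¹} ∪
    {g | ∃ x w, ∃ (h : bf x w = 0) (hx : qf x = 0) (hw : qf w = 0), g = siegelLift k x w h hx hw})

variable {k ι}

theorem hs_mem_brwGroup (t : ZMod 2) (v : QS ι) : hs k t v ∈ brwGroup k ι :=
  Subgroup.subset_closure (Or.inl (Or.inl ⟨t, v, rfl⟩))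

theorem exists_induces_of_mem_brwGroup {g : FunSpace k ι ≃ₗ[k] FunSpace k ι}
    (hg : g ∈ brwGroup k ι) : ∃ A ∈ evenGroup ι, Induces k g A := by
  induction hg using Subgroup.closure_induction with
  | mem g hg =>
    rcases hg with (⟨t, v, rfl⟩ | ⟨v, w, hv, hw, rfl⟩) | ⟨x, w, h, hx, hw, rfl⟩
    · exact ⟨1, one_mem _, induces_hs t v⟩
    · refine ⟨_, ?_, (induces_transvecLift v hv).mul (induces_transvecLift w hw).inv⟩
      rw [← closure_evenGens]
      exact Subgroup.subset_closure (Or.inl ⟨v, w, hv, hw, rfl⟩)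
    · exact ⟨_, ⟨siegel_mem h hx hw, dickson_siegel h hx hw⟩, induces_siegelLift x w h hx hw⟩
  | one => exact ⟨1, one_mem _, by rw [← hs_zero]; exact induces_hs 0 0⟩
  | mul g g' _ _ h h' =>
    obtain ⟨A, hA, hgA⟩ := h
    obtain ⟨B, hB, hgB⟩ := h'
    exact ⟨_, mul_mem hA hB, hgA.mul hgB⟩
  | inv g _ h =>
    obtain ⟨A, hA, hgA⟩ := h
    exact ⟨_, inv_mem hA, hgA.inv⟩

variable (k ι) in
/-- The linear isometries of the standard bilinear form. -/
def dotGroup : Subgroup (FunSpace k ι ≃ₗ[k] FunSpace k ι) where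
  carrier := {g | ∀ φ ψ, g φ ⬝ᵥ g ψ = φ ⬝ᵥ ψ}
  mul_mem' {g h} hg hh φ ψ := (hg _ _).trans (hh _ _)
  one_mem' _ _ := rfl
  inv_mem' {g} hg φ ψ := by
    have h := hg (g⁻¹ φ) (g⁻¹ ψ)
    rw [show g (g⁻¹ φ) = φ from g.apply_symm_apply φ,
      show g (g⁻¹ ψ) = ψ from g.apply_symm_apply ψ] at h
    exact h.symm

theorem transvecLift_mul_inv_mem_dotGroup {v w : QS ι} (hv : qf v = 1) (hw : qf w = 1) :
    transvecLift k v hv * (transvecLift k w hw)⁻¹ ∈ dotGroup k ι := fun φ ψ => by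
  have e : ∀ φ, transvecLift k w hw ((transvecLift k w hw)⁻¹ φ) = φ :=
    (transvecLift k w hw).apply_symm_apply
  have h := transvecLift_dotProduct w hw ((transvecLift k w hw)⁻¹ φ) ((transvecLift k w hw)⁻¹ ψ)
  rw [e, e] at h
  rw [LinearEquiv.mul_apply, LinearEquiv.mul_apply, transvecLift_dotProduct, h]

theorem brwGroup_le_dotGroup : brwGroup k ι ≤ dotGroup k ι := by
  refine (Subgroup.closure_le _).2 ?_
  rintro g ((⟨t, v, rfl⟩ | ⟨v, w, hv, hw, rfl⟩) | ⟨x, w, h, hx, hw, rfl⟩)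
  · exact hs_dotProduct_hs t v
  · exact transvecLift_mul_inv_mem_dotGroup hv hw
  · exact siegelLift_dotProduct x w h hx hw

theorem exists_mem_brwGroup_induces {A : QS ι ≃ₗ[ZMod 2] QS ι} (hA : A ∈ evenGroup ι) :
    ∃ g ∈ brwGroup k ι, Induces k g A := by
  rw [← closure_evenGens] at hA
  induction hA using Subgroup.closure_induction with
  | mem A hA =>
    rcases hA with ⟨v, w, hv, hw, rfl⟩ | ⟨x, w, h, hx, hw, rfl⟩
    · exact ⟨_, Subgroup.subset_closure (Or.inl (Or.inr ⟨v, w, hv, hw, rfl⟩)),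
        (induces_transvecLift v hv).mul (induces_transvecLift w hw).inv⟩
    · exact ⟨_, Subgroup.subset_closure (Or.inr ⟨x, w, h, hx, hw, rfl⟩),
        induces_siegelLift x w h hx hw⟩
  | one => exact ⟨1, one_mem _, by rw [← hs_zero]; exact induces_hs 0 0⟩
  | mul A B _ _ h h' =>
    obtain ⟨g, hg, hgA⟩ := h
    obtain ⟨g', hg', hgB⟩ := h'
    exact ⟨_, mul_mem hg hg', hgA.mul hgB⟩
  | inv A _ h =>
    obtain ⟨g, hg, hgA⟩ := h
    exact ⟨_, inv_mem hg, hgA.inv⟩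

theorem exists_induces_of_mem_orthGroup {A : QS ι ≃ₗ[ZMod 2] QS ι} (hA : A ∈ orthGroup ι) :
    ∃ g : FunSpace k ι ≃ₗ[k] FunSpace k ι, Induces k g A := by
  rw [← closure_orthGens] at hA
  induction hA using Subgroup.closure_induction with
  | mem A hA =>
    rcases hA with ⟨v, hv, rfl⟩ | ⟨x, w, h, hx, hw, rfl⟩
    · exact ⟨_, induces_transvecLift v hv⟩
    · exact ⟨_, induces_siegelLift x w h hx hw⟩
  | one => exact ⟨1, by rw [← hs_zero]; exact induces_hs 0 0⟩
  | mul A B _ _ h h' =>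
    obtain ⟨g, hgA⟩ := h
    obtain ⟨g', hgB⟩ := h'
    exact ⟨_, hgA.mul hgB⟩
  | inv A _ h =>
    obtain ⟨g, hgA⟩ := h
    exact ⟨_, hgA.inv⟩

theorem exists_eq_hs_of_induces_one {g : FunSpace k ι ≃ₗ[k] FunSpace k ι} (hg : Induces k g 1)
    (hd : g ∈ dotGroup k ι) : ∃ t v, g = hs k t v := by
  obtain ⟨c, v, hc⟩ := hg.exists_eq_smul
  have h := hd (Pi.single 0 1) (Pi.single 0 1)
  rw [hc, smul_dotProduct, dotProduct_smul, hs_dotProduct_hs, dotProduct_single_one,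
    Pi.single_eq_same, smul_eq_mul, smul_eq_mul, mul_one] at h
  rcases mul_self_eq_one_iff.1 h with rfl | rfl
  · exact ⟨0, v, LinearEquiv.ext fun φ => by rw [hc, one_smul]⟩
  · exact ⟨1, v, LinearEquiv.ext fun φ => by rw [hc, hs_apply_eq_smul k 1, sg_one]⟩

theorem exists_eq_mul_hs {g b : FunSpace k ι ≃ₗ[k] FunSpace k ι} {A : QS ι ≃ₗ[ZMod 2] QS ι}
    (hg : Induces k g A) (hb : Induces k b A) (hgd : g ∈ dotGroup k ι) (hbd : b ∈ dotGroup k ι) :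
    ∃ t v, g = b * hs k t v := by
  have h := hb.inv.mul hg
  rw [inv_mul_cancel] at h
  obtain ⟨t, v, e⟩ := exists_eq_hs_of_induces_one h (mul_mem (inv_mem hbd) hgd)
  exact ⟨t, v, by rw [← e, mul_inv_cancel_left]⟩

/-- A description free of generators: an isometry inducing an even transformation agrees with some
member of the group up to an isometry inducing the identity, and those are the elements `hs k t v`.
-/
theorem mem_brwGroup_iff {g : FunSpace k ι ≃ₗ[k] FunSpace k ι} :
    g ∈ brwGroup k ι ↔ g ∈ dotGroup k ι ∧ ∃ A ∈ evenGroup ι, Induces k g A := by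
  refine ⟨fun h => ⟨brwGroup_le_dotGroup h, exists_induces_of_mem_brwGroup h⟩, ?_⟩
  rintro ⟨hd, A, hA, hgA⟩
  obtain ⟨b, hb, hbA⟩ := exists_mem_brwGroup_induces (k := k) hA
  obtain ⟨t, v, rfl⟩ := exists_eq_mul_hs hgA hbA hd (brwGroup_le_dotGroup hb)
  exact mul_mem hb (hs_mem_brwGroup t v)

theorem commutator_mem_dotGroup {g h : FunSpace k ι ≃ₗ[k] FunSpace k ι}
    {A B : QS ι ≃ₗ[ZMod 2] QS ι} (hg : Induces k g A) (hh : Induces k h B) :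
    ⁅g, h⁆ ∈ dotGroup k ι := fun φ ψ => by
  obtain ⟨c, hc0, hc⟩ := hg.exists_multiplier
  obtain ⟨e, he0, he⟩ := hh.exists_multiplier
  have hc' : ∀ φ ψ, g⁻¹ φ ⬝ᵥ g⁻¹ ψ = c⁻¹ * (φ ⬝ᵥ ψ) := fun φ ψ => by
    have := hc (g⁻¹ φ) (g⁻¹ ψ)
    rw [show g (g⁻¹ φ) = φ from g.apply_symm_apply φ,
      show g (g⁻¹ ψ) = ψ from g.apply_symm_apply ψ] at this
    rw [this, inv_mul_cancel_left₀ hc0]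
  have he' : ∀ φ ψ, h⁻¹ φ ⬝ᵥ h⁻¹ ψ = e⁻¹ * (φ ⬝ᵥ ψ) := fun φ ψ => by
    have := he (h⁻¹ φ) (h⁻¹ ψ)
    rw [show h (h⁻¹ φ) = φ from h.apply_symm_apply φ,
      show h (h⁻¹ ψ) = ψ from h.apply_symm_apply ψ] at this
    rw [this, inv_mul_cancel_left₀ he0]
  change g (h (g⁻¹ (h⁻¹ φ))) ⬝ᵥ g (h (g⁻¹ (h⁻¹ ψ))) = _
  rw [hc, he, hc', he']
  field_simp

/-- Multipliers and Dickson invariants take values in abelian groups, so both become trivial on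
commutators. -/
theorem commutator_mem_brwGroup {g h : FunSpace k ι ≃ₗ[k] FunSpace k ι}
    {A B : QS ι ≃ₗ[ZMod 2] QS ι} (hg : Induces k g A) (hh : Induces k h B) :
    ⁅g, h⁆ ∈ brwGroup k ι := by
  refine mem_brwGroup_iff.2 ⟨commutator_mem_dotGroup hg hh, _, ?_,
    ((hg.mul hh).mul hg.inv).mul hh.inv⟩
  have hA := hg.mem_orthGroup
  have hB := hh.mem_orthGroup
  refine ⟨mul_mem (mul_mem (mul_mem hA hB) (inv_mem hA)) (inv_mem hB), ?_⟩
  rw [dickson_mul (mul_mem (mul_mem hA hB) (inv_mem hA)) (inv_mem hB),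
    dickson_mul (mul_mem hA hB) (inv_mem hA), dickson_mul hA hB, dickson_inv hA, dickson_inv hB,
    add_right_comm (dickson A), zmod_two_add_self, zero_add, zmod_two_add_self]

theorem hs_mem_of_hs_mem {H : Subgroup (FunSpace k ι ≃ₗ[k] FunSpace k ι)} {v : QS ι}
    {t : ZMod 2} (h : hs k t v ∈ H) (h1 : hs k 1 0 ∈ H) (s : ZMod 2) : hs k s v ∈ H := by
  rcases zmod_two_eq_zero_or_one (s + t) with e | e
  · have : s = t := by rw [← add_zero s, ← zmod_two_add_self t, ← add_assoc, e, zero_add]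
    rwa [this]
  · have h2 := mul_mem h1 h
    rw [hs_mul, zero_add] at h2
    convert h2 using 2
    rw [← e]; simp [add_assoc, zmod_two_add_self]

theorem Induces.exists_mul_hs_eq {g : FunSpace k ι ≃ₗ[k] FunSpace k ι} {A : QS ι ≃ₗ[ZMod 2] QS ι}
    (hg : Induces k g A) (v : QS ι) : ∃ t, g * hs k 0 v = hs k t (A v) * g := by
  obtain ⟨t, ht⟩ := hg v
  refine ⟨t, LinearEquiv.ext fun φ => ?_⟩
  rw [LinearEquiv.mul_apply, LinearEquiv.mul_apply, ht, hs_apply_eq_smul k t]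

/-- Conjugation by `g` sends `1 - D_v` to `1 - D_w` or `1 + D_w`, where `w = A v`, and `1 + D_w =
D_w (1 - D_w)`. -/
theorem Induces.mul_transvecLift {g : FunSpace k ι ≃ₗ[k] FunSpace k ι}
    {A : QS ι ≃ₗ[ZMod 2] QS ι} (hg : Induces k g A) {v : QS ι} (hv : qf v = 1)
    (hw : qf (A v) = 1) : ∃ t u, g * transvecLift k v hv =
      hs k t u * transvecLift k (A v) hw * g := by
  obtain ⟨t, ht⟩ := hg v
  rcases zmod_two_eq_zero_or_one t with rfl | rfl
  · refine ⟨0, 0, LinearEquiv.ext fun φ => ?_⟩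
    rw [hs_zero, one_mul, LinearEquiv.mul_apply, LinearEquiv.mul_apply, transvecLift_apply,
      transvecLift_apply, map_sub, ht, sg_zero, one_smul]
  · refine ⟨0, A v, LinearEquiv.ext fun φ => ?_⟩
    rw [LinearEquiv.mul_apply, LinearEquiv.mul_apply, LinearEquiv.mul_apply, transvecLift_apply,
      transvecLift_apply, map_sub, map_sub, ht, hs_hs_self, hw, sg_one]
    module

/-- For `|ι| ≥ 3` the derived subgroup of the normalizer is generated by the standard extraspecial
group, the quotients of two lifts of transvections and the lifts of Siegel transformations. -/
theorem derivedNormalizer_eq (h3 : 3 ≤ Fintype.card ι) : derivedNormalizer k ι = brwGroup k ι := by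
  have : Nonempty ι := Fintype.card_pos_iff.1 (by omega)
  refine le_antisymm (Subgroup.commutator_le.2 fun g hg h hh => ?_) ?_
  · obtain ⟨A, hA⟩ := mem_normalizer_iff_exists_induces.1 hg
    obtain ⟨B, hB⟩ := mem_normalizer_iff_exists_induces.1 hh
    exact commutator_mem_brwGroup hA hB
  have hcomm : ∀ {g h : FunSpace k ι ≃ₗ[k] FunSpace k ι} {A B : QS ι ≃ₗ[ZMod 2] QS ι}
      (_ : Induces k g A) (_ : Induces k h B), ⁅g, h⁆ ∈ derivedNormalizer k ι :=
    fun hg hh => Subgroup.commutator_mem_commutator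
      (mem_normalizer_iff_exists_induces.2 ⟨_, hg⟩) (mem_normalizer_iff_exists_induces.2 ⟨_, hh⟩)
  have hone : hs k 1 (0 : QS ι) ∈ derivedNormalizer k ι := by
    obtain ⟨i⟩ := ‹Nonempty ι›
    have := hcomm (induces_hs (k := k) 0 (eVec i)) (induces_hs (k := k) 0 (fVec i))
    rw [commutatorElement_def, hs_inv, hs_inv, hs_mul, hs_mul, hs_mul] at this
    have e : (eVec i + fVec i + eVec i + fVec i : QS ι) = 0 := by
      rw [add_assoc (eVec i + fVec i), qs_add_self]
    rw [e, qf_eVec, qf_fVec] at this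
    convert this using 2
    simp [eVec, fVec, zmod_two_add_self]
  -- For `u` not orthogonal to `v`, the commutator of the lift `1 - D_v` with `D_u` is `±D_{u+v} D_u
  -- = ±D_v`.
  have hns : ∀ (t) (v : QS ι), qf v = 1 → hs k t v ∈ derivedNormalizer k ι := fun t v hv => by
    have hv0 : v ≠ 0 := fun h => by rw [h, qf_zero] at hv; exact zero_ne_one hv
    obtain ⟨u, -, hu⟩ := exists_bf_eq_one_of_mem_offSub (S := ∅) (x := v)
      (fun i hi => absurd hi (Finset.notMem_empty i)) hv0
    have hm := induces_transvecLift (k := k) v hv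
    obtain ⟨s, hs'⟩ := hm.exists_mul_hs_eq u
    have h := hcomm hm (induces_hs (k := k) 0 u)
    rw [commutatorElement_def, hs', mul_inv_cancel_right, hs_inv, hs_mul, transvec_apply, hu,
      one_smul, add_right_comm u v u, qs_add_self, zero_add (qf u),
      zero_add v] at h
    exact hs_mem_of_hs_mem h hone t
  -- A singular `v` is the sum of the nonsingular vectors `v + u` and `u`, with `u` orthogonal to
  -- `v`.
  have hsm : ∀ t (v : QS ι), hs k t v ∈ derivedNormalizer k ι := fun t v => by
    rcases zmod_two_eq_zero_or_one (qf v) with hv | hv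
    · obtain ⟨u, hu, hvu, -⟩ := exists_orthogonal_nonsingular h3 v v
      have h := mul_mem (hns 0 (v + u) (by rw [qf_add, hv, hu, hvu, zero_add, add_zero]))
        (hns 0 u hu)
      rw [hs_mul, qs_add_add_self] at h
      exact hs_mem_of_hs_mem h hone t
    · exact hns t v hv
  -- With `w = A v` and `m` inducing `A`, the quotient of the lifts is, up to an extraspecial
  -- element, the commutator of the first lift with `m`.
  have htt : ∀ (v w : QS ι) (hv : qf v = 1) (hw : qf w = 1),
      transvecLift k v hv * (transvecLift k w hw)⁻¹ ∈ derivedNormalizer k ι := fun v w hv hw => by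
    obtain ⟨A, hA, rfl⟩ := exists_map_eq_of_nonsingular h3 hv hw
    obtain ⟨m, hm⟩ := exists_induces_of_mem_orthGroup (k := k) hA
    obtain ⟨t, u, e⟩ := hm.mul_transvecLift hv hw
    have h := hcomm (induces_transvecLift (k := k) v hv) hm
    have e2 : ⁅transvecLift k v hv, m⁆ =
        transvecLift k v hv * (m * transvecLift k v hv * m⁻¹)⁻¹ := by
      rw [commutatorElement_def]; group
    rw [e2, e, mul_inv_cancel_right, _root_.mul_inv_rev, ← mul_assoc] at h
    have := mul_mem h (hsm t u)
    rwa [inv_mul_cancel_right] at this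
  refine (Subgroup.closure_le _).2 ?_
  rintro g ((⟨t, v, rfl⟩ | ⟨v, w, hv, hw, rfl⟩) | ⟨x, w, h, hx, hw, rfl⟩)
  · exact hsm t v
  · exact htt v w hv hw
  -- The Siegel lift and the product of two quotients of transvection lifts are isometries inducing
  -- the same transformation, hence differ by an extraspecial element.
  · obtain ⟨a, b, c, d, ha, hb, hc, hd, e⟩ := exists_siegel_eq h3 h hx hw
    have h1 : Induces k (transvecLift k a ha * (transvecLift k b hb)⁻¹ *
        (transvecLift k c hc * (transvecLift k d hd)⁻¹)) (siegel x w h) := by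
      rw [e]
      exact ((induces_transvecLift a ha).mul (induces_transvecLift b hb).inv).mul
        ((induces_transvecLift c hc).mul (induces_transvecLift d hd).inv)
    obtain ⟨t, v, e'⟩ := exists_eq_mul_hs (induces_siegelLift x w h hx hw) h1
      (siegelLift_dotProduct x w h hx hw)
      (mul_mem (transvecLift_mul_inv_mem_dotGroup ha hb) (transvecLift_mul_inv_mem_dotGroup hc hd))
    rw [SetLike.mem_coe, e']
    exact mul_mem (mul_mem (htt a b ha hb) (htt c d hc hd)) (hsm t v)

end Lifts

/-! ### Descent along `g ↦ g ⊗ 1`, giving the Bolt-Room-Wall groups of small rank. -/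

section Tensor

variable {k : Type*} [Field k] [CharZero k] {ι κ : Type*} [Fintype ι] [DecidableEq ι]
  [Fintype κ] [DecidableEq κ]

open Matrix

theorem tensorOne_apply (g : FunSpace k ι ≃ₗ[k] FunSpace k ι) (φ : FunSpace k (ι ⊕ κ))
    (z : ι ⊕ κ → ZMod 2) : tensorOne k ι κ g φ z =
      g (fun x => φ (Sum.elim x (z ∘ Sum.inr))) (z ∘ Sum.inl) := rfl

theorem tensorOne_slice (g : FunSpace k ι ≃ₗ[k] FunSpace k ι) (φ : FunSpace k (ι ⊕ κ))
    (y : κ → ZMod 2) : (fun x => tensorOne k ι κ g φ (Sum.elim x y)) =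
      g (fun x => φ (Sum.elim x y)) := rfl

theorem tensorOne_injective : Function.Injective (tensorOne k ι κ) := fun g h e => by
  refine LinearEquiv.ext fun φ => ?_
  have := tensorOne_slice g (fun z : ι ⊕ κ → ZMod 2 => φ (z ∘ Sum.inl)) 0
  rw [e, tensorOne_slice] at this
  exact this.symm

theorem dotProduct_sum (φ ψ : FunSpace k (ι ⊕ κ)) :
    φ ⬝ᵥ ψ = ∑ y : κ → ZMod 2, (fun x => φ (Sum.elim x y)) ⬝ᵥ (fun x => ψ (Sum.elim x y)) := by
  simp only [dotProduct]
  rw [Finset.sum_comm, ← Fintype.sum_prod_type']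
  exact Fintype.sum_equiv (Equiv.sumArrowEquivProdArrow ι κ (ZMod 2)) _ _ fun z => by
    simp [Equiv.sumArrowEquivProdArrow]

theorem tensorOne_mem_dotGroup {g : FunSpace k ι ≃ₗ[k] FunSpace k ι} :
    tensorOne k ι κ g ∈ dotGroup k (ι ⊕ κ) ↔ g ∈ dotGroup k ι := by
  constructor
  · intro h φ ψ
    have := h (fun z => φ (z ∘ Sum.inl)) (fun z => ψ (z ∘ Sum.inl))
    rw [dotProduct_sum, dotProduct_sum] at this
    simp only [tensorOne_slice, Sum.elim_comp_inl, Finset.sum_const, nsmul_eq_mul] at this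
    have h0 : ((Finset.univ : Finset (κ → ZMod 2)).card : k) ≠ 0 :=
      Nat.cast_ne_zero.2 (Finset.card_ne_zero_of_mem (Finset.mem_univ 0))
    exact mul_left_cancel₀ h0 this
  · intro h φ ψ
    rw [dotProduct_sum, dotProduct_sum]
    exact Finset.sum_congr rfl fun y _ => by
      rw [tensorOne_slice, tensorOne_slice]; exact h _ _

theorem tensorOne_hs (t : ZMod 2) (v : QS ι) :
    tensorOne k ι κ (hs k t v) = hs k t ((splitQS ι κ).symm (v, 0)) := by
  refine LinearEquiv.ext fun φ => funext fun z => ?_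
  obtain ⟨x, y, rfl⟩ : ∃ x y, z = Sum.elim x y := ⟨_, _, (Sum.elim_comp_inl_inr z).symm⟩
  rw [tensorOne_apply, hs_apply, hs_apply, splitQS_symm_apply]
  congr 2
  · simp [dotProduct]
  · ext i; cases i <;> simp

theorem tensorOne_comm_hs (g : FunSpace k ι ≃ₗ[k] FunSpace k ι) (w : QS κ)
    (φ : FunSpace k (ι ⊕ κ)) :
    tensorOne k ι κ g (hs k 0 ((splitQS ι κ).symm (0, w)) φ) =
      hs k 0 ((splitQS ι κ).symm (0, w)) (tensorOne k ι κ g φ) := by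
  refine funext fun z => ?_
  obtain ⟨x, y, rfl⟩ : ∃ x y, z = Sum.elim x y := ⟨_, _, (Sum.elim_comp_inl_inr z).symm⟩
  have hd : ∀ x : ι → ZMod 2,
      ((splitQS ι κ).symm (0, w)).2 ⬝ᵥ (Sum.elim x y) = w.2 ⬝ᵥ y := fun x => by
    simp [splitQS_symm_apply, dotProduct]
  have ha : ∀ x : ι → ZMod 2,
      Sum.elim x y + ((splitQS ι κ).symm (0, w)).1 = Sum.elim x (y + w.1) := fun x => by
    ext i; cases i <;> simp [splitQS_symm_apply]
  have e : (fun x => hs k 0 ((splitQS ι κ).symm (0, w)) φ (Sum.elim x y)) =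
      sg k (w.2 ⬝ᵥ y) • fun x => φ (Sum.elim x (y + w.1)) := by
    ext x
    rw [hs_apply, hd, ha, zero_add]; rfl
  rw [hs_apply, hd, ha, zero_add, tensorOne_apply, tensorOne_apply]
  simp only [Sum.elim_comp_inl, Sum.elim_comp_inr]
  rw [e, map_smul]; rfl

theorem hs_splitQS (p : QS ι × QS κ) (φ : FunSpace k (ι ⊕ κ)) :
    hs k 0 ((splitQS ι κ).symm p) φ = hs k 0 ((splitQS ι κ).symm (p.1, 0))
      (hs k 0 ((splitQS ι κ).symm (0, p.2)) φ) := by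
  rw [← LinearEquiv.mul_apply, hs_mul, ← map_add]
  congr 2
  · simp [splitQS_symm_apply, dotProduct]
  · simp

theorem Induces.tensorOne {g : FunSpace k ι ≃ₗ[k] FunSpace k ι} {A : QS ι ≃ₗ[ZMod 2] QS ι}
    (hg : Induces k g A) : Induces k (tensorOne k ι κ g) (extQS κ A) := fun v => by
  obtain ⟨p, rfl⟩ := (splitQS ι κ).symm.surjective v
  obtain ⟨t, e⟩ := hg.exists_mul_hs_eq p.1
  refine ⟨t, fun φ => ?_⟩
  have h := congrArg (BarnesWall.tensorOne k ι κ) e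
  rw [map_mul, map_mul, tensorOne_hs, tensorOne_hs] at h
  have h' := LinearEquiv.congr_fun h (hs k 0 ((splitQS ι κ).symm (0, p.2)) φ)
  rw [LinearEquiv.mul_apply, LinearEquiv.mul_apply, tensorOne_comm_hs, hs_apply_eq_smul k t] at h'
  rw [hs_splitQS, h', extQS_apply, hs_splitQS (A p.1, p.2)]

/-- The operator `g ⊗ 1` commutes with the extraspecial group of the second factor, so the second
component of `u` is orthogonal to everything and vanishes. -/
theorem exists_eq_hs_of_tensorOne_eq {g : FunSpace k ι ≃ₗ[k] FunSpace k ι} {t : ZMod 2}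
    {u : QS (ι ⊕ κ)} (h : tensorOne k ι κ g = hs k t u) : ∃ v, g = hs k t v := by
  obtain ⟨p, rfl⟩ := (splitQS ι κ).symm.surjective u
  have hp : p.2 = 0 := by
    refine bf_nondegenerate _ fun w => ?_
    have hb : bf ((splitQS ι κ).symm p) ((splitQS ι κ).symm (0, w)) = bf p.2 w := by
      simp [bf_apply, splitQS_symm_apply]
    rw [← hb]
    have e := tensorOne_comm_hs g w (fun _ => 1)
    rw [h, hs_apply_eq_smul, hs_apply_eq_smul k t _ (fun _ => 1), map_smul] at e
    have e2 := smul_right_injective (FunSpace k (ι ⊕ κ)) (sg_ne_zero k t) e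
    rw [hs_commute] at e2
    have h0 : hs k 0 ((splitQS ι κ).symm (0, w)) (hs k 0 ((splitQS ι κ).symm p) (fun _ => 1)) ≠ 0 :=
      (LinearEquiv.map_ne_zero_iff _).2 ((LinearEquiv.map_ne_zero_iff _).2
        fun h => one_ne_zero (congrFun h 0))
    have e3 := smul_left_injective k h0 (e2.trans (one_smul k _).symm)
    exact sg_injective k (e3.trans (sg_zero k).symm)
  refine ⟨p.1, tensorOne_injective (κ := κ) ?_⟩
  rw [h, tensorOne_hs, ← hp]

/-- Conjugates by `g ⊗ 1` of elements `x ⊗ 1` are again of this form, so `g` inherits the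
normalizing property. Being an isometry and the parity of the induced transformation are both
unaffected by the extra factor. -/
theorem tensorOne_mem_brwGroup [Nonempty ι] {g : FunSpace k ι ≃ₗ[k] FunSpace k ι} :
    tensorOne k ι κ g ∈ brwGroup k (ι ⊕ κ) ↔ g ∈ brwGroup k ι := by
  constructor
  · intro h
    have key : ∀ g : FunSpace k ι ≃ₗ[k] FunSpace k ι, tensorOne k ι κ g ∈ brwGroup k (ι ⊕ κ) →
        ∀ x ∈ stdLower k ι, g * x * g⁻¹ ∈ stdLower k ι := fun g h x hx => by
      obtain ⟨s, v, rfl⟩ := (mem_stdLower k).1 hx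
      obtain ⟨B, -, hB⟩ := exists_induces_of_mem_brwGroup h
      have hn := Subgroup.mem_normalizer_iff.1 (mem_normalizer_iff_exists_induces.2 ⟨B, hB⟩)
      obtain ⟨t, u, e⟩ := (mem_stdLower k).1 ((hn _).1 ((mem_stdLower k).2
        ⟨s, (splitQS ι κ).symm (v, 0), rfl⟩))
      rw [← tensorOne_hs, ← map_mul, ← map_inv, ← map_mul] at e
      obtain ⟨w, hw⟩ := exists_eq_hs_of_tensorOne_eq e
      exact (mem_stdLower k).2 ⟨t, w, hw⟩
    have hN : g ∈ Subgroup.normalizer (stdLower k ι : Set (FunSpace k ι ≃ₗ[k] FunSpace k ι)) := by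
      refine Subgroup.mem_normalizer_iff.2 fun x => ⟨key g h x, fun hx => ?_⟩
      have := key g⁻¹ (by rw [map_inv]; exact inv_mem h) _ hx
      simpa [mul_assoc] using this
    obtain ⟨A, hA⟩ := mem_normalizer_iff_exists_induces.1 hN
    obtain ⟨hd, B, hB, hgB⟩ := mem_brwGroup_iff.1 h
    have e := hA.tensorOne.unique hgB
    refine mem_brwGroup_iff.2 ⟨tensorOne_mem_dotGroup.1 hd, A, ⟨hA.mem_orthGroup, ?_⟩, hA⟩
    rw [← dickson_extQS (κ := κ), e]
    exact hB.2
  · intro h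
    obtain ⟨hd, A, hA, hgA⟩ := mem_brwGroup_iff.1 h
    refine mem_brwGroup_iff.2 ⟨tensorOne_mem_dotGroup.2 hd, _, ⟨extQS_mem.2 hA.1, ?_⟩,
      hgA.tensorOne⟩
    rw [dickson_extQS, hA.2]

theorem BRW0_eq (k : Type*) [Field k] [CharZero k] {d : ℕ} (hd : 0 < d) :
    BRW0 k d = brwGroup k (Fin d) := by
  rw [BRW0]
  split_ifs with h
  · exact derivedNormalizer_eq (by simpa using h)
  · rw [derivedNormalizer_eq (by simp)]
    have : Nonempty (Fin d) := ⟨⟨0, hd⟩⟩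
    ext g
    exact tensorOne_mem_brwGroup

end Tensor

/-! ### Base change from the rational numbers -/

section BaseChange

variable (k : Type*) [Field k] [CharZero k] {ι : Type*} [Fintype ι] [DecidableEq ι]

/-- The homomorphism of general linear groups given by base change from `ℚ`. -/
noncomputable def baseChange : (FunSpace ℚ ι ≃ₗ[ℚ] FunSpace ℚ ι) →* (FunSpace k ι ≃ₗ[k] FunSpace k ι) :=
  (LinearMap.GeneralLinearGroup.generalLinearEquiv k (FunSpace k ι)).toMonoidHom.comp
    ((Units.map ((LinearMap.toMatrixAlgEquiv' (R := k) (n := ι → ZMod 2)).symm.toRingEquiv.toRingHom.comp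
      ((algebraMap ℚ k).mapMatrix.comp
        (LinearMap.toMatrixAlgEquiv' (R := ℚ) (n := ι → ZMod 2)).toRingEquiv.toRingHom)).toMonoidHom).comp
      (LinearMap.GeneralLinearGroup.generalLinearEquiv ℚ (FunSpace ℚ ι)).symm.toMonoidHom)

/-- The inclusion of the rational functions. -/
def ratFun (φ : FunSpace ℚ ι) : FunSpace k ι := fun x => (φ x : k)

theorem baseChange_ratFun (g : FunSpace ℚ ι ≃ₗ[ℚ] FunSpace ℚ ι) (φ : FunSpace ℚ ι) :
    baseChange k g (ratFun k φ) = ratFun k (g φ) := by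
  change Matrix.toLin' ((LinearMap.toMatrix' (g : FunSpace ℚ ι →ₗ[ℚ] FunSpace ℚ ι)).map
    (algebraMap ℚ k)) (ratFun k φ) = _
  rw [Matrix.toLin'_apply]
  ext x
  have := RingHom.map_mulVec (algebraMap ℚ k)
    (LinearMap.toMatrix' (g : FunSpace ℚ ι →ₗ[ℚ] FunSpace ℚ ι)) φ x
  rw [LinearMap.toMatrix'_mulVec] at this
  exact this.symm

variable {k} in
theorem ext_ratFun {g h : FunSpace k ι ≃ₗ[k] FunSpace k ι}
    (e : ∀ φ, g (ratFun k φ) = h (ratFun k φ)) : g = h := by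
  refine LinearEquiv.toLinearMap_injective (LinearMap.pi_ext' fun a => LinearMap.ext_ring ?_)
  have := e (Pi.single a 1)
  have h1 : ratFun k (Pi.single a 1 : FunSpace ℚ ι) = Pi.single a 1 := by
    ext x; by_cases hx : x = a
    · subst hx; simp [ratFun]
    · simp [ratFun, hx]
  rw [h1] at this
  exact this

theorem ratFun_injective : Function.Injective (ratFun k : FunSpace ℚ ι → FunSpace k ι) :=
  fun _ _ h => funext fun x => Rat.cast_injective (congrFun h x)

theorem baseChange_injective :
    Function.Injective (baseChange k : (FunSpace ℚ ι ≃ₗ[ℚ] FunSpace ℚ ι) →* _) := fun g h e => by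
  refine LinearEquiv.ext fun φ => ratFun_injective k ?_
  rw [← baseChange_ratFun, e, baseChange_ratFun]

theorem hs_ratFun (t : ZMod 2) (v : QS ι) (φ : FunSpace ℚ ι) :
    hs k t v (ratFun k φ) = ratFun k (hs ℚ t v φ) := by
  ext x
  simp only [ratFun, hs_apply, Rat.cast_mul]
  congr 1
  rcases zmod_two_eq_zero_or_one (t + v.2 ⬝ᵥ x) with h | h <;> rw [h] <;> simp

theorem baseChange_hs (t : ZMod 2) (v : QS ι) : baseChange k (hs ℚ t v) = hs k t v :=
  ext_ratFun fun φ => by rw [baseChange_ratFun, hs_ratFun]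

theorem baseChange_transvecLift (v : QS ι) (hv : qf v = 1) :
    baseChange k (transvecLift ℚ v hv) = transvecLift k v hv :=
  ext_ratFun fun φ => by
    rw [baseChange_ratFun, transvecLift_apply, transvecLift_apply, hs_ratFun]
    ext x; simp [ratFun]

theorem baseChange_siegelLift (x w : QS ι) (h : bf x w = 0) (hx : qf x = 0) (hw : qf w = 0) :
    baseChange k (siegelLift ℚ x w h hx hw) = siegelLift k x w h hx hw :=
  ext_ratFun fun φ => by
    rw [baseChange_ratFun, siegelLift_apply, siegelLift_apply, hs_ratFun, hs_ratFun, hs_ratFun]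
    ext x; simp [ratFun]

/-- The generators have rational matrices. The lattice side lives over `ℝ` and the target over an
arbitrary field, so the comparison passes through `ℚ`. -/
theorem map_baseChange_brwGroup : (brwGroup ℚ ι).map (baseChange k) = brwGroup k ι := by
  rw [brwGroup, MonoidHom.map_closure, brwGroup]
  congr 1
  ext g
  constructor
  · rintro ⟨_, (⟨t, v, rfl⟩ | ⟨v, w, hv, hw, rfl⟩) | ⟨x, w, h, hx, hw, rfl⟩, rfl⟩
    · exact Or.inl (Or.inl ⟨t, v, baseChange_hs k t v⟩)
    · refine Or.inl (Or.inr ⟨v, w, hv, hw, ?_⟩)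
      rw [map_mul, map_inv, baseChange_transvecLift, baseChange_transvecLift]
    · exact Or.inr ⟨x, w, h, hx, hw, baseChange_siegelLift k x w h hx hw⟩
  · rintro ((⟨t, v, rfl⟩ | ⟨v, w, hv, hw, rfl⟩) | ⟨x, w, h, hx, hw, rfl⟩)
    · exact ⟨_, Or.inl (Or.inl ⟨t, v, rfl⟩), baseChange_hs k t v⟩
    · refine ⟨_, Or.inl (Or.inr ⟨v, w, hv, hw, rfl⟩), ?_⟩
      rw [map_mul, map_inv, baseChange_transvecLift, baseChange_transvecLift]
    · exact ⟨_, Or.inr ⟨x, w, h, hx, hw, rfl⟩, baseChange_siegelLift k x w h hx hw⟩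

theorem baseChange_mem_stdLower [Nonempty ι] {g : FunSpace ℚ ι ≃ₗ[ℚ] FunSpace ℚ ι} :
    baseChange k g ∈ stdLower k ι ↔ g ∈ stdLower ℚ ι := by
  rw [mem_stdLower, mem_stdLower]
  refine exists_congr fun t => exists_congr fun v => ?_
  rw [← baseChange_hs]
  exact (baseChange_injective k).eq_iff

/-- The isomorphism of the groups `brwGroup` over `ℚ` and over `k`. -/
noncomputable def brwGroupEquiv : brwGroup ℚ ι ≃* brwGroup k ι :=
  ((brwGroup ℚ ι).equivMapOfInjective (baseChange k) (baseChange_injective k)).trans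
    (MulEquiv.subgroupCongr (map_baseChange_brwGroup k))

theorem coe_brwGroupEquiv (g : brwGroup ℚ ι) :
    (brwGroupEquiv k g : FunSpace k ι ≃ₗ[k] FunSpace k ι) = baseChange k g := rfl

end BaseChange

/-! ### Lattices on which the square of the augmentation ideal is divisible by two -/

section Stable

variable {E V : Type*} [NormedAddCommGroup E] [InnerProductSpace ℝ E]
  [NormedAddCommGroup V] [InnerProductSpace ℝ V]

theorem isometry_mul_apply (g h : E ≃ₗᵢ[ℝ] E) (x : E) : (g * h) x = g (h x) := rfl

theorem mem_latAut_of {L : Submodule ℤ E} {g : E ≃ₗᵢ[ℝ] E} (h : ∀ x ∈ L, g x ∈ L)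
    (h' : ∀ x ∈ L, g⁻¹ x ∈ L) : g ∈ latAut L := fun x => by
  refine ⟨fun hx => ?_, h x⟩
  have := h' _ hx
  rwa [show g⁻¹ (g x) = x from g.symm_apply_apply x] at this

/-- `R` preserves `L`, and `(1 - g) (1 - h) L ⊆ 2 L` for all `g, h ∈ R`. -/
def SquareStable (L : Submodule ℤ E) (R : Subgroup (E ≃ₗᵢ[ℝ] E)) : Prop :=
  R ≤ latAut L ∧ ∀ g ∈ R, ∀ h ∈ R, ∀ x ∈ L, ∃ y ∈ L, (x - h x) - g (x - h x) = (2 : ℝ) • y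

theorem SquareStable.mono {L : Submodule ℤ E} {R S : Subgroup (E ≃ₗᵢ[ℝ] E)}
    (h : SquareStable L S) (hRS : R ≤ S) : SquareStable L R :=
  ⟨hRS.trans h.1, fun g hg k hk => h.2 g (hRS hg) k (hRS hk)⟩

/-- The identities `1 - ab = (1 - b) + (1 - a) b = (1 - a) + a (1 - b)` and `1 - a⁻¹ = -(1 - a) a⁻¹
= -a⁻¹ (1 - a)` reduce each of the two factors in turn to generators. -/
theorem squareStable_closure {L : Submodule ℤ E} {S : Set (E ≃ₗᵢ[ℝ] E)} (hS : S ⊆ latAut L)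
    (h2 : ∀ g ∈ S, ∀ h ∈ S, ∀ x ∈ L, ∃ y ∈ L, (x - h x) - g (x - h x) = (2 : ℝ) • y) :
    SquareStable L (Subgroup.closure S) := by
  have hle : Subgroup.closure S ≤ latAut L := (Subgroup.closure_le _).2 hS
  refine ⟨hle, ?_⟩
  have step : ∀ g ∈ S, ∀ h ∈ Subgroup.closure S, ∀ x ∈ L, ∃ y ∈ L,
      (x - h x) - g (x - h x) = (2 : ℝ) • y := by
    intro g hg h hh
    induction hh using Subgroup.closure_induction with
    | mem h hh => exact h2 g hg h hh
    | one => exact fun x _ => ⟨0, zero_mem _, by simp⟩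
    | mul a b ha hb iha ihb =>
      intro x hx
      obtain ⟨y, hy, e⟩ := iha (b x) ((hle hb x).2 hx)
      obtain ⟨z, hz, e'⟩ := ihb x hx
      refine ⟨y + z, add_mem hy hz, ?_⟩
      rw [smul_add, ← e, ← e', isometry_mul_apply]
      simp only [map_sub]
      abel
    | inv a ha iha =>
      intro x hx
      obtain ⟨y, hy, e⟩ := iha (a⁻¹ x) ((hle (inv_mem ha) x).2 hx)
      refine ⟨-y, neg_mem hy, ?_⟩
      rw [smul_neg, ← e, show a (a⁻¹ x) = x from a.apply_symm_apply x]
      simp only [map_sub]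
      abel
  intro g hg h hh
  induction hg using Subgroup.closure_induction with
  | mem g hg => exact step g hg h hh
  | one => exact fun x _ => ⟨0, zero_mem _, by simp⟩
  | mul a b ha hb iha ihb =>
    intro x hx
    obtain ⟨y, hy, e⟩ := iha x hx
    obtain ⟨z, hz, e'⟩ := ihb x hx
    refine ⟨y + a z, add_mem hy ((hle ha z).2 hz), ?_⟩
    rw [smul_add, ← e, ← map_smul a, ← e', isometry_mul_apply]
    simp only [map_sub]
    abel
  | inv a ha iha =>
    intro x hx
    obtain ⟨y, hy, e⟩ := iha x hx
    refine ⟨-(a⁻¹ y), neg_mem ((hle (inv_mem ha) y).2 hy), ?_⟩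
    rw [smul_neg, ← map_smul a⁻¹, ← e]
    have h1 : ∀ z, a⁻¹ (a z) = z := a.symm_apply_apply
    simp only [map_sub, h1]
    abel

/-- Any two elements of `R` commute or anticommute. -/
def SignCommute (R : Subgroup (E ≃ₗᵢ[ℝ] E)) : Prop :=
  ∀ g ∈ R, ∀ h ∈ R, (∀ x, g (h x) = h (g x)) ∨ (∀ x, g (h x) = -h (g x))

theorem sultry_apply (f : E ≃ₗᵢ[ℝ] E) (x : E) : sultry f x = x - f x := rfl

theorem sultry_add_apply {f : E ≃ₗᵢ[ℝ] E} (hf : IsFourvolution f) (x : E) :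
    sultry f (x + f x) = (2 : ℝ) • x := by
  rw [sultry_apply, map_add, hf]; module

theorem sultry_surjective {f : E ≃ₗᵢ[ℝ] E} (hf : IsFourvolution f) :
    Function.Surjective (sultry f) := fun x =>
  ⟨(2⁻¹ : ℝ) • (x + f x), by rw [map_smul, sultry_add_apply hf, smul_smul]; norm_num⟩

theorem inner_sultry {f : E ≃ₗᵢ[ℝ] E} (hf : IsFourvolution f) (x y : E) :
    inner ℝ (sultry f x) (sultry f y) = 2 * inner ℝ x y := by
  have h1 : inner ℝ (f x) y = -inner ℝ x (f y) := by
    have := f.inner_map_map (f x) y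
    rw [hf, inner_neg_left] at this
    exact this.symm
  rw [sultry_apply, sultry_apply, inner_sub_left, inner_sub_right, inner_sub_right,
    f.inner_map_map, h1]
  ring

section Twist

variable {M : Submodule ℤ E} {Q : Subgroup (E ≃ₗᵢ[ℝ] E)} {f : E ≃ₗᵢ[ℝ] E}

theorem SquareStable.sultry_mem (h : SquareStable M Q) (hf : f ∈ Q) {x : E} (hx : x ∈ M) :
    sultry f x ∈ M := sub_mem hx ((h.1 hf x).2 hx)

/-- As `f⁻¹ = -f`, the hypothesis yields `(1 + f)(1 - g) x = 2 m`; multiplying by `1 - f` and using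
`(1 - f)(1 + f) = 2` leaves `(1 - g) x = (1 - f) m`. -/
theorem SquareStable.exists_sub_eq_sultry (h : SquareStable M Q) (hf : f ∈ Q)
    (hf4 : IsFourvolution f) {g : E ≃ₗᵢ[ℝ] E} (hg : g ∈ Q) {x : E} (hx : x ∈ M) :
    ∃ m ∈ M, x - g x = sultry f m := by
  obtain ⟨m, hm, e⟩ := h.2 f⁻¹ (inv_mem hf) g hg x hx
  refine ⟨m, hm, ?_⟩
  have hinv : ∀ z, f⁻¹ z = -f z := fun z => by
    apply f.injective
    rw [show f (f⁻¹ z) = z from f.apply_symm_apply z, map_neg, hf4, neg_neg]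
  rw [hinv, sub_neg_eq_add] at e
  have e2 := congrArg (sultry f) e
  rw [sultry_add_apply hf4, map_smul] at e2
  exact smul_right_injective E (two_ne_zero (α := ℝ)) e2

/-- In the anticommuting case `(1 - f) g = g (1 + f) = g f (1 - f)`. So every twist by `1 - f` of a
`Q`-stable lattice is again `Q`-stable. -/
theorem SignCommute.exists_sultry_apply (hc : SignCommute Q) (hf : f ∈ Q)
    (hf4 : IsFourvolution f) {g : E ≃ₗᵢ[ℝ] E} (hg : g ∈ Q) :
    ∃ g' ∈ Q, ∀ x, sultry f (g x) = g' (sultry f x) := by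
  rcases hc g hg f hf with h | h
  · exact ⟨g, hg, fun x => by rw [sultry_apply, sultry_apply, map_sub, h]⟩
  · refine ⟨g * f, mul_mem hg hf, fun x => ?_⟩
    rw [sultry_apply, sultry_apply, isometry_mul_apply, map_sub, map_sub, hf4, h,
      map_neg]
    abel

theorem SquareStable.comap_sultry (h : SquareStable M Q) (hc : SignCommute Q) (hf : f ∈ Q)
    (hf4 : IsFourvolution f) : SquareStable (M.comap ((sultry f).restrictScalars ℤ)) Q := by
  have key : ∀ g ∈ Q, ∀ x ∈ M.comap ((sultry f).restrictScalars ℤ),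
      g x ∈ M.comap ((sultry f).restrictScalars ℤ) := fun g hg x hx => by
    obtain ⟨g', hg', e⟩ := hc.exists_sultry_apply hf hf4 hg
    change sultry f (g x) ∈ M
    rw [e]
    exact (h.1 hg' _).2 hx
  refine ⟨fun g hg => mem_latAut_of (key g hg) (key g⁻¹ (inv_mem hg)), fun g hg k hk x hx => ?_⟩
  obtain ⟨g', hg', eg⟩ := hc.exists_sultry_apply hf hf4 hg
  obtain ⟨k', hk', ek⟩ := hc.exists_sultry_apply hf hf4 hk
  obtain ⟨y, hy, e⟩ := h.2 g' hg' k' hk' (sultry f x) hx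
  refine ⟨(2⁻¹ : ℝ) • ((x - k x) - g (x - k x)), ?_, by rw [smul_smul]; norm_num⟩
  change sultry f _ ∈ M
  rw [map_smul, map_sub, map_sub, eg, map_sub, ek, e, smul_smul]
  norm_num
  exact hy

/-- The properties of the sultry twists `N = M[-r]` and `N[1] = M[1-r]` for `r ∈ {0, 1}`. -/
theorem sultryTwist_properties (h : SquareStable M Q) (hc : SignCommute Q) (hf : f ∈ Q)
    (hf4 : IsFourvolution f) (n : ℕ) :
    SquareStable (sultryTwist f M (-((n % 2 : ℕ) : ℤ))) Q ∧
    M ≤ sultryTwist f M (-((n % 2 : ℕ) : ℤ)) ∧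
    (∀ x ∈ sultryTwist f M (-((n % 2 : ℕ) : ℤ)), sultry f x ∈ M) ∧
    sultryTwist f M (1 - ((n % 2 : ℕ) : ℤ)) =
      (sultryTwist f M (-((n % 2 : ℕ) : ℤ))).map ((sultry f).restrictScalars ℤ) := by
  -- For `r = 0` the lattice `N = M[-r]` is `M`; for `r = 1` it is `(1 - f)⁻¹ M`. Expressing the
  -- successor through `N` alone makes the two parities uniform afterwards.
  rcases Nat.mod_two_eq_zero_or_one n with hn | hn <;> rw [hn]
  · have e0 : sultryTwist f M (-((0 : ℕ) : ℤ)) = M := by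
      change M.map (((sultry f) ^ 0).restrictScalars ℤ) = M
      ext x; simp
    have e1 : sultryTwist f M (1 - ((0 : ℕ) : ℤ)) = M.map ((sultry f).restrictScalars ℤ) := by
      change M.map (((sultry f) ^ 1).restrictScalars ℤ) = _
      rw [pow_one]
    rw [e0, e1]
    exact ⟨h, le_rfl, fun x hx => h.sultry_mem hf hx, rfl⟩
  · have e0 : sultryTwist f M (-((1 : ℕ) : ℤ)) = M.comap ((sultry f).restrictScalars ℤ) := by
      change M.comap (((sultry f) ^ 1).restrictScalars ℤ) = _
      rw [pow_one]
    have e1 : sultryTwist f M (1 - ((1 : ℕ) : ℤ)) = M := by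
      change M.map (((sultry f) ^ 0).restrictScalars ℤ) = M
      ext x; simp
    rw [e0, e1]
    refine ⟨h.comap_sultry hc hf hf4, fun x hx => h.sultry_mem hf hx, fun x hx => hx, ?_⟩
    exact (Submodule.map_comap_eq_of_surjective (f := (sultry f).restrictScalars ℤ)
      (sultry_surjective hf4) M).symm

end Twist

/-! ### The successor lattice -/

section Next

variable {N : Submodule ℤ E} {Q : Subgroup (E ≃ₗᵢ[ℝ] E)} {f : E ≃ₗᵢ[ℝ] E}
  {ψ₁ ψ₂ : E →ₗᵢ[ℝ] V}

/-- The lattice of all `ψ₁ x + ψ₂ y` with `x, y ∈ N` and `x - y ∈ (1 - f) N`. -/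
def gluedLattice (ψ₁ ψ₂ : E →ₗᵢ[ℝ] V) (f : E ≃ₗᵢ[ℝ] E) (N : Submodule ℤ E) : Submodule ℤ V :=
  copy ψ₁ (N.map ((sultry f).restrictScalars ℤ)) ⊔
    copy ψ₂ (N.map ((sultry f).restrictScalars ℤ)) ⊔ diagCopy ψ₁ ψ₂ N

theorem mem_gluedLattice (h : SquareStable N Q) (hf : f ∈ Q) {v : V} :
    v ∈ gluedLattice ψ₁ ψ₂ f N ↔
      ∃ x ∈ N, ∃ y ∈ N, ∃ m ∈ N, x - y = sultry f m ∧ v = ψ₁ x + ψ₂ y := by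
  constructor
  · intro hv
    obtain ⟨u, hu, _, ⟨c, hc, rfl⟩, rfl⟩ := Submodule.mem_sup.1 hv
    obtain ⟨_, ⟨_, ⟨a, ha, rfl⟩, rfl⟩, _, ⟨_, ⟨b, hb, rfl⟩, rfl⟩, rfl⟩ := Submodule.mem_sup.1 hu
    refine ⟨sultry f a + c, add_mem (h.sultry_mem hf ha) hc, sultry f b + c,
      add_mem (h.sultry_mem hf hb) hc, a - b, sub_mem ha hb, by rw [map_sub]; abel, ?_⟩
    change ψ₁ (sultry f a) + ψ₂ (sultry f b) + (ψ₁ c + ψ₂ c) = _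
    rw [map_add, map_add]; abel
  · rintro ⟨x, hx, y, hy, m, hm, e, rfl⟩
    refine Submodule.mem_sup.2 ⟨ψ₁ (sultry f m), Submodule.mem_sup_left ⟨_, ⟨m, hm, rfl⟩, rfl⟩,
      ψ₁ y + ψ₂ y, ⟨y, hy, rfl⟩, ?_⟩
    rw [← e, map_sub]; abel

/-- The generators of the successor group, up to sign: the diagonal action of `Q`, the sign change
on the first summand, and the interchange of the summands. -/
def gluedGens (ψ₁ ψ₂ : E →ₗᵢ[ℝ] V) (Q : Subgroup (E ≃ₗᵢ[ℝ] E)) : Set (V ≃ₗᵢ[ℝ] V) :=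
  {g | (∃ h ∈ Q, ∀ x, g (ψ₁ x) = ψ₁ (h x) ∧ g (ψ₂ x) = ψ₂ (h x)) ∨
    (∀ x, g (ψ₁ x) = -ψ₁ x ∧ g (ψ₂ x) = ψ₂ x) ∨ (∀ x, g (ψ₁ x) = ψ₂ x ∧ g (ψ₂ x) = ψ₁ x)}

theorem inv_mem_gluedGens {g : V ≃ₗᵢ[ℝ] V} (hg : g ∈ gluedGens ψ₁ ψ₂ Q) :
    g⁻¹ ∈ gluedGens ψ₁ ψ₂ Q := by
  have hinv : ∀ {u v}, g u = v → g⁻¹ v = u := fun {u v} h => by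
    rw [← h]; exact g.symm_apply_apply u
  rcases hg with ⟨h, hh, e⟩ | e | e
  · refine Or.inl ⟨h⁻¹, inv_mem hh, fun x => ⟨hinv ?_, hinv ?_⟩⟩
    · rw [(e _).1, show h (h⁻¹ x) = x from h.apply_symm_apply x]
    · rw [(e _).2, show h (h⁻¹ x) = x from h.apply_symm_apply x]
  · refine Or.inr (Or.inl fun x => ⟨hinv ?_, hinv (e x).2⟩)
    rw [map_neg, (e x).1, neg_neg]
  · exact Or.inr (Or.inr fun x => ⟨hinv (e x).2, hinv (e x).1⟩)

/-- A single factor `1 - g` already puts both components into `(1 - f) N` and makes them congruent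
modulo `2 N`. This is what lets a second factor produce divisibility by 2. -/
theorem sub_gluedGens_apply (h : SquareStable N Q) (hf : f ∈ Q) (hf4 : IsFourvolution f)
    {g : V ≃ₗᵢ[ℝ] V} (hg : g ∈ gluedGens ψ₁ ψ₂ Q) {v : V} (hv : v ∈ gluedLattice ψ₁ ψ₂ f N) :
    ∃ a ∈ N, ∃ b ∈ N, ∃ c ∈ N, sultry f a - sultry f b = (2 : ℝ) • c ∧
      v - g v = ψ₁ (sultry f a) + ψ₂ (sultry f b) := by
  obtain ⟨x, hx, y, hy, m, hm, e, rfl⟩ := (mem_gluedLattice h hf).1 hv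
  rcases hg with ⟨k, hk, eg⟩ | eg | eg
  · obtain ⟨a, ha, ea⟩ := h.exists_sub_eq_sultry hf hf4 hk hx
    obtain ⟨b, hb, eb⟩ := h.exists_sub_eq_sultry hf hf4 hk hy
    obtain ⟨c, hc, ec⟩ := h.2 k hk f hf m hm
    refine ⟨a, ha, b, hb, c, hc, ?_, ?_⟩
    · rw [← ec, ← sultry_apply f m, ← e, ← ea, ← eb, map_sub]; abel
    · rw [← ea, ← eb, map_add, (eg x).1, (eg y).2, map_sub, map_sub]; abel
  · refine ⟨x + f x, add_mem hx ((h.1 hf x).2 hx), 0, zero_mem _, x, hx, ?_, ?_⟩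
    · rw [map_zero, sub_zero, sultry_add_apply hf4]
    · rw [map_zero, map_zero, sultry_add_apply hf4, map_add, (eg x).1, (eg y).2, map_smul]; module
  · refine ⟨m, hm, -m, neg_mem hm, x - y, sub_mem hx hy, ?_, ?_⟩
    · rw [map_neg, ← e]; module
    · rw [map_neg, ← e, map_add, (eg x).1, (eg y).2, map_neg, map_sub, map_sub]; abel

/-- The inductive heart. On the vectors supplied by `sub_gluedGens_apply`, a diagonal generator
gains 2 from the hypothesis on `N`, the sign change doubles a component, and the interchange sees
only the difference of the components, which lies in `2 N`. -/
theorem squareStable_gluedLattice (h : SquareStable N Q) (hf : f ∈ Q) (hf4 : IsFourvolution f) :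
    SquareStable (gluedLattice ψ₁ ψ₂ f N) (Subgroup.closure (gluedGens ψ₁ ψ₂ Q)) := by
  have h2N : ∀ {c}, c ∈ N → ∃ m ∈ N, (2 : ℝ) • c = sultry f m := fun {c} hc =>
    ⟨c + f c, add_mem hc ((h.1 hf c).2 hc), (sultry_add_apply hf4 c).symm⟩
  have key : ∀ g ∈ gluedGens ψ₁ ψ₂ Q, ∀ v ∈ gluedLattice ψ₁ ψ₂ f N,
      g v ∈ gluedLattice ψ₁ ψ₂ f N := fun g hg v hv => by
    obtain ⟨a, ha, b, hb, c, hc, e, e'⟩ := sub_gluedGens_apply h hf hf4 hg hv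
    obtain ⟨m, hm, em⟩ := h2N hc
    have : v - g v ∈ gluedLattice ψ₁ ψ₂ f N := (mem_gluedLattice h hf).2
      ⟨_, h.sultry_mem hf ha, _, h.sultry_mem hf hb, m, hm, e.trans em, e'⟩
    simpa using sub_mem hv this
  refine squareStable_closure (fun g hg => mem_latAut_of (key g hg)
    (key _ (inv_mem_gluedGens hg))) fun g hg k hk v hv => ?_
  obtain ⟨a, ha, b, hb, c, hc, e, e'⟩ := sub_gluedGens_apply h hf hf4 hk hv
  rw [e']
  rcases hg with ⟨q, hq, eg⟩ | eg | eg
  · obtain ⟨x, hx, ex⟩ := h.2 q hq f hf a ha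
    obtain ⟨y, hy, ey⟩ := h.2 q hq f hf b hb
    obtain ⟨m, hm, em⟩ := h.exists_sub_eq_sultry hf hf4 hq hc
    refine ⟨_, (mem_gluedLattice h hf).2 ⟨x, hx, y, hy, m, hm, ?_, rfl⟩, ?_⟩
    · refine smul_right_injective E (two_ne_zero (α := ℝ)) ?_
      change (2 : ℝ) • (x - y) = (2 : ℝ) • sultry f m
      rw [smul_sub, ← ex, ← ey, ← em, smul_sub, ← map_smul q, ← e, sultry_apply f a,
        sultry_apply f b]
      simp only [map_sub]
      abel
    · rw [smul_add, ← map_smul, ← map_smul, ← ex, ← ey, map_add, (eg _).1, (eg _).2, 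
        ← sultry_apply f a, ← sultry_apply f b, map_sub, map_sub]
      abel
  · refine ⟨_, (mem_gluedLattice h hf).2 ⟨sultry f a, h.sultry_mem hf ha, 0, zero_mem _, a, ha,
      sub_zero _, rfl⟩, ?_⟩
    rw [map_add, (eg _).1, (eg _).2, map_zero]; module
  · obtain ⟨m, hm, em⟩ := h2N hc
    refine ⟨_, (mem_gluedLattice h hf).2 ⟨c, hc, -c, neg_mem hc, m, hm, by rw [← em]; module,
      rfl⟩, ?_⟩
    rw [smul_add, ← map_smul, ← map_smul, smul_neg, ← e, map_add, (eg _).1, (eg _).2, map_neg,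
      map_sub, map_sub]
    abel

/-- The inner products of the vectors of `L` are rational. -/
def RationalLattice (L : Submodule ℤ E) : Prop := ∀ x ∈ L, ∀ y ∈ L, ∃ r : ℚ, inner ℝ x y = (r : ℝ)

/-- The map `1 - f` doubles inner products, so undoing it halves them. -/
theorem RationalLattice.of_sultry {M : Submodule ℤ E} (hM : RationalLattice M)
    (hf4 : IsFourvolution f) (hN : ∀ x ∈ N, sultry f x ∈ M) : RationalLattice N :=
  fun x hx y hy => by
    obtain ⟨r, hr⟩ := hM _ (hN x hx) _ (hN y hy)
    refine ⟨r / 2, ?_⟩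
    rw [inner_sultry hf4] at hr
    push_cast
    linarith

theorem RationalLattice.gluedLattice (hN : RationalLattice N) (h : SquareStable N Q) (hf : f ∈ Q)
    (hψ : ∀ x y, inner ℝ (ψ₁ x) (ψ₂ y) = 0) : RationalLattice (gluedLattice ψ₁ ψ₂ f N) := by
  intro v hv v' hv'
  obtain ⟨x, hx, y, hy, -, -, -, rfl⟩ := (mem_gluedLattice h hf).1 hv
  obtain ⟨x', hx', y', hy', -, -, -, rfl⟩ := (mem_gluedLattice h hf).1 hv'
  obtain ⟨r, hr⟩ := hN x hx x' hx'
  obtain ⟨s, hs'⟩ := hN y hy y' hy'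
  refine ⟨r + s, ?_⟩
  rw [inner_add_left, inner_add_right, inner_add_right, hψ, real_inner_comm (ψ₁ x') (ψ₂ y), hψ,
    LinearIsometry.inner_map_map, LinearIsometry.inner_map_map, hr, hs']
  push_cast; ring

theorem span_map_sultry (h : SquareStable N Q) (hf : f ∈ Q) (hf4 : IsFourvolution f)
    (hN : Submodule.span ℝ (N : Set E) = ⊤) :
    Submodule.span ℝ (N.map ((sultry f).restrictScalars ℤ) : Set E) = ⊤ := by
  rw [eq_top_iff, ← hN, Submodule.span_le]
  intro x hx
  have h2 : (2 : ℝ) • x ∈ Submodule.span ℝ (N.map ((sultry f).restrictScalars ℤ) : Set E) :=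
    Submodule.subset_span ⟨x + f x, add_mem hx ((h.1 hf x).2 hx), sultry_add_apply hf4 x⟩
  have := Submodule.smul_mem _ (2⁻¹ : ℝ) h2
  rwa [smul_smul, inv_mul_cancel₀ two_ne_zero, one_smul] at this

theorem apply_mem_span_map {S : Submodule ℤ E} (hS : Submodule.span ℝ (S : Set E) = ⊤)
    (A : E →ₗ[ℝ] V) (x : E) :
    A x ∈ Submodule.span ℝ (S.map (A.restrictScalars ℤ) : Set V) := by
  have : (S.map (A.restrictScalars ℤ) : Set V) = A '' S := rfl
  rw [this, Submodule.span_image, hS]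
  exact ⟨x, trivial, rfl⟩

theorem ssdInvolution_apply_of_mem [FiniteDimensional ℝ V] {S : Submodule ℤ V} {v : V}
    (hv : v ∈ Submodule.span ℝ (S : Set V)) : ssdInvolution S v = -v :=
  Submodule.reflection_mem_subspace_orthogonalComplement_eq_neg
    (Submodule.le_orthogonal_orthogonal _ hv)

theorem ssdInvolution_apply_of_orthogonal [FiniteDimensional ℝ V] {S : Submodule ℤ V} {v : V}
    (hv : ∀ s ∈ S, inner ℝ s v = 0) : ssdInvolution S v = v := by
  refine Submodule.reflection_mem_subspace_eq_self ?_
  rw [Submodule.mem_orthogonal]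
  intro u hu
  induction hu using Submodule.span_induction with
  | mem x hx => exact hv x hx
  | zero => exact inner_zero_left _
  | add x y _ _ hx hy => rw [inner_add_left, hx, hy, add_zero]
  | smul c x _ hx => rw [inner_smul_left, hx, mul_zero]

theorem span_gluedLattice {N : Submodule ℤ E}
    (hN : Submodule.span ℝ (N.map ((sultry f).restrictScalars ℤ) : Set E) = ⊤)
    (hV : ∀ v : V, ∃ x y, v = ψ₁ x + ψ₂ y) :
    Submodule.span ℝ (gluedLattice ψ₁ ψ₂ f N : Set V) = ⊤ := by
  refine eq_top_iff.2 fun v _ => ?_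
  obtain ⟨x, y, rfl⟩ := hV v
  refine add_mem ?_ ?_
  · refine Submodule.span_mono ?_ (apply_mem_span_map hN ψ₁.toLinearMap x)
    exact fun w hw => Submodule.mem_sup_left (Submodule.mem_sup_left hw)
  · refine Submodule.span_mono ?_ (apply_mem_span_map hN ψ₂.toLinearMap y)
    exact fun w hw => Submodule.mem_sup_left (Submodule.mem_sup_right hw)

end Next

end Stable

/-! ### Coordinates for the lower group -/

section Coordinates

open Matrix

/-- Transport of isometries along linear coordinates. -/
def conjHom {V X : Type*} [NormedAddCommGroup V] [InnerProductSpace ℝ V] [AddCommGroup X]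
    [Module ℝ X] (Φ : V ≃ₗ[ℝ] X) : (V ≃ₗᵢ[ℝ] V) →* (X ≃ₗ[ℝ] X) where
  toFun g := Φ.symm.trans (g.toLinearEquiv.trans Φ)
  map_one' := LinearEquiv.ext fun x => Φ.apply_symm_apply x
  map_mul' g h := LinearEquiv.ext fun x => by
    change Φ (g (h (Φ.symm x))) = Φ (g (Φ.symm (Φ (h (Φ.symm x)))))
    rw [Φ.symm_apply_apply]

variable {E V : Type*} [NormedAddCommGroup E] [InnerProductSpace ℝ E]
  [NormedAddCommGroup V] [InnerProductSpace ℝ V] {ι : Type*} [Fintype ι] [DecidableEq ι]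

theorem conjHom_apply {X : Type*} [AddCommGroup X] [Module ℝ X] (Φ : V ≃ₗ[ℝ] X) (g : V ≃ₗᵢ[ℝ] V)
    (v : V) : conjHom Φ g (Φ v) = Φ (g v) := by
  change Φ (g (Φ.symm (Φ v))) = _
  rw [Φ.symm_apply_apply]

theorem conjHom_injective {X : Type*} [AddCommGroup X] [Module ℝ X] (Φ : V ≃ₗ[ℝ] X) :
    Function.Injective (conjHom Φ) := fun g h e => by
  ext v
  apply Φ.injective
  rw [← conjHom_apply, e, conjHom_apply]

/-- Coordinates in which the inner product is the standard one. -/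
def IsometricCoord (Φ : V ≃ₗ[ℝ] FunSpace ℝ ι) : Prop := ∀ x y, inner ℝ x y = Φ x ⬝ᵥ Φ y

theorem IsometricCoord.conjHom_mem {Φ : V ≃ₗ[ℝ] FunSpace ℝ ι} (hΦ : IsometricCoord Φ)
    (g : V ≃ₗᵢ[ℝ] V) : conjHom Φ g ∈ dotGroup ℝ ι := fun φ ψ => by
  obtain ⟨x, rfl⟩ := Φ.surjective φ
  obtain ⟨y, rfl⟩ := Φ.surjective ψ
  rw [conjHom_apply, conjHom_apply, ← hΦ, ← hΦ, g.inner_map_map]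

theorem IsometricCoord.exists_conjHom_eq {Φ : V ≃ₗ[ℝ] FunSpace ℝ ι} (hΦ : IsometricCoord Φ)
    {u : FunSpace ℝ ι ≃ₗ[ℝ] FunSpace ℝ ι} (hu : u ∈ dotGroup ℝ ι) : ∃ g, conjHom Φ g = u := by
  refine ⟨(Φ.trans (u.trans Φ.symm)).isometryOfInner fun x y => ?_, ?_⟩
  · rw [hΦ, hΦ]
    change Φ (Φ.symm (u (Φ x))) ⬝ᵥ Φ (Φ.symm (u (Φ y))) = _
    rw [Φ.apply_symm_apply, Φ.apply_symm_apply, hu]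
  · refine LinearEquiv.ext fun x => ?_
    change Φ (Φ.symm (u (Φ (Φ.symm x)))) = u x
    rw [Φ.apply_symm_apply, Φ.apply_symm_apply]

theorem signCommute_of_coord [Nonempty ι] {Φ : V ≃ₗ[ℝ] FunSpace ℝ ι}
    {R : Subgroup (V ≃ₗᵢ[ℝ] V)} (hR : R = (stdLower ℝ ι).comap (conjHom Φ)) :
    SignCommute R := by
  subst hR
  intro g hg h hh
  obtain ⟨s, v, eg⟩ := (mem_stdLower ℝ).1 hg
  obtain ⟨t, w, eh⟩ := (mem_stdLower ℝ).1 hh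
  have key : ∀ x, Φ (g (h x)) = sg ℝ (bf v w) • Φ (h (g x)) := fun x => by
    rw [← conjHom_apply, ← conjHom_apply, ← conjHom_apply Φ h, ← conjHom_apply Φ g, eg, eh,
      hs_apply_eq_smul ℝ s, hs_apply_eq_smul ℝ t, hs_apply_eq_smul ℝ t, hs_apply_eq_smul ℝ s,
      map_smul, map_smul, hs_commute]
    simp only [smul_smul]
    congr 1
    ring
  rcases zmod_two_eq_zero_or_one (bf v w) with e | e
  · exact Or.inl fun x => Φ.injective (by rw [key, e, sg_zero, one_smul])
  · exact Or.inr fun x => Φ.injective (by rw [key, e, sg_one, neg_one_smul, map_neg])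

/-- A pair of functions on `𝔽₂^n` as a function on `𝔽₂^(n+1)`. -/
def pairFun (n : ℕ) : (FunSpace ℝ (Fin n) × FunSpace ℝ (Fin n)) ≃ₗ[ℝ] FunSpace ℝ (Fin (n + 1)) where
  toFun p z := if z 0 = 0 then p.1 (Fin.tail z) else p.2 (Fin.tail z)
  invFun φ := (fun x => φ (Fin.cons 0 x), fun x => φ (Fin.cons 1 x))
  map_add' p q := by ext z; by_cases h : z 0 = 0 <;> simp [h]
  map_smul' c p := by ext z; by_cases h : z 0 = 0 <;> simp [h]
  left_inv p := by ext x <;> simp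
  right_inv φ := by
    ext z
    by_cases h : z 0 = 0
    · simp only [h, if_true]
      congr 1
      rw [← h]; exact Fin.cons_self_tail z
    · simp only [h, if_false]
      congr 1
      rw [← zmod_two_ne_zero h]; exact Fin.cons_self_tail z

theorem pairFun_cons_zero {n : ℕ} (p : FunSpace ℝ (Fin n) × FunSpace ℝ (Fin n))
    (x : Fin n → ZMod 2) : pairFun n p (Fin.cons 0 x) = p.1 x := by
  simp [pairFun]

theorem pairFun_cons_one {n : ℕ} (p : FunSpace ℝ (Fin n) × FunSpace ℝ (Fin n))
    (x : Fin n → ZMod 2) : pairFun n p (Fin.cons 1 x) = p.2 x := by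
  simp [pairFun]

theorem ext_cons {n : ℕ} {φ ψ : FunSpace ℝ (Fin (n + 1))}
    (h0 : ∀ x, φ (Fin.cons 0 x) = ψ (Fin.cons 0 x))
    (h1 : ∀ x, φ (Fin.cons 1 x) = ψ (Fin.cons 1 x)) : φ = ψ :=
  (pairFun n).symm.injective (Prod.ext (funext h0) (funext h1))

theorem cons_dotProduct_cons {n : ℕ} (a b : ZMod 2) (x y : Fin n → ZMod 2) :
    (Fin.cons a x : Fin (n + 1) → ZMod 2) ⬝ᵥ (Fin.cons b y : Fin (n + 1) → ZMod 2) =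
      a * b + x ⬝ᵥ y := by
  simp [dotProduct, Fin.sum_univ_succ]

theorem cons_add_cons {n : ℕ} (a b : ZMod 2) (x y : Fin n → ZMod 2) :
    (Fin.cons a x + Fin.cons b y : Fin (n + 1) → ZMod 2) = Fin.cons (a + b) (x + y) := by
  ext i; refine Fin.cases ?_ (fun j => ?_) i <;> simp

theorem pairFun_dotProduct {n : ℕ} (p q : FunSpace ℝ (Fin n) × FunSpace ℝ (Fin n)) :
    pairFun n p ⬝ᵥ pairFun n q = p.1 ⬝ᵥ q.1 + p.2 ⬝ᵥ q.2 := by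
  simp only [dotProduct]
  rw [Fintype.sum_equiv (Fin.consEquiv (fun _ : Fin (n + 1) => ZMod 2)).symm _
    (fun z : ZMod 2 × (Fin n → ZMod 2) => pairFun n p (Fin.cons z.1 z.2) *
      pairFun n q (Fin.cons z.1 z.2))
    (fun z => by simp [Fin.consEquiv]), Fintype.sum_prod_type]
  have : (Finset.univ : Finset (ZMod 2)) = {0, 1} := rfl
  rw [this, Finset.sum_pair zero_ne_one]
  simp only [pairFun_cons_zero, pairFun_cons_one]

/-- The new coordinate of `𝔽₂^(n+1)` tells the two summands apart: diagonal elements do not involve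
it, the sign on the second summand is the new sign change, and the interchange is the new
translation. -/
theorem hs_pairFun {n : ℕ} (t : ZMod 2) (v : QS (Fin n))
    (p : FunSpace ℝ (Fin n) × FunSpace ℝ (Fin n)) :
    hs ℝ t ((Fin.cons 0 v.1, Fin.cons 0 v.2) : QS (Fin (n + 1))) (pairFun n p) =
      pairFun n (hs ℝ t v p.1, hs ℝ t v p.2) := by
  refine ext_cons (fun x => ?_) fun x => ?_ <;>
  simp only [hs_apply, cons_dotProduct_cons, cons_add_cons, pairFun_cons_zero, pairFun_cons_one,
    zero_mul, zero_add, add_zero]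

theorem hs_sign_pairFun {n : ℕ} (p : FunSpace ℝ (Fin n) × FunSpace ℝ (Fin n)) :
    hs ℝ 0 ((0, Fin.cons 1 0) : QS (Fin (n + 1))) (pairFun n p) = pairFun n (p.1, -p.2) := by
  refine ext_cons (fun x => ?_) fun x => ?_ <;>
  simp [hs_apply, cons_dotProduct_cons, pairFun_cons_zero, pairFun_cons_one]

theorem hs_swap_pairFun {n : ℕ} (p : FunSpace ℝ (Fin n) × FunSpace ℝ (Fin n)) :
    hs ℝ 0 ((Fin.cons 1 0, 0) : QS (Fin (n + 1))) (pairFun n p) = pairFun n (p.2, p.1) := by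
  refine ext_cons (fun x => ?_) fun x => ?_ <;>
  simp [hs_apply, cons_add_cons, pairFun_cons_zero, pairFun_cons_one, zmod_two_add_self]

variable {ψ₁ ψ₂ : E →ₗᵢ[ℝ] V}

theorem exists_pairEquiv [FiniteDimensional ℝ E] [FiniteDimensional ℝ V]
    (hψ : ∀ x y, inner ℝ (ψ₁ x) (ψ₂ y) = 0)
    (hdim : Module.finrank ℝ V = 2 * Module.finrank ℝ E) :
    ∃ Ψ : (E × E) ≃ₗ[ℝ] V, ∀ x y, Ψ (x, y) = ψ₁ x + ψ₂ y := by
  let A : (E × E) →ₗ[ℝ] V := ψ₁.toLinearMap.coprod ψ₂.toLinearMap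
  have hA : ∀ x y, A (x, y) = ψ₁ x + ψ₂ y := fun x y => by simp [A]
  have hinj : Function.Injective A := by
    refine (injective_iff_map_eq_zero A).2 fun p hp => ?_
    obtain ⟨x, y⟩ := p
    rw [hA] at hp
    have h1 : inner ℝ (ψ₁ x) (ψ₁ x + ψ₂ y) = 0 := by rw [hp, inner_zero_right]
    have h2 : inner ℝ (ψ₁ x + ψ₂ y) (ψ₂ y) = 0 := by rw [hp, inner_zero_left]
    rw [inner_add_right, hψ, add_zero, ψ₁.inner_map_map, inner_self_eq_zero] at h1
    rw [inner_add_left, hψ, zero_add, ψ₂.inner_map_map, inner_self_eq_zero] at h2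
    rw [h1, h2]; rfl
  refine ⟨LinearEquiv.ofInjectiveOfFinrankEq A hinj ?_, hA⟩
  rw [Module.finrank_prod, hdim, two_mul]

end Coordinates

/-! ### The successor step in coordinates. -/

section Step

open Matrix

variable {E V : Type*} [NormedAddCommGroup E] [InnerProductSpace ℝ E]
  [NormedAddCommGroup V] [InnerProductSpace ℝ V] [FiniteDimensional ℝ V]
  {ψ₁ ψ₂ : E →ₗᵢ[ℝ] V} {n : ℕ} {Φ : E ≃ₗ[ℝ] FunSpace ℝ (Fin n)} {Q : Subgroup (E ≃ₗᵢ[ℝ] E)}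
  {Ψ : (E × E) ≃ₗ[ℝ] V}

/-- Coordinates on the orthogonal sum of two copies. -/
def pairCoord (Ψ : (E × E) ≃ₗ[ℝ] V) (Φ : E ≃ₗ[ℝ] FunSpace ℝ (Fin n)) :
    V ≃ₗ[ℝ] FunSpace ℝ (Fin (n + 1)) :=
  Ψ.symm.trans ((Φ.prodCongr Φ).trans (pairFun n))

theorem pairCoord_apply (hΨ : ∀ x y, Ψ (x, y) = ψ₁ x + ψ₂ y) (x y : E) :
    pairCoord Ψ Φ (ψ₁ x + ψ₂ y) = pairFun n (Φ x, Φ y) := by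
  rw [← hΨ]
  change pairFun n ((Φ.prodCongr Φ) (Ψ.symm (Ψ (x, y)))) = _
  rw [Ψ.symm_apply_apply]; rfl

theorem exists_eq_add (hΨ : ∀ x y, Ψ (x, y) = ψ₁ x + ψ₂ y) (v : V) :
    ∃ x y, v = ψ₁ x + ψ₂ y := by
  obtain ⟨⟨x, y⟩, rfl⟩ := Ψ.surjective v
  exact ⟨x, y, hΨ x y⟩

theorem isometricCoord_pairCoord (hψ : ∀ x y, inner ℝ (ψ₁ x) (ψ₂ y) = 0)
    (hΨ : ∀ x y, Ψ (x, y) = ψ₁ x + ψ₂ y) (hΦ : IsometricCoord Φ) :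
    IsometricCoord (pairCoord Ψ Φ) := fun v w => by
  obtain ⟨x, y, rfl⟩ := exists_eq_add hΨ v
  obtain ⟨x', y', rfl⟩ := exists_eq_add hΨ w
  rw [pairCoord_apply hΨ, pairCoord_apply hΨ, pairFun_dotProduct, ← hΦ, ← hΦ, inner_add_left,
    inner_add_right, inner_add_right, hψ, real_inner_comm (ψ₁ x') (ψ₂ y), hψ,
    LinearIsometry.inner_map_map, LinearIsometry.inner_map_map, add_zero, zero_add]

theorem conjHom_pairCoord_eq (hΨ : ∀ x y, Ψ (x, y) = ψ₁ x + ψ₂ y) {g : V ≃ₗᵢ[ℝ] V}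
    {u : FunSpace ℝ (Fin (n + 1)) ≃ₗ[ℝ] FunSpace ℝ (Fin (n + 1))}
    (h : ∀ x y, pairCoord Ψ Φ (g (ψ₁ x + ψ₂ y)) = u (pairFun n (Φ x, Φ y))) :
    conjHom (pairCoord Ψ Φ) g = u := by
  refine LinearEquiv.ext fun φ => ?_
  obtain ⟨v, rfl⟩ := (pairCoord Ψ Φ).surjective φ
  obtain ⟨x, y, rfl⟩ := exists_eq_add hΨ v
  rw [conjHom_apply, h, pairCoord_apply hΨ]

theorem conjHom_diag (hΨ : ∀ x y, Ψ (x, y) = ψ₁ x + ψ₂ y) {g : V ≃ₗᵢ[ℝ] V} {h : E ≃ₗᵢ[ℝ] E}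
    {t : ZMod 2} {v : QS (Fin n)} (hh : conjHom Φ h = hs ℝ t v)
    (hg : ∀ x, g (ψ₁ x) = ψ₁ (h x) ∧ g (ψ₂ x) = ψ₂ (h x)) :
    conjHom (pairCoord Ψ Φ) g = hs ℝ t (Fin.cons 0 v.1, Fin.cons 0 v.2) :=
  conjHom_pairCoord_eq hΨ fun x y => by
    rw [map_add, (hg x).1, (hg y).2, pairCoord_apply hΨ, hs_pairFun, ← conjHom_apply,
      ← conjHom_apply, hh]

theorem conjHom_sign (hΨ : ∀ x y, Ψ (x, y) = ψ₁ x + ψ₂ y) {g : V ≃ₗᵢ[ℝ] V} (t : ZMod 2)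
    (hg : ∀ x y, g (ψ₁ x + ψ₂ y) = sg ℝ t • (ψ₁ x + ψ₂ (-y))) :
    conjHom (pairCoord Ψ Φ) g = hs ℝ t (0, Fin.cons 1 0) :=
  conjHom_pairCoord_eq hΨ fun x y => by
    rw [hg, map_smul, pairCoord_apply hΨ, hs_apply_eq_smul, hs_sign_pairFun, map_neg]

theorem conjHom_swap (hΨ : ∀ x y, Ψ (x, y) = ψ₁ x + ψ₂ y) {g : V ≃ₗᵢ[ℝ] V} (t : ZMod 2)
    (hg : ∀ x y, g (ψ₁ x + ψ₂ y) = sg ℝ t • (ψ₁ y + ψ₂ x)) :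
    conjHom (pairCoord Ψ Φ) g = hs ℝ t (Fin.cons 1 0, 0) :=
  conjHom_pairCoord_eq hΨ fun x y => by
    rw [hg, map_smul, pairCoord_apply hΨ, hs_apply_eq_smul, hs_swap_pairFun]

/-- Since `t₁ = -t₂` and `t₁₂ = -t₁₂'`, the four involutions give only one sign change and one
interchange; the argument of `sg` in the four formulas records the sign. -/
theorem ssdInvolution_copy_left (hψ : ∀ x y, inner ℝ (ψ₁ x) (ψ₂ y) = 0) {S : Submodule ℤ E}
    (hS : Submodule.span ℝ (S : Set E) = ⊤) (x y : E) :
    ssdInvolution (copy ψ₁ S) (ψ₁ x + ψ₂ y) = sg ℝ 1 • (ψ₁ x + ψ₂ (-y)) := by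
  have h1 := ssdInvolution_apply_of_mem (apply_mem_span_map hS ψ₁.toLinearMap x)
  have h2 : ssdInvolution (copy ψ₁ S) (ψ₂ y) = ψ₂ y := ssdInvolution_apply_of_orthogonal (by
    rintro _ ⟨s, -, rfl⟩; exact hψ s y)
  rw [map_add, h2, map_neg, sg_one]
  change ssdInvolution (copy ψ₁ S) (ψ₁ x) = -ψ₁ x at h1
  rw [h1]; module

theorem ssdInvolution_copy_right (hψ : ∀ x y, inner ℝ (ψ₁ x) (ψ₂ y) = 0) {S : Submodule ℤ E}
    (hS : Submodule.span ℝ (S : Set E) = ⊤) (x y : E) :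
    ssdInvolution (copy ψ₂ S) (ψ₁ x + ψ₂ y) = sg ℝ 0 • (ψ₁ x + ψ₂ (-y)) := by
  have h1 := ssdInvolution_apply_of_mem (apply_mem_span_map hS ψ₂.toLinearMap y)
  have h2 : ssdInvolution (copy ψ₂ S) (ψ₁ x) = ψ₁ x := ssdInvolution_apply_of_orthogonal (by
    rintro _ ⟨s, -, rfl⟩
    rw [real_inner_comm]; exact hψ x s)
  rw [map_add, h2, map_neg, sg_zero]
  change ssdInvolution (copy ψ₂ S) (ψ₂ y) = -ψ₂ y at h1
  rw [h1]; module

theorem ssdInvolution_diagCopy (hψ : ∀ x y, inner ℝ (ψ₁ x) (ψ₂ y) = 0) {S : Submodule ℤ E}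
    (hS : Submodule.span ℝ (S : Set E) = ⊤) (x y : E) :
    ssdInvolution (diagCopy ψ₁ ψ₂ S) (ψ₁ x + ψ₂ y) = sg ℝ 1 • (ψ₁ y + ψ₂ x) := by
  have h1 : ∀ z, ssdInvolution (diagCopy ψ₁ ψ₂ S) (ψ₁ z + ψ₂ z) = -(ψ₁ z + ψ₂ z) := fun z =>
    ssdInvolution_apply_of_mem (apply_mem_span_map hS (ψ₁.toLinearMap + ψ₂.toLinearMap) z)
  have h2 : ∀ z, ssdInvolution (diagCopy ψ₁ ψ₂ S) (ψ₁ z - ψ₂ z) = ψ₁ z - ψ₂ z := fun z =>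
    ssdInvolution_apply_of_orthogonal (by
      rintro _ ⟨s, -, rfl⟩
      change inner ℝ (ψ₁ s + ψ₂ s) (ψ₁ z - ψ₂ z) = 0
      rw [inner_add_left, inner_sub_right, inner_sub_right, hψ, real_inner_comm (ψ₁ z) (ψ₂ s), hψ,
        LinearIsometry.inner_map_map, LinearIsometry.inner_map_map]
      ring)
  have e : ψ₁ x + ψ₂ y = (ψ₁ ((2⁻¹ : ℝ) • (x + y)) + ψ₂ ((2⁻¹ : ℝ) • (x + y))) +
      (ψ₁ ((2⁻¹ : ℝ) • (x - y)) - ψ₂ ((2⁻¹ : ℝ) • (x - y))) := by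
    simp only [map_smul, map_add, map_sub]; module
  rw [e, map_add, h1, h2, sg_one]
  simp only [map_smul, map_add, map_sub]; module

theorem ssdInvolution_antidiagCopy (hψ : ∀ x y, inner ℝ (ψ₁ x) (ψ₂ y) = 0) {S : Submodule ℤ E}
    (hS : Submodule.span ℝ (S : Set E) = ⊤) (x y : E) :
    ssdInvolution (antidiagCopy ψ₁ ψ₂ S) (ψ₁ x + ψ₂ y) = sg ℝ 0 • (ψ₁ y + ψ₂ x) := by
  have h1 : ∀ z, ssdInvolution (antidiagCopy ψ₁ ψ₂ S) (ψ₁ z - ψ₂ z) = -(ψ₁ z - ψ₂ z) := fun z =>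
    ssdInvolution_apply_of_mem (apply_mem_span_map hS (ψ₁.toLinearMap - ψ₂.toLinearMap) z)
  have h2 : ∀ z, ssdInvolution (antidiagCopy ψ₁ ψ₂ S) (ψ₁ z + ψ₂ z) = ψ₁ z + ψ₂ z := fun z =>
    ssdInvolution_apply_of_orthogonal (by
      rintro _ ⟨s, -, rfl⟩
      change inner ℝ (ψ₁ s - ψ₂ s) (ψ₁ z + ψ₂ z) = 0
      rw [inner_sub_left, inner_add_right, inner_add_right, hψ, real_inner_comm (ψ₁ z) (ψ₂ s), hψ,
        LinearIsometry.inner_map_map, LinearIsometry.inner_map_map]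
      ring)
  have e : ψ₁ x + ψ₂ y = (ψ₁ ((2⁻¹ : ℝ) • (x + y)) + ψ₂ ((2⁻¹ : ℝ) • (x + y))) +
      (ψ₁ ((2⁻¹ : ℝ) • (x - y)) - ψ₂ ((2⁻¹ : ℝ) • (x - y))) := by
    simp only [map_smul, map_add, map_sub]; module
  rw [e, map_add, h1, h2, sg_zero]
  simp only [map_smul, map_add, map_sub]; module

/-- The group generated by `Q₁₂` and by the involutions attached to `S₁`, `S₂`, `T₁₂`, `T₁₂'`. -/
def gluedLower (ψ₁ ψ₂ : E →ₗᵢ[ℝ] V) (Q : Subgroup (E ≃ₗᵢ[ℝ] E)) (S T : Submodule ℤ E) :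
    Subgroup (V ≃ₗᵢ[ℝ] V) :=
  Subgroup.closure ({g | ∃ h ∈ Q, ∀ x, g (ψ₁ x) = ψ₁ (h x) ∧ g (ψ₂ x) = ψ₂ (h x)} ∪
    {ssdInvolution (copy ψ₁ S), ssdInvolution (copy ψ₂ S), ssdInvolution (diagCopy ψ₁ ψ₂ T),
      ssdInvolution (antidiagCopy ψ₁ ψ₂ T)})

/-- Up to signs, both groups are generated by the diagonal copy of the smaller extraspecial group,
one sign change and one interchange. A translation or sign change in the larger group splits into
its new coordinate and its tail accordingly. -/
theorem gluedLower_eq (hn : 0 < n) (hΦ : IsometricCoord Φ)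
    (hQ : Q = (stdLower ℝ (Fin n)).comap (conjHom Φ)) (hψ : ∀ x y, inner ℝ (ψ₁ x) (ψ₂ y) = 0)
    (hΨ : ∀ x y, Ψ (x, y) = ψ₁ x + ψ₂ y) {S T : Submodule ℤ E}
    (hS : Submodule.span ℝ (S : Set E) = ⊤) (hT : Submodule.span ℝ (T : Set E) = ⊤) :
    gluedLower ψ₁ ψ₂ Q S T = (stdLower ℝ (Fin (n + 1))).comap (conjHom (pairCoord Ψ Φ)) := by
  have : Nonempty (Fin n) := ⟨⟨0, hn⟩⟩
  have e1 := conjHom_sign (Φ := Φ) hΨ 1 (ssdInvolution_copy_left hψ hS)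
  have e2 := conjHom_sign (Φ := Φ) hΨ 0 (ssdInvolution_copy_right hψ hS)
  have e3 := conjHom_swap (Φ := Φ) hΨ 1 (ssdInvolution_diagCopy hψ hT)
  have e4 := conjHom_swap (Φ := Φ) hΨ 0 (ssdInvolution_antidiagCopy hψ hT)
  refine le_antisymm ((Subgroup.closure_le _).2 ?_) ?_
  · rintro g (⟨h, hh, hg⟩ | rfl | rfl | rfl | rfl)
    · rw [hQ] at hh
      obtain ⟨t, v, e⟩ := (mem_stdLower ℝ).1 hh
      exact (mem_stdLower ℝ).2 ⟨_, _, conjHom_diag hΨ e hg⟩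
    · exact (mem_stdLower ℝ).2 ⟨_, _, e1⟩
    · exact (mem_stdLower ℝ).2 ⟨_, _, e2⟩
    · exact (mem_stdLower ℝ).2 ⟨_, _, e3⟩
    · exact (mem_stdLower ℝ).2 ⟨_, _, e4⟩
  · suffices hle : stdLower ℝ (Fin (n + 1)) ≤
        (gluedLower ψ₁ ψ₂ Q S T).map (conjHom (pairCoord Ψ Φ)) by
      intro g hg
      obtain ⟨r, hr, e⟩ := hle hg
      rwa [← conjHom_injective _ e]
    have h1 : ∀ (v : QS (Fin n)), hs ℝ 0 ((Fin.cons 0 v.1, Fin.cons 0 v.2) : QS (Fin (n + 1))) ∈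
        (gluedLower ψ₁ ψ₂ Q S T).map (conjHom (pairCoord Ψ Φ)) := fun v => by
      obtain ⟨h, eh⟩ := hΦ.exists_conjHom_eq (hs_dotProduct_hs (k := ℝ) 0 v)
      have hh : h ∈ Q := by rw [hQ]; exact (mem_stdLower ℝ).2 ⟨0, v, eh⟩
      obtain ⟨g, eg⟩ := (isometricCoord_pairCoord hψ hΨ hΦ).exists_conjHom_eq
        (hs_dotProduct_hs (k := ℝ) 0 (Fin.cons 0 v.1, Fin.cons 0 v.2))
      have key : ∀ x y, g (ψ₁ x + ψ₂ y) = ψ₁ (h x) + ψ₂ (h y) := fun x y => by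
        apply (pairCoord Ψ Φ).injective
        rw [← conjHom_apply, eg, pairCoord_apply hΨ, pairCoord_apply hΨ, hs_pairFun, ← conjHom_apply,
          ← conjHom_apply, eh]
      refine ⟨g, Subgroup.subset_closure (Or.inl ⟨h, hh, fun x => ⟨?_, ?_⟩⟩), eg⟩
      · simpa using key x 0
      · simpa using key 0 x
    have h2 : hs ℝ 0 ((0, Fin.cons 1 0) : QS (Fin (n + 1))) ∈
        (gluedLower ψ₁ ψ₂ Q S T).map (conjHom (pairCoord Ψ Φ)) :=
      ⟨_, Subgroup.subset_closure (Or.inr (Or.inr (Or.inl rfl))), e2⟩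
    have h3 : hs ℝ 0 ((Fin.cons 1 0, 0) : QS (Fin (n + 1))) ∈
        (gluedLower ψ₁ ψ₂ Q S T).map (conjHom (pairCoord Ψ Φ)) :=
      ⟨_, Subgroup.subset_closure (Or.inr (Or.inr (Or.inr (Or.inr rfl)))), e4⟩
    have h00 : (Fin.cons 0 0 : Fin (n + 1) → ZMod 2) = 0 := by
      ext i; refine Fin.cases ?_ (fun j => ?_) i <;> simp
    refine (Subgroup.closure_le _).2 ?_
    rintro g (⟨a, rfl⟩ | ⟨b, rfl⟩)
    · rw [translation_eq, ← Fin.cons_self_tail a, SetLike.mem_coe]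
      have h := h1 (Fin.tail a, 0)
      rw [h00] at h
      rcases zmod_two_eq_zero_or_one (a 0) with e | e <;> rw [e]
      · exact h
      · have h' := mul_mem h3 h
        rw [hs_mul, Prod.mk_add_mk, cons_add_cons] at h'
        simpa using h'
    · rw [signChange_eq, ← Fin.cons_self_tail b, SetLike.mem_coe]
      have h := h1 (0, Fin.tail b)
      rw [h00] at h
      rcases zmod_two_eq_zero_or_one (b 0) with e | e <;> rw [e]
      · exact h
      · have h' := mul_mem h2 h
        rw [hs_mul, Prod.mk_add_mk, cons_add_cons] at h'
        simpa using h'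

/-- Because `-1` lies in `Q`, it lies diagonally among the generators `gluedGens`, and `t₂`, `t₁₂`
are the negatives of the other two. -/
theorem gluedLower_le (hneg : LinearIsometryEquiv.neg ℝ ∈ Q)
    (hψ : ∀ x y, inner ℝ (ψ₁ x) (ψ₂ y) = 0) {S T : Submodule ℤ E}
    (hS : Submodule.span ℝ (S : Set E) = ⊤) (hT : Submodule.span ℝ (T : Set E) = ⊤) :
    gluedLower ψ₁ ψ₂ Q S T ≤ Subgroup.closure (gluedGens ψ₁ ψ₂ Q) := by
  have split : ∀ {g : V ≃ₗᵢ[ℝ] V} {a b : E → V}, (∀ x y, g (ψ₁ x + ψ₂ y) = a x + b y) →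
      a 0 = 0 → b 0 = 0 → ∀ x, g (ψ₁ x) = a x ∧ g (ψ₂ x) = b x := fun {g a b} h ha hb x =>
    ⟨by simpa [hb] using h x 0, by simpa [ha] using h 0 x⟩
  have hn : (LinearIsometryEquiv.neg ℝ : V ≃ₗᵢ[ℝ] V) ∈ Subgroup.closure (gluedGens ψ₁ ψ₂ Q) :=
    Subgroup.subset_closure (Or.inl ⟨_, hneg, fun x => by simp⟩)
  have h1 : ssdInvolution (copy ψ₁ S) ∈ Subgroup.closure (gluedGens ψ₁ ψ₂ Q) := by
    refine Subgroup.subset_closure (Or.inr (Or.inl (split (fun x y => ?_) (by simp) (by simp))))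
    rw [ssdInvolution_copy_left hψ hS, sg_one, map_neg]; module
  have h4 : ssdInvolution (antidiagCopy ψ₁ ψ₂ T) ∈ Subgroup.closure (gluedGens ψ₁ ψ₂ Q) := by
    refine Subgroup.subset_closure (Or.inr (Or.inr (split (fun x y => ?_) (by simp) (by simp))))
    rw [ssdInvolution_antidiagCopy hψ hT, sg_zero]; module
  have h2 : LinearIsometryEquiv.neg ℝ * ssdInvolution (copy ψ₂ S) ∈
      Subgroup.closure (gluedGens ψ₁ ψ₂ Q) := by
    refine Subgroup.subset_closure (Or.inr (Or.inl (split (fun x y => ?_) (by simp) (by simp))))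
    rw [isometry_mul_apply, ssdInvolution_copy_right hψ hS, sg_zero, map_neg,
      LinearIsometryEquiv.coe_neg]
    module
  have h3 : LinearIsometryEquiv.neg ℝ * ssdInvolution (diagCopy ψ₁ ψ₂ T) ∈
      Subgroup.closure (gluedGens ψ₁ ψ₂ Q) := by
    refine Subgroup.subset_closure (Or.inr (Or.inr (split (fun x y => ?_) (by simp) (by simp))))
    rw [isometry_mul_apply, ssdInvolution_diagCopy hψ hT, sg_one, LinearIsometryEquiv.coe_neg]
    module
  refine (Subgroup.closure_le _).2 ?_
  rintro g (hg | rfl | rfl | rfl | rfl)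
  · exact Subgroup.subset_closure (Or.inl hg)
  · exact h1
  · simpa using mul_mem (inv_mem hn) h2
  · simpa using mul_mem (inv_mem hn) h3
  · exact h4

end Step

/-! ### Induction over the construction, its starting point, and existence of the pairs. -/

section Pairs

open Matrix

/-- The properties of a Barnes-Wall lattice and its lower group that are needed to compute the
normalizer. -/
structure IsGoodPair (d : ℕ) (L : Submodule ℤ (Euc d)) (R : Subgroup (Euc d ≃ₗᵢ[ℝ] Euc d)) :
    Prop where
  stable : SquareStable L R
  span : Submodule.span ℝ (L : Set (Euc d)) = ⊤
  rational : RationalLattice L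
  coord : ∃ Φ : Euc d ≃ₗ[ℝ] FunSpace ℝ (Fin d), IsometricCoord Φ ∧
    R = (stdLower ℝ (Fin d)).comap (conjHom Φ)

theorem neg_mem_of_coord {V ι : Type*} [NormedAddCommGroup V] [InnerProductSpace ℝ V] [Fintype ι]
    [DecidableEq ι] [Nonempty ι] (Φ : V ≃ₗ[ℝ] FunSpace ℝ ι) :
    LinearIsometryEquiv.neg ℝ ∈ (stdLower ℝ ι).comap (conjHom Φ) := by
  refine (mem_stdLower ℝ).2 ⟨1, 0, LinearEquiv.ext fun φ => ?_⟩
  obtain ⟨x, rfl⟩ := Φ.surjective φ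
  rw [conjHom_apply, hs_apply_eq_smul, hs_zero, sg_one, LinearIsometryEquiv.coe_neg, map_neg]
  exact (neg_one_smul ℝ _).symm

theorem IsGoodPair.next {d : ℕ} {M : Submodule ℤ (Euc (d + 1))}
    {Q : Subgroup (Euc (d + 1) ≃ₗᵢ[ℝ] Euc (d + 1))} (h : IsGoodPair (d + 1) M Q)
    {f : Euc (d + 1) ≃ₗᵢ[ℝ] Euc (d + 1)} {ψ₁ ψ₂ : Euc (d + 1) →ₗᵢ[ℝ] Euc (d + 2)} (hf : f ∈ Q)
    (hf4 : IsFourvolution f) (hψ : ∀ x y, inner ℝ (ψ₁ x) (ψ₂ y) = 0) (n : ℕ) :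
    IsGoodPair (d + 2) (nextLattice ψ₁ ψ₂ f ((n % 2 : ℕ) : ℤ) M)
      (nextLower ψ₁ ψ₂ f ((n % 2 : ℕ) : ℤ) M Q) := by
  obtain ⟨Φ, hΦ, hQ⟩ := h.coord
  have hc := signCommute_of_coord hQ
  obtain ⟨hN, hMN, hNM, e⟩ := sultryTwist_properties h.stable hc hf hf4 n
  obtain ⟨Ψ, hΨ⟩ := exists_pairEquiv hψ (by
    rw [finrank_euclideanSpace_fin, finrank_euclideanSpace_fin]; ring)
  have hT : Submodule.span ℝ (sultryTwist f M (-((n % 2 : ℕ) : ℤ)) : Set (Euc (d + 1))) = ⊤ :=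
    eq_top_iff.2 (h.span.ge.trans (Submodule.span_mono hMN))
  have hS := span_map_sultry hN hf hf4 hT
  have hneg : LinearIsometryEquiv.neg ℝ ∈ Q := by rw [hQ]; exact neg_mem_of_coord Φ
  have eL : nextLattice ψ₁ ψ₂ f ((n % 2 : ℕ) : ℤ) M =
      gluedLattice ψ₁ ψ₂ f (sultryTwist f M (-((n % 2 : ℕ) : ℤ))) := by
    rw [nextLattice, e]; rfl
  have eR : nextLower ψ₁ ψ₂ f ((n % 2 : ℕ) : ℤ) M Q = gluedLower ψ₁ ψ₂ Q
      ((sultryTwist f M (-((n % 2 : ℕ) : ℤ))).map ((sultry f).restrictScalars ℤ))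
      (sultryTwist f M (-((n % 2 : ℕ) : ℤ))) := by
    rw [nextLower, e]; rfl
  rw [eL, eR]
  exact
    { stable := (squareStable_gluedLattice hN hf hf4).mono (gluedLower_le hneg hψ hS hT)
      span := span_gluedLattice hS (exists_eq_add hΨ)
      rational := (h.rational.of_sultry hf4 hNM).gluedLattice hN hf hψ
      coord := ⟨pairCoord Ψ Φ, isometricCoord_pairCoord hψ hΨ hΦ,
        gluedLower_eq (Nat.succ_pos d) hΦ hQ hψ hΨ hS hT⟩ }

/-! ### The square lattice -/

/-- The coordinates of an orthonormal basis indexed by `𝔽₂`-vectors. -/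
noncomputable def basisCoord {V ι : Type*} [NormedAddCommGroup V] [InnerProductSpace ℝ V] [Fintype ι]
    [DecidableEq ι] (b : OrthonormalBasis (ι → ZMod 2) ℝ V) : V ≃ₗ[ℝ] FunSpace ℝ ι :=
  b.repr.toLinearEquiv.trans (WithLp.linearEquiv 2 ℝ _)

theorem isometricCoord_basisCoord {V ι : Type*} [NormedAddCommGroup V] [InnerProductSpace ℝ V]
    [Fintype ι] [DecidableEq ι] (b : OrthonormalBasis (ι → ZMod 2) ℝ V) :
    IsometricCoord (basisCoord b) := fun x y => by
  rw [← b.repr.inner_map_map, EuclideanSpace.inner_eq_star_dotProduct, dotProduct_comm]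
  rfl

theorem mem_span_basis_iff {V ι : Type*} [NormedAddCommGroup V] [InnerProductSpace ℝ V]
    [Fintype ι] [DecidableEq ι] (b : OrthonormalBasis (ι → ZMod 2) ℝ V) (x : V) :
    x ∈ Submodule.span ℤ (Set.range b) ↔ ∃ m : (ι → ZMod 2) → ℤ, ∀ z, basisCoord b x z = m z := by
  have h := b.toBasis.mem_span_iff_repr_mem ℤ x
  rw [b.coe_toBasis] at h
  rw [h]
  constructor
  · intro h
    choose m hm using h
    exact ⟨m, fun z => (hm z).symm⟩
  · rintro ⟨m, hm⟩ z
    exact ⟨m z, (hm z).symm⟩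

theorem eq_zero_or_eq_one (z : Fin 1 → ZMod 2) : z = 0 ∨ z = 1 := by
  rcases zmod_two_eq_zero_or_one (z 0) with h | h
  · exact Or.inl (funext fun i => by rw [Subsingleton.elim i 0, h]; rfl)
  · exact Or.inr (funext fun i => by rw [Subsingleton.elim i 0, h]; rfl)

theorem sum_fin_one (F : (Fin 1 → ZMod 2) → ℝ) : ∑ z, F z = F 0 + F 1 := by
  have : (Finset.univ : Finset (Fin 1 → ZMod 2)) = {0, 1} := by
    ext z; simpa using eq_zero_or_eq_one z
  rw [this, Finset.sum_pair zero_ne_one]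

theorem one_add_one_fin_one : (1 + 1 : Fin 1 → ZMod 2) = 0 := rfl

/-- The sign `(-1)^t` as an integer. -/
def sgInt (t : ZMod 2) : ℤ := if t = 0 then 1 else -1

theorem sg_eq_sgInt (t : ZMod 2) : sg ℝ t = sgInt t := by
  rcases zmod_two_eq_zero_or_one t with rfl | rfl
  · simp [sgInt]
  · rw [sg_one, sgInt, if_neg one_ne_zero]; simp

theorem sgInt_eq_or (t : ZMod 2) : sgInt t = 1 ∨ sgInt t = -1 := by
  rcases zmod_two_eq_zero_or_one t with rfl | rfl
  · exact Or.inl rfl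
  · exact Or.inr rfl

variable {V : Type*} [NormedAddCommGroup V] [InnerProductSpace ℝ V]
  (b : OrthonormalBasis (Fin 1 → ZMod 2) ℝ V)

theorem comap_le_latAut :
    (stdLower ℝ (Fin 1)).comap (conjHom (basisCoord b)) ≤
      latAut (Submodule.span ℤ (Set.range b)) := by
  have key : ∀ g ∈ (stdLower ℝ (Fin 1)).comap (conjHom (basisCoord b)),
      ∀ x ∈ Submodule.span ℤ (Set.range b), g x ∈ Submodule.span ℤ (Set.range b) := by
    intro g hg x hx
    obtain ⟨t, v, e⟩ := (mem_stdLower ℝ).1 hg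
    obtain ⟨m, hm⟩ := (mem_span_basis_iff b x).1 hx
    refine (mem_span_basis_iff b _).2 ⟨fun z => sgInt (t + v.2 ⬝ᵥ z) * m (z + v.1), fun z => ?_⟩
    rw [← conjHom_apply, e, hs_apply, hm, sg_eq_sgInt]
    push_cast; rfl
  exact fun g hg => mem_latAut_of (key g hg) (key g⁻¹ (inv_mem hg))

/-- A delta function is sent to an integral vector of norm 1, so to plus or minus a delta function.
After composing with an extraspecial element the one at 0 is fixed, the other goes to plus or minus
itself, and what is left is a sign change. -/
theorem mem_comap_of_mem_latAut {g : V ≃ₗᵢ[ℝ] V}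
    (hg : g ∈ latAut (Submodule.span ℤ (Set.range b))) :
    g ∈ (stdLower ℝ (Fin 1)).comap (conjHom (basisCoord b)) := by
  have hu : conjHom (basisCoord b) g ∈ dotGroup ℝ (Fin 1) :=
    (isometricCoord_basisCoord b).conjHom_mem g
  have hint : ∃ m : (Fin 1 → ZMod 2) → ℤ, ∀ z,
      conjHom (basisCoord b) g (Pi.single 0 1) z = m z := by
    obtain ⟨x, hx⟩ := (basisCoord b).surjective (Pi.single 0 1)
    rw [← hx]
    simp only [conjHom_apply]
    refine (mem_span_basis_iff b _).1 ((hg x).2 ((mem_span_basis_iff b x).2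
      ⟨Pi.single 0 1, fun z => ?_⟩))
    rw [hx]
    by_cases h : z = 0
    · subst h; simp
    · simp [h]
  rw [Subgroup.mem_comap]
  generalize conjHom (basisCoord b) g = u at hu hint
  have hpt : ∃ s a, u (Pi.single 0 1) = hs ℝ s ((a, 0) : QS (Fin 1)) (Pi.single 0 1) := by
    obtain ⟨m, hm⟩ := hint
    have h1 := hu (Pi.single 0 1) (Pi.single 0 1)
    rw [dotProduct_single_one, Pi.single_eq_same, dotProduct, sum_fin_one, hm, hm] at h1
    have h2 : m 0 * m 0 + m 1 * m 1 = 1 := by exact_mod_cast h1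
    have h3 : (m 0 = 0 ∧ (m 1 = 1 ∨ m 1 = -1)) ∨ (m 1 = 0 ∧ (m 0 = 1 ∨ m 0 = -1)) := by
      have ha : m 0 ≤ 1 := by nlinarith
      have hb : -1 ≤ m 0 := by nlinarith
      have hc : m 1 ≤ 1 := by nlinarith
      have hd : -1 ≤ m 1 := by nlinarith
      interval_cases m 0 <;> interval_cases m 1 <;> simp_all
    have hval : ∀ (s : ZMod 2) (a : Fin 1 → ZMod 2), (∀ z, (m z : ℝ) = sg ℝ s *
        (Pi.single 0 1 : FunSpace ℝ (Fin 1)) (z + a)) →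
        ∃ s a, u (Pi.single 0 1) = hs ℝ s ((a, 0) : QS (Fin 1)) (Pi.single 0 1) :=
      fun s a h => ⟨s, a, funext fun z => by rw [hm, h, hs_apply, zero_dotProduct, add_zero]⟩
    rcases h3 with ⟨h0, h1 | h1⟩ | ⟨h1, h0 | h0⟩
    · refine hval 0 1 fun z => ?_
      rcases eq_zero_or_eq_one z with rfl | rfl <;> simp [h0, h1, one_add_one_fin_one]
    · refine hval 1 1 fun z => ?_
      rcases eq_zero_or_eq_one z with rfl | rfl <;> simp [h0, h1, one_add_one_fin_one]
    · refine hval 0 0 fun z => ?_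
      rcases eq_zero_or_eq_one z with rfl | rfl <;> simp [h0, h1]
    · refine hval 1 0 fun z => ?_
      rcases eq_zero_or_eq_one z with rfl | rfl <;> simp [h0, h1]
  obtain ⟨s, a, e⟩ := hpt
  have hsd : hs ℝ s ((a, 0) : QS (Fin 1)) ∈ dotGroup ℝ (Fin 1) := hs_dotProduct_hs s (a, 0)
  have hw : ∀ φ ψ, ((hs ℝ s (a, 0))⁻¹ * u) φ ⬝ᵥ ((hs ℝ s (a, 0))⁻¹ * u) ψ = φ ⬝ᵥ ψ :=
    mul_mem (inv_mem hsd) hu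
  have hw0 : ((hs ℝ s (a, 0))⁻¹ * u) (Pi.single 0 1) = Pi.single 0 1 := by
    rw [LinearEquiv.mul_apply, e]
    exact (hs ℝ s (a, 0)).symm_apply_apply _
  have hmul : u = hs ℝ s (a, 0) * ((hs ℝ s (a, 0))⁻¹ * u) := (mul_inv_cancel_left _ _).symm
  rw [hmul]
  refine mul_mem ((mem_stdLower ℝ).2 ⟨_, _, rfl⟩) ?_
  generalize (hs ℝ s (a, 0))⁻¹ * u = w at hw hw0
  have h0 : w (Pi.single 1 1) 0 = 0 := by
    have := hw (Pi.single 1 1) (Pi.single 0 1)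
    rw [hw0, dotProduct_single_one, dotProduct_single_one] at this
    simpa using this
  have h1 : w (Pi.single 1 1) 1 * w (Pi.single 1 1) 1 = 1 := by
    have := hw (Pi.single 1 1) (Pi.single 1 1)
    rw [dotProduct_single_one, Pi.single_eq_same, dotProduct, sum_fin_one, h0] at this
    simpa using this
  have h2 : ∃ r, w (Pi.single 1 1) 1 = sg ℝ r := by
    rcases mul_self_eq_one_iff.1 h1 with h | h
    · exact ⟨0, by rw [h, sg_zero]⟩
    · exact ⟨1, by rw [h, sg_one]⟩
  obtain ⟨r, hr⟩ := h2
  refine (mem_stdLower ℝ).2 ⟨0, (0, fun _ => r), LinearEquiv.toLinearMap_injective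
    (LinearMap.pi_ext' fun x => LinearMap.ext_ring (funext fun z => ?_))⟩
  change w (Pi.single x 1) z = hs ℝ 0 (0, fun _ => r) (Pi.single x 1) z
  rw [hs_apply, zero_add, add_zero]
  rcases eq_zero_or_eq_one x with rfl | rfl
  · rw [hw0]
    rcases eq_zero_or_eq_one z with rfl | rfl <;> simp
  · rcases eq_zero_or_eq_one z with rfl | rfl
    · rw [h0]; simp
    · rw [hr, Pi.single_eq_same]; simp [dotProduct]

/-- The two coordinates of `(1 - h) x` have equal parity. As `g` permutes coordinates up to sign,
applying `1 - g` makes them even. -/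
theorem squareStable_basis :
    SquareStable (Submodule.span ℤ (Set.range b))
      ((stdLower ℝ (Fin 1)).comap (conjHom (basisCoord b))) := by
  refine ⟨comap_le_latAut b, fun g hg h hh x hx => ?_⟩
  obtain ⟨s, v, eg⟩ := (mem_stdLower ℝ).1 hg
  obtain ⟨t, w, eh⟩ := (mem_stdLower ℝ).1 hh
  obtain ⟨m, hm⟩ := (mem_span_basis_iff b x).1 hx
  set c : (Fin 1 → ZMod 2) → ℤ := fun z => m z - sgInt (t + w.2 ⬝ᵥ z) * m (z + w.1) with hc
  have hD : ∀ z, basisCoord b (x - h x) z = c z := fun z => by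
    rw [map_sub, ← conjHom_apply, eh, Pi.sub_apply, hs_apply, hm, hm, sg_eq_sgInt, hc]
    push_cast; rfl
  have hpar : ∃ k, c 0 - c 1 = 2 * k := by
    simp only [hc]
    rcases eq_zero_or_eq_one w.1 with e | e <;> rw [e] <;>
    rcases sgInt_eq_or (t + w.2 ⬝ᵥ 0) with e1 | e1 <;> rw [e1] <;>
    rcases sgInt_eq_or (t + w.2 ⬝ᵥ 1) with e2 | e2 <;> rw [e2]
    all_goals simp only [add_zero, zero_add, one_add_one_fin_one]
    all_goals generalize m 0 = p; generalize m 1 = q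
    · exact ⟨0, by ring⟩
    · exact ⟨-q, by ring⟩
    · exact ⟨p, by ring⟩
    · exact ⟨p - q, by ring⟩
    · exact ⟨p - q, by ring⟩
    · exact ⟨-q, by ring⟩
    · exact ⟨p, by ring⟩
    · exact ⟨0, by ring⟩
  have heven : ∀ z, ∃ k, c z - sgInt (s + v.2 ⬝ᵥ z) * c (z + v.1) = 2 * k := fun z => by
    obtain ⟨k, hk⟩ := hpar
    have hp : ∃ j, c z - c (z + v.1) = 2 * j := by
      rcases eq_zero_or_eq_one v.1 with e | e <;> rw [e]
      · exact ⟨0, by rw [add_zero]; ring⟩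
      · rcases eq_zero_or_eq_one z with rfl | rfl
        · exact ⟨k, by rw [zero_add, hk]⟩
        · exact ⟨-k, by rw [one_add_one_fin_one]; linarith⟩
    obtain ⟨j, hj⟩ := hp
    rcases sgInt_eq_or (s + v.2 ⬝ᵥ z) with e | e <;> rw [e]
    · exact ⟨j, by linarith⟩
    · exact ⟨j + c (z + v.1), by linarith⟩
  choose k hk using heven
  refine ⟨(basisCoord b).symm fun z => (k z : ℝ), (mem_span_basis_iff b _).2
    ⟨k, fun z => by rw [LinearEquiv.apply_symm_apply]⟩, ?_⟩
  apply (basisCoord b).injective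
  ext z
  rw [map_smul, LinearEquiv.apply_symm_apply, map_sub, ← conjHom_apply (basisCoord b) g, eg,
    Pi.sub_apply, hs_apply, hD, hD, sg_eq_sgInt, Pi.smul_apply, smul_eq_mul]
  exact_mod_cast hk z

theorem isGoodPair_one {L : Submodule ℤ (Euc 1)} {R : Subgroup (Euc 1 ≃ₗᵢ[ℝ] Euc 1)}
    (h : IsBWPair 1 L R) : IsGoodPair 1 L R := by
  obtain ⟨⟨b, rfl⟩, rfl⟩ := h
  let e : (Fin 1 → ZMod 2) ≃ Fin (2 ^ 1) := Fintype.equivOfCardEq (by simp)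
  have hb : Set.range (b.reindex e.symm) = Set.range b := by
    rw [OrthonormalBasis.coe_reindex, EquivLike.range_comp]
  rw [← hb]
  have hR : latAut (Submodule.span ℤ (Set.range (b.reindex e.symm))) =
      (stdLower ℝ (Fin 1)).comap (conjHom (basisCoord (b.reindex e.symm))) :=
    le_antisymm (fun g hg => mem_comap_of_mem_latAut _ hg) (comap_le_latAut _)
  rw [hR]
  refine ⟨squareStable_basis _, ?_, fun x hx y hy => ?_,
    _, isometricCoord_basisCoord _, rfl⟩
  · rw [eq_top_iff, ← (b.reindex e.symm).toBasis.span_eq, OrthonormalBasis.coe_toBasis]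
    exact Submodule.span_mono Submodule.subset_span
  · obtain ⟨m, hm⟩ := (mem_span_basis_iff _ _).1 hx
    obtain ⟨m', hm'⟩ := (mem_span_basis_iff _ _).1 hy
    refine ⟨((∑ z, m z * m' z : ℤ) : ℚ), ?_⟩
    rw [isometricCoord_basisCoord (b.reindex e.symm), dotProduct]
    push_cast
    exact Finset.sum_congr rfl fun z _ => by rw [hm, hm']

theorem IsBWPair.isGoodPair : ∀ {d : ℕ} {L : Submodule ℤ (Euc d)}
    {R : Subgroup (Euc d ≃ₗᵢ[ℝ] Euc d)}, IsBWPair d L R → IsGoodPair d L R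
  | 0, _, _, h => h.elim
  | 1, _, _, h => isGoodPair_one h
  | d + 2, L, R, h => by
    obtain ⟨M, Q, f, ψ₁, ψ₂, hMQ, hf, hf4, hψ, rfl, rfl⟩ := h
    exact hMQ.isGoodPair.next hf hf4 hψ (d + 2)

theorem exists_isBWPair : ∀ d : ℕ, ∃ L R, IsBWPair (d + 1) L R
  | 0 => ⟨_, _, ⟨EuclideanSpace.basisFun _ ℝ, rfl⟩, rfl⟩
  | d + 1 => by
    obtain ⟨M, Q, h⟩ := exists_isBWPair d
    obtain ⟨Φ, hΦ, hQ⟩ := h.isGoodPair.coord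
    let i : Fin (d + 1) := 0
    -- A nonsingular vector has an operator of square `-1`, so the lower group contains a
    -- fourvolution.
    have hq : qf (eVec i + fVec i) = 1 := by
      rw [qf_add, qf_eVec, qf_fVec, bf_fVec]; simp [eVec]
    obtain ⟨f, hf⟩ := hΦ.exists_conjHom_eq (hs_dotProduct_hs (k := ℝ) 0 (eVec i + fVec i))
    have hf4 : IsFourvolution f := fun x => by
      apply Φ.injective
      rw [← conjHom_apply, ← conjHom_apply, hf, hs_hs_self, hq, sg_one, neg_one_smul, map_neg]
    -- The two isometric embeddings send the standard basis to the two halves of the larger one.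
    let e : Fin (2 ^ (d + 1)) ⊕ Fin (2 ^ (d + 1)) ≃ Fin (2 ^ (d + 2)) :=
      finSumFinEquiv.trans (finCongr (by ring))
    let B := EuclideanSpace.basisFun (Fin (2 ^ (d + 1))) ℝ
    let b := EuclideanSpace.basisFun (Fin (2 ^ (d + 2))) ℝ
    have ho : ∀ i : Fin (2 ^ (d + 1)) → Fin (2 ^ (d + 1)) ⊕ Fin (2 ^ (d + 1)),
        Function.Injective i → Orthonormal ℝ fun j => b (e (i j)) := fun i hi =>
      b.orthonormal.comp _ (e.injective.comp hi)
    let A : (Fin (2 ^ (d + 1)) → Fin (2 ^ (d + 1)) ⊕ Fin (2 ^ (d + 1))) →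
        Euc (d + 1) →ₗ[ℝ] Euc (d + 2) := fun i => B.toBasis.constr ℝ fun j => b (e (i j))
    have hA : ∀ i j, A i (B j) = b (e (i j)) := fun i j => by
      have := B.toBasis.constr_basis ℝ (fun j => b (e (i j))) j
      rwa [OrthonormalBasis.coe_toBasis] at this
    have hAo : ∀ i, Function.Injective i → Orthonormal ℝ (A i ∘ B.toBasis) := fun i hi => by
      have : A i ∘ B.toBasis = fun j => b (e (i j)) := funext fun j => by
        rw [Function.comp_apply, OrthonormalBasis.coe_toBasis, hA]
      rw [this]; exact ho i hi
    have hBo : Orthonormal ℝ B.toBasis := by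
      rw [OrthonormalBasis.coe_toBasis]; exact B.orthonormal
    refine ⟨_, _, M, Q, f, (A Sum.inl).isometryOfOrthonormal hBo (hAo _ Sum.inl_injective),
      (A Sum.inr).isometryOfOrthonormal hBo (hAo _ Sum.inr_injective), h, ?_, hf4, fun x y => ?_,
      rfl, rfl⟩
    · rw [hQ]; exact (mem_stdLower ℝ).2 ⟨_, _, hf⟩
    · change inner ℝ (A Sum.inl x) (A Sum.inr y) = 0
      rw [← B.sum_repr x, ← B.sum_repr y, map_sum, map_sum, sum_inner]
      refine Finset.sum_eq_zero fun j _ => ?_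
      rw [inner_sum]
      refine Finset.sum_eq_zero fun l _ => ?_
      rw [map_smul, map_smul, hA, hA, inner_smul_left, inner_smul_right,
        b.orthonormal.2 (e.injective.ne Sum.inl_ne_inr), mul_zero, mul_zero]

end Pairs

/-! ### Groups with Heisenberg coordinates are extraspecial -/

section Extraspecial

open Matrix
open scoped commutatorElement

variable {ι : Type*} [Fintype ι] [DecidableEq ι] {P : Type*} [Group P]

/-- Coordinates of a group in which the multiplication is that of the standard extraspecial
group. -/
def IsHeisenberg (e : ZMod 2 × QS ι ≃ P) : Prop :=
  ∀ s t v w, e (s, v) * e (t, w) = e (s + t + w.2 ⬝ᵥ v.1, v + w)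

variable {e : ZMod 2 × QS ι ≃ P}

theorem IsHeisenberg.map_zero (he : IsHeisenberg e) : e (0, 0) = 1 := by
  have := he 0 0 0 0
  simpa using this

/-- The projection to the quadratic space. -/
def IsHeisenberg.proj (he : IsHeisenberg e) : P →* Multiplicative (QS ι) where
  toFun x := Multiplicative.ofAdd (e.symm x).2
  map_one' := by rw [← he.map_zero, e.symm_apply_apply]; rfl
  map_mul' x y := by
    obtain ⟨⟨s, v⟩, rfl⟩ := e.surjective x
    obtain ⟨⟨t, w⟩, rfl⟩ := e.surjective y
    rw [he, e.symm_apply_apply, e.symm_apply_apply, e.symm_apply_apply]; rfl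

theorem IsHeisenberg.proj_mul (he : IsHeisenberg e) (x y : P) :
    (e.symm (x * y)).2 = (e.symm x).2 + (e.symm y).2 :=
  congrArg Multiplicative.toAdd (map_mul he.proj x y)

theorem IsHeisenberg.mem_center (he : IsHeisenberg e) (x : P) :
    x ∈ Subgroup.center P ↔ (e.symm x).2 = 0 := by
  obtain ⟨⟨s, v⟩, rfl⟩ := e.surjective x
  rw [e.symm_apply_apply, Subgroup.mem_center_iff]
  constructor
  · intro h
    refine bf_nondegenerate v fun w => ?_
    have := h (e (0, w))
    rw [he, he] at this
    have h2 := congrArg Prod.fst (e.injective this)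
    have h3 : v.2 ⬝ᵥ w.1 = w.2 ⬝ᵥ v.1 := by
      rw [add_comm 0 s] at h2
      exact add_left_cancel h2
    rw [← dotProduct_add_dotProduct_comm, h3, zmod_two_add_self]
  · rintro rfl y
    obtain ⟨⟨t, w⟩, rfl⟩ := e.surjective y
    rw [he, he, add_comm t s, add_comm w]
    simp

theorem IsHeisenberg.mul_self_apply (he : IsHeisenberg e) (t : ZMod 2) (v : QS ι) :
    e (t, v) * e (t, v) = e (qf v, 0) := by
  have hq : v.2 ⬝ᵥ v.1 = qf v := dotProduct_comm _ _
  rw [he, zmod_two_add_self, zero_add, qs_add_self, hq]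

theorem IsHeisenberg.sq_eq_one_iff (he : IsHeisenberg e) (x : P) :
    qf (e.symm x).2 = 0 ↔ x ^ 2 = 1 := by
  obtain ⟨⟨t, v⟩, rfl⟩ := e.surjective x
  rw [pow_two, he.mul_self_apply, e.symm_apply_apply, ← he.map_zero, e.apply_eq_iff_eq]
  simp

/-- The elements whose second coordinate in the quadratic space is zero. -/
def IsHeisenberg.translations (he : IsHeisenberg e) : Subgroup P :=
  (AddSubgroup.toSubgroup (AddMonoidHom.snd (ι → ZMod 2) (ι → ZMod 2)).ker).comap he.proj

theorem IsHeisenberg.mem_translations (he : IsHeisenberg e) (x : P) :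
    x ∈ he.translations ↔ (e.symm x).2.2 = 0 :=
  Iff.rfl

/-- The group of the elements `±` translation has order `2^(1+d)` and exponent 2, since `qf`
vanishes on vectors `(a, 0)`. -/
theorem IsHeisenberg.isExtraspecialPlus {d : ℕ} (hd : 0 < d) {e : ZMod 2 × QS (Fin d) ≃ P}
    (he : IsHeisenberg e) : IsExtraspecialPlus d P := by
  have hpow : ∀ x : P, x ^ 2 ∈ Subgroup.center P := fun x => by
    rw [he.mem_center, pow_two, he.proj_mul, qs_add_self]
  refine ⟨?_, ?_, ?_, hpow, he.translations, ?_, ?_⟩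
  · rw [← Nat.card_congr e, Nat.card_prod, Nat.card_prod, Nat.card_fun, Nat.card_zmod,
      Nat.card_eq_fintype_card, Fintype.card_fin]
    ring
  · let z : ZMod 2 ≃ Subgroup.center P :=
      { toFun := fun t => ⟨e (t, 0), (he.mem_center _).2 (by rw [e.symm_apply_apply])⟩
        invFun := fun x => (e.symm x).1
        left_inv := fun t => by simp
        right_inv := fun x => Subtype.ext (by
          have := (he.mem_center _).1 x.2
          change e ((e.symm x).1, 0) = x
          rw [← this]; exact e.apply_symm_apply _) }
    rw [← Nat.card_congr z, Nat.card_zmod]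
  · refine le_antisymm (fun x hx => ?_) fun x hx => ?_
    · have := Abelianization.commutator_subset_ker he.proj hx
      exact (he.mem_center x).2 (congrArg Multiplicative.toAdd (MonoidHom.mem_ker.1 this))
    · have hz := (he.mem_center x).1 hx
      obtain ⟨⟨t, v⟩, rfl⟩ := e.surjective x
      rw [e.symm_apply_apply] at hz
      subst hz
      rcases zmod_two_eq_zero_or_one t with rfl | rfl
      · rw [he.map_zero]; exact one_mem _
      · let i : Fin d := ⟨0, hd⟩
        have hc : e (1, 0) = ⁅e (0, fVec i), e (0, eVec i)⁆ := by
          rw [commutatorElement_def, eq_mul_inv_iff_mul_eq, eq_mul_inv_iff_mul_eq, he, he, he]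
          simp [eVec, fVec, add_comm, zmod_two_add_self]
        change e (1, 0) ∈ _
        rw [hc]
        exact Subgroup.commutator_mem_commutator (Subgroup.mem_top _) (Subgroup.mem_top _)
  · let z : ZMod 2 × (Fin d → ZMod 2) ≃ he.translations :=
      { toFun := fun p => ⟨e (p.1, (p.2, 0)), by
          rw [he.mem_translations, e.symm_apply_apply]⟩
        invFun := fun x => ((e.symm x).1, (e.symm x).2.1)
        left_inv := fun t => by simp
        right_inv := fun x => Subtype.ext (by
          have := (he.mem_translations _).1 x.2
          change e ((e.symm x).1, ((e.symm x).2.1, 0)) = x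
          rw [← this]; exact e.apply_symm_apply _) }
    rw [← Nat.card_congr z, Nat.card_prod, Nat.card_fun, Nat.card_zmod,
      Nat.card_eq_fintype_card, Fintype.card_fin]
    ring
  · intro x hx
    rw [← he.sq_eq_one_iff, qf, (he.mem_translations x).1 hx]
    exact dotProduct_zero _

end Extraspecial

/-! ### The normalizer of the lower group -/

section Normalizer

open Matrix

variable {V ι : Type*} [NormedAddCommGroup V] [InnerProductSpace ℝ V] [Fintype ι] [DecidableEq ι]
  [Nonempty ι] {Φ : V ≃ₗ[ℝ] FunSpace ℝ ι} {L : Submodule ℤ V} {R : Subgroup (V ≃ₗᵢ[ℝ] V)}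

theorem conjHom_apply_eq (Φ : V ≃ₗ[ℝ] FunSpace ℝ ι) {g : V ≃ₗᵢ[ℝ] V}
    {u : FunSpace ℝ ι ≃ₗ[ℝ] FunSpace ℝ ι} (h : conjHom Φ g = u) (x : V) : Φ (g x) = u (Φ x) := by
  rw [← h, conjHom_apply]

theorem IsometricCoord.exists_conjHom_eq_hs (hΦ : IsometricCoord Φ)
    (hR : R = (stdLower ℝ ι).comap (conjHom Φ)) (t : ZMod 2) (v : QS ι) :
    ∃ p ∈ R, conjHom Φ p = hs ℝ t v := by
  obtain ⟨p, hp⟩ := hΦ.exists_conjHom_eq (hs_dotProduct_hs t v)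
  refine ⟨p, ?_, hp⟩
  rw [hR, Subgroup.mem_comap, hp]
  exact (mem_stdLower ℝ).2 ⟨t, v, rfl⟩

/-- So `(1 - D)(1 - D')/2` preserves the lattice for all signed elements `D`, `D'` of the group. The
lifts needed later are operators of this kind or their differences from 1. -/
theorem SquareStable.exists_half (hst : SquareStable L R) (hΦ : IsometricCoord Φ)
    (hR : R = (stdLower ℝ ι).comap (conjHom Φ)) (s t : ZMod 2) (v w : QS ι) {x : V} (hx : x ∈ L) :
    ∃ y ∈ L, Φ y =
      (2⁻¹ : ℝ) • (Φ x - hs ℝ t w (Φ x) - hs ℝ s v (Φ x - hs ℝ t w (Φ x))) := by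
  obtain ⟨p, hp, ep⟩ := hΦ.exists_conjHom_eq_hs hR s v
  obtain ⟨q, hq, eq⟩ := hΦ.exists_conjHom_eq_hs hR t w
  obtain ⟨y, hy, e⟩ := hst.2 p hp q hq x hx
  refine ⟨y, hy, ?_⟩
  have e2 := congrArg Φ e
  rw [map_sub, conjHom_apply_eq Φ ep, map_sub, conjHom_apply_eq Φ eq, map_smul] at e2
  rw [e2, smul_smul, inv_mul_cancel₀ two_ne_zero, one_smul]

theorem IsometricCoord.mem_map_latAut (hΦ : IsometricCoord Φ)
    {u : FunSpace ℝ ι ≃ₗ[ℝ] FunSpace ℝ ι} (hd : u ∈ dotGroup ℝ ι)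
    (h : ∀ x ∈ L, ∃ y ∈ L, Φ y = u (Φ x)) (h' : ∀ x ∈ L, ∃ y ∈ L, Φ y = u⁻¹ (Φ x)) :
    u ∈ (latAut L).map (conjHom Φ) := by
  obtain ⟨g, hg⟩ := hΦ.exists_conjHom_eq hd
  have hg' : conjHom Φ g⁻¹ = u⁻¹ := by rw [map_inv, hg]
  refine ⟨g, mem_latAut_of (fun x hx => ?_) fun x hx => ?_, hg⟩
  · obtain ⟨y, hy, e⟩ := h x hx
    rw [← conjHom_apply_eq Φ hg] at e
    exact Φ.injective e ▸ hy
  · obtain ⟨y, hy, e⟩ := h' x hx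
    rw [← conjHom_apply_eq Φ hg'] at e
    exact Φ.injective e ▸ hy

theorem SquareStable.brwGroup_le_map_latAut (hst : SquareStable L R) (hΦ : IsometricCoord Φ)
    (hR : R = (stdLower ℝ ι).comap (conjHom Φ)) :
    brwGroup ℝ ι ≤ (latAut L).map (conjHom Φ) := by
  have hT : ∀ (v w : QS ι) (hv : qf v = 1) (hw : qf w = 1), ∀ x ∈ L, ∃ y ∈ L,
      Φ y = (transvecLift ℝ v hv * (transvecLift ℝ w hw)⁻¹) (Φ x) := fun v w hv hw x hx => by
    -- The sign 1 inserts `-D_w`, and `(1 - D_v)(1 + D_w)/2` is the quotient of the two lifts.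
    obtain ⟨y, hy, e⟩ := hst.exists_half hΦ hR 0 1 v w hx
    refine ⟨y, hy, ?_⟩
    rw [e]
    change _ = transvecLift ℝ v hv ((2⁻¹ : ℝ) • (Φ x + hs ℝ 0 w (Φ x)))
    rw [hs_apply_eq_smul ℝ 1 w, sg_one, neg_one_smul, sub_neg_eq_add, transvecLift_apply, map_smul,
      smul_sub]
  refine (Subgroup.closure_le _).2 ?_
  rintro _ ((⟨t, v, rfl⟩ | ⟨v, w, hv, hw, rfl⟩) | ⟨x, w, h, hx, hw, rfl⟩)
  · obtain ⟨p, hp, e⟩ := hΦ.exists_conjHom_eq_hs hR t v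
    exact ⟨p, hst.1 hp, e⟩
  · refine hΦ.mem_map_latAut (transvecLift_mul_inv_mem_dotGroup hv hw) (hT v w hv hw) ?_
    rw [_root_.mul_inv_rev, inv_inv]
    exact hT w v hw hv
  · have hS : ∀ y ∈ L, ∃ z ∈ L, Φ z = siegelLift ℝ x w h hx hw (Φ y) := fun y hy => by
      obtain ⟨z, hz, e⟩ := hst.exists_half hΦ hR 0 0 x w hy
      -- The Siegel lift is `1 - (1 - D)(1 - D')/2`.
      refine ⟨y - z, sub_mem hy hz, ?_⟩
      rw [map_sub, e, siegelLift_apply, map_sub]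
      module
    exact hΦ.mem_map_latAut (fun φ ψ => siegelLift_dotProduct x w h hx hw φ ψ) hS hS

/-- For automorphisms `a`, `b`, `p` of a rational lattice, `(1 - p) a` is not `√2` times `b`. -/
theorem RationalLattice.sub_map_ne_smul [Nontrivial V] (hrat : RationalLattice L)
    (hspan : Submodule.span ℝ (L : Set V) = ⊤) {c : ℝ} (hc : c * c = 2) {a b p : V ≃ₗᵢ[ℝ] V}
    (ha : a ∈ latAut L) (hb : b ∈ latAut L) (hp : p ∈ latAut L)
    (h : ∀ x, a x - p (a x) = c • b x) : False := by
  obtain ⟨x, hx, hx0⟩ : ∃ x ∈ L, x ≠ 0 := by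
    by_contra! hL
    exact bot_ne_top ((Submodule.span_eq_bot.2 hL).symm.trans hspan)
  have hbx := (hb x).2 hx
  obtain ⟨r, hr⟩ := hrat _ (sub_mem ((ha x).2 hx) ((hp _).2 ((ha x).2 hx))) _ hbx
  obtain ⟨s, hs'⟩ := hrat _ hbx _ hbx
  have hs0 : (s : ℝ) ≠ 0 := by
    rw [← hs', inner_self_ne_zero]
    exact (LinearIsometryEquiv.map_eq_zero_iff b).not.2 hx0
  rw [h, real_inner_smul_left, hs'] at hr
  -- Pairing the relation with `b x` exhibits `c` as a quotient of two rational inner products.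
  have hcr : c = ((r / s : ℚ) : ℝ) := by push_cast; field_simp; exact hr
  exact irrational_sqrt_two ⟨|r / s|, by
    rw [← hc, Real.sqrt_mul_self_eq_abs, Rat.cast_abs, ← hcr]⟩

/-- Normalizing `R` is a condition on isometries only, while the standard normalizer is taken in the
full linear group. The gap closes because the extraspecial group, and its conjugates by isometries,
consist of isometries. -/
theorem IsometricCoord.induces_of_mem_normalizer (hΦ : IsometricCoord Φ)
    (hR : R = (stdLower ℝ ι).comap (conjHom Φ)) {g : V ≃ₗᵢ[ℝ] V}
    (hg : g ∈ Subgroup.normalizer (R : Set (V ≃ₗᵢ[ℝ] V))) : ∃ A, Induces ℝ (conjHom Φ g) A := by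
  rw [← mem_normalizer_iff_exists_induces, Subgroup.mem_normalizer_iff]
  intro u
  have hmem : ∀ h, h ∈ R ↔ conjHom Φ h ∈ stdLower ℝ ι := fun h => by rw [hR, Subgroup.mem_comap]
  have key : ∀ h, conjHom Φ h ∈ stdLower ℝ ι ↔
      conjHom Φ g * conjHom Φ h * (conjHom Φ g)⁻¹ ∈ stdLower ℝ ι := fun h => by
    rw [← map_inv, ← map_mul, ← map_mul, ← hmem, ← hmem]
    exact Subgroup.mem_normalizer_iff.1 hg h
  have hd : u ∈ dotGroup ℝ ι → (u ∈ stdLower ℝ ι ↔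
      conjHom Φ g * u * (conjHom Φ g)⁻¹ ∈ stdLower ℝ ι) := fun hu => by
    obtain ⟨h, rfl⟩ := hΦ.exists_conjHom_eq hu
    exact key h
  have hle : stdLower ℝ ι ≤ dotGroup ℝ ι := fun u hu => by
    obtain ⟨t, v, rfl⟩ := (mem_stdLower ℝ).1 hu
    exact hs_dotProduct_hs t v
  refine ⟨fun hu => (hd (hle hu)).1 hu, fun hu => (hd ?_).2 hu⟩
  have hgd := hΦ.conjHom_mem g
  have := mul_mem (mul_mem (inv_mem hgd) (hle hu)) hgd
  simpa [mul_assoc] using this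

/-- If `g` induced an odd `A`, then `transvec v * A` would be even, hence induced by some `u` in
`brwGroup`. By Schur's lemma `u⁻¹ (1 - D_v) g` is a scalar `c` times an extraspecial element, that
is `(1 - p) g = c b` on the lattice side, contradicting rationality. -/
theorem SquareStable.map_autNormalizer (hst : SquareStable L R) (hΦ : IsometricCoord Φ)
    (hR : R = (stdLower ℝ ι).comap (conjHom Φ)) (hrat : RationalLattice L)
    (hspan : Submodule.span ℝ (L : Set V) = ⊤) :
    (autNormalizer L R).map (conjHom Φ) = brwGroup ℝ ι := by
  apply le_antisymm
  · rintro _ ⟨g, ⟨hgL, hgR⟩, rfl⟩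
    obtain ⟨A, hA⟩ := hΦ.induces_of_mem_normalizer hR hgR
    refine mem_brwGroup_iff.2 ⟨hΦ.conjHom_mem g, A, mem_evenGroup.2 ⟨hA.mem_orthGroup, ?_⟩, hA⟩
    by_contra hodd
    let i := Classical.arbitrary ι
    have hv : qf (eVec i + fVec i : QS ι) = 1 := by
      rw [qf_add, qf_eVec, qf_fVec, bf_fVec, zero_add, zero_add]
      exact Pi.single_eq_same _ _
    generalize (eVec i + fVec i : QS ι) = v at hv
    have heven : transvec v * A ∈ evenGroup ι := mem_evenGroup.2
      ⟨mul_mem (transvec_mem hv) hA.mem_orthGroup, by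
        rw [dickson_transvec_mul hA.mem_orthGroup hv, zmod_two_ne_zero hodd, zmod_two_add_self]⟩
    obtain ⟨u, hu, huA⟩ := exists_mem_brwGroup_induces (k := ℝ) heven
    have h1 := huA.inv.mul ((induces_transvecLift v hv).mul hA)
    rw [inv_mul_cancel] at h1
    obtain ⟨c, w, hc⟩ := h1.exists_eq_smul
    obtain ⟨b, hb, eb⟩ := hst.brwGroup_le_map_latAut hΦ hR
      (mul_mem hu (hs_mem_brwGroup (k := ℝ) 0 w))
    obtain ⟨p, hp, ep⟩ := hΦ.exists_conjHom_eq_hs hR 0 v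
    have hkey : ∀ x, g x - p (g x) = c • b x := fun x => Φ.injective (by
      have h2 := congrArg u (hc (Φ x))
      change u (u.symm _) = _ at h2
      rw [LinearEquiv.apply_symm_apply, map_smul] at h2
      change conjHom Φ g (Φ x) - hs ℝ 0 v (conjHom Φ g (Φ x)) = _ at h2
      rw [map_sub, conjHom_apply_eq Φ ep, map_smul, conjHom_apply_eq Φ eb, ← conjHom_apply]
      exact h2)
    -- For nonsingular `v` the operator `1 - p` doubles squared norms, while `g` and `b` preserve
    -- them.
    have hcc : c * c = 2 := by
      have hx : ∃ x : V, inner ℝ x x = (1 : ℝ) := ⟨Φ.symm (Pi.single 0 1), by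
        rw [hΦ]; simp⟩
      obtain ⟨x, hx⟩ := hx
      have h3 : inner ℝ (g x - p (g x)) (g x - p (g x)) = (2 : ℝ) := by
        have := transvecLift_dotProduct (k := ℝ) v hv (Φ (g x)) (Φ (g x))
        rw [transvecLift_apply, ← conjHom_apply_eq Φ ep, ← map_sub, ← hΦ, ← hΦ,
          LinearIsometryEquiv.inner_map_map, hx, mul_one] at this
        exact this
      rw [hkey, real_inner_smul_left, real_inner_smul_right, LinearIsometryEquiv.inner_map_map, hx,
        mul_one] at h3
      exact h3
    have := Φ.toEquiv.nontrivial
    exact hrat.sub_map_ne_smul hspan hcc hgL hb (hst.1 hp) hkey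
  · intro u hu
    obtain ⟨g, hg, rfl⟩ := hst.brwGroup_le_map_latAut hΦ hR hu
    refine ⟨g, ⟨hg, Subgroup.mem_normalizer_iff.2 fun h => ?_⟩, rfl⟩
    obtain ⟨A, -, hA⟩ := exists_induces_of_mem_brwGroup hu
    have := Subgroup.mem_normalizer_iff.1 (mem_normalizer_iff_exists_induces.2 ⟨A, hA⟩)
      (conjHom Φ h)
    rw [hR, Subgroup.mem_comap, Subgroup.mem_comap, map_mul, map_mul, map_inv]
    exact this

/-- The coordinates of the lower group. -/
theorem IsometricCoord.exists_isHeisenberg (hΦ : IsometricCoord Φ)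
    (hR : R = (stdLower ℝ ι).comap (conjHom Φ)) :
    ∃ e : ZMod 2 × QS ι ≃ R, IsHeisenberg e ∧
      ∀ t v, conjHom Φ (e (t, v) : V ≃ₗᵢ[ℝ] V) = hs ℝ t v := by
  choose p hp ep using fun z : ZMod 2 × QS ι => hΦ.exists_conjHom_eq_hs hR z.1 z.2
  have hinj : Function.Injective fun z => (⟨p z, hp z⟩ : R) := fun z z' h => by
    have h1 := congrArg (conjHom Φ) (congrArg Subtype.val h)
    rw [ep, ep] at h1
    exact Prod.ext_iff.2 (hs_injective ℝ h1)
  have hsurj : Function.Surjective fun z => (⟨p z, hp z⟩ : R) := fun ⟨g, hg⟩ => by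
    have hg' := hg
    rw [hR, Subgroup.mem_comap, mem_stdLower] at hg'
    obtain ⟨t, v, h⟩ := hg'
    exact ⟨(t, v), Subtype.ext (conjHom_injective Φ (by rw [ep, h]))⟩
  refine ⟨Equiv.ofBijective _ ⟨hinj, hsurj⟩, fun s t v w => ?_, fun t v => ep (t, v)⟩
  refine Subtype.ext (conjHom_injective Φ ?_)
  change conjHom Φ (p _ * p _) = conjHom Φ (p _)
  rw [map_mul, ep, ep, ep, hs_mul]

end Normalizer

/-! ### The isomorphism with the Bolt-Room-Wall group and the action on the quadratic space. -/

section Main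

variable {d : ℕ} {L : Submodule ℤ (Euc d)} {R : Subgroup (Euc d ≃ₗᵢ[ℝ] Euc d)}

theorem IsGoodPair.exists_equiv_BRW0 (F : Type*) [Field F] [CharZero F] (hd : 0 < d)
    (h : IsGoodPair d L R) : ∃ θ : autNormalizer L R ≃* BRW0 F d,
      ∀ g : autNormalizer L R, (g : Euc d ≃ₗᵢ[ℝ] Euc d) ∈ R ↔
        (θ g : FunSpace F (Fin d) ≃ₗ[F] FunSpace F (Fin d)) ∈ stdLower F (Fin d) := by
  have : Nonempty (Fin d) := ⟨⟨0, hd⟩⟩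
  obtain ⟨Φ, hΦ, hR⟩ := h.coord
  have hmem : ∀ g, g ∈ R ↔ conjHom Φ g ∈ stdLower ℝ (Fin d) := fun g => by
    rw [hR, Subgroup.mem_comap]
  have hmap := h.stable.map_autNormalizer hΦ hR h.rational h.span
  let α : autNormalizer L R ≃* brwGroup ℝ (Fin d) :=
    ((autNormalizer L R).equivMapOfInjective _ (conjHom_injective Φ)).trans
      (MulEquiv.subgroupCongr hmap)
  have hα : ∀ g, (α g : FunSpace ℝ (Fin d) ≃ₗ[ℝ] FunSpace ℝ (Fin d)) = conjHom Φ g :=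
    fun g => rfl
  refine ⟨((α.trans (brwGroupEquiv ℝ).symm).trans (brwGroupEquiv F)).trans
    (MulEquiv.subgroupCongr (BRW0_eq F hd).symm), fun g => ?_⟩
  change _ ↔ (brwGroupEquiv F ((brwGroupEquiv ℝ).symm (α g)) :
    FunSpace F (Fin d) ≃ₗ[F] FunSpace F (Fin d)) ∈ stdLower F (Fin d)
  rw [coe_brwGroupEquiv, baseChange_mem_stdLower, ← baseChange_mem_stdLower ℝ,
    ← coe_brwGroupEquiv, MulEquiv.apply_symm_apply, hα]
  exact hmem g

/-- The induced transformation is determined by the operator, so choosing it elementwise already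
gives a homomorphism; surjectivity holds because every even transformation lifts to `brwGroup`. -/
theorem IsGoodPair.exists_induces (hd : 0 < d) (h : IsGoodPair d L R)
    {Φ : Euc d ≃ₗ[ℝ] FunSpace ℝ (Fin d)} (hΦ : IsometricCoord Φ)
    (hR : R = (stdLower ℝ (Fin d)).comap (conjHom Φ)) :
    ∃ π : autNormalizer L R →* OmegaPlus d, Function.Surjective π ∧
      ∀ g : autNormalizer L R, Induces ℝ (conjHom Φ g) (π g) := by
  have : Nonempty (Fin d) := ⟨⟨0, hd⟩⟩
  have hmap := h.stable.map_autNormalizer hΦ hR h.rational h.span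
  have hex : ∀ g : autNormalizer L R, ∃ A : OmegaPlus d,
      Induces ℝ (conjHom Φ g) (A : QSpace d ≃ₗ[ZMod 2] QSpace d) := fun g => by
    have hg : conjHom Φ g ∈ brwGroup ℝ (Fin d) := by
      rw [← hmap]; exact Subgroup.mem_map_of_mem _ g.2
    obtain ⟨A, hA, hgA⟩ := exists_induces_of_mem_brwGroup hg
    exact ⟨⟨A, by rw [omegaPlus_eq]; exact hA⟩, hgA⟩
  choose π hπ using hex
  refine ⟨MonoidHom.mk' π fun g g' => Subtype.ext ?_, fun A => ?_, hπ⟩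
  · refine (hπ (g * g')).unique ?_
    have := (hπ g).mul (hπ g')
    rwa [← map_mul] at this
  · have hA : (A : QSpace d ≃ₗ[ZMod 2] QSpace d) ∈ evenGroup (Fin d) := by
      rw [← omegaPlus_eq]; exact A.2
    obtain ⟨u, hu, huA⟩ := exists_mem_brwGroup_induces (k := ℝ) hA
    rw [← hmap] at hu
    obtain ⟨g, hg, rfl⟩ := hu
    exact ⟨⟨g, hg⟩, Subtype.ext ((hπ ⟨g, hg⟩).unique huA)⟩

theorem IsGoodPair.exists_quadratic_action (hd : 0 < d) (h : IsGoodPair d L R) :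
    IsExtraspecialPlus d R ∧
    ∃ (σ : R → QSpace d) (π : autNormalizer L R →* OmegaPlus d),
      (∀ x y, σ (x * y) = σ x + σ y) ∧ Function.Surjective σ ∧
      (∀ x, σ x = 0 ↔ x ∈ Subgroup.center R) ∧
      (∀ x, hypForm d (σ x) = 0 ↔ x ^ 2 = 1) ∧
      Function.Surjective π ∧
      (∀ g : autNormalizer L R, π g = 1 ↔ (g : Euc d ≃ₗᵢ[ℝ] Euc d) ∈ R) ∧
      (∀ (g : autNormalizer L R) (x y : R), (y : Euc d ≃ₗᵢ[ℝ] Euc d) = g * x * g⁻¹ →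
        σ y = (π g : QSpace d ≃ₗ[ZMod 2] QSpace d) (σ x)) := by
  have : Nonempty (Fin d) := ⟨⟨0, hd⟩⟩
  obtain ⟨Φ, hΦ, hR⟩ := h.coord
  have hmem : ∀ g, g ∈ R ↔ conjHom Φ g ∈ stdLower ℝ (Fin d) := fun g => by
    rw [hR, Subgroup.mem_comap]
  obtain ⟨e, he, hes⟩ := hΦ.exists_isHeisenberg hR
  obtain ⟨π, hπs, hπ⟩ := h.exists_induces hd hΦ hR
  refine ⟨he.isExtraspecialPlus hd, fun x => (e.symm x).2, π, he.proj_mul, fun v => ?_,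
    fun x => (he.mem_center x).symm, he.sq_eq_one_iff, hπs, fun g => ?_, fun g x y hy => ?_⟩
  · exact ⟨e (0, v), congrArg Prod.snd (e.symm_apply_apply _)⟩
  · rw [hmem, mem_stdLower]
    constructor
    -- An isometry acting trivially on the quadratic space is `±D_v`, so the kernel is exactly `R`.
    · intro h1
      have h2 := hπ g
      rw [h1] at h2
      exact exists_eq_hs_of_induces_one h2 (hΦ.conjHom_mem g)
    · rintro ⟨t, v, h1⟩
      have h2 := hπ g
      rw [h1] at h2
      exact Subtype.ext (h2.unique (induces_hs t v))
  · obtain ⟨⟨s, v⟩, rfl⟩ := e.surjective x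
    obtain ⟨⟨t, w⟩, rfl⟩ := e.surjective y
    simp only [e.symm_apply_apply]
    have h1 := congrArg (conjHom Φ) hy
    rw [map_mul, map_mul, InvMemClass.coe_inv, map_inv, hes, hes, eq_mul_inv_iff_mul_eq] at h1
    obtain ⟨r, hr⟩ := (hπ g).exists_mul_hs_eq v
    refine (hs_injective ℝ (s := t) (t := s + r) (mul_right_cancel (b := conjHom Φ g) ?_)).2
    rw [h1]
    refine LinearEquiv.ext fun φ => ?_
    have h2 := LinearEquiv.congr_fun hr φ
    rw [LinearEquiv.mul_apply, LinearEquiv.mul_apply] at h2 ⊢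
    rw [hs_apply_eq_smul ℝ s, map_smul, h2, hs_apply_eq_smul ℝ r,
      hs_apply_eq_smul ℝ (s + r), sg_add, smul_smul]

end Main
end BarnesWall

theorem mainTheorem5 (F : Type*) [Field F] [CharZero F] (d : ℕ) (hd : 2 ≤ d) :
    (∃ L R, BarnesWall.IsBWPair d L R) ∧
    ∀ (L : Submodule ℤ (BarnesWall.Euc d))
      (R : Subgroup (BarnesWall.Euc d ≃ₗᵢ[ℝ] BarnesWall.Euc d)),
      BarnesWall.IsBWPair d L R →
      R ≤ BarnesWall.latAut L ∧
      BarnesWall.IsExtraspecialPlus d R ∧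
      (∃ θ : BarnesWall.autNormalizer L R ≃* BarnesWall.BRW0 F d,
        ∀ g : BarnesWall.autNormalizer L R, (g : BarnesWall.Euc d ≃ₗᵢ[ℝ] BarnesWall.Euc d) ∈ R ↔
          (θ g : BarnesWall.FunSpace F (Fin d) ≃ₗ[F] BarnesWall.FunSpace F (Fin d)) ∈
            BarnesWall.stdLower F (Fin d)) ∧
      (∃ (σ : R → BarnesWall.QSpace d)
          (π : BarnesWall.autNormalizer L R →* BarnesWall.OmegaPlus d),
        (∀ x y, σ (x * y) = σ x + σ y) ∧ Function.Surjective σ ∧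
        (∀ x, σ x = 0 ↔ x ∈ Subgroup.center R) ∧
        (∀ x, BarnesWall.hypForm d (σ x) = 0 ↔ x ^ 2 = 1) ∧
        Function.Surjective π ∧
        (∀ g : BarnesWall.autNormalizer L R, π g = 1 ↔ (g : BarnesWall.Euc d ≃ₗᵢ[ℝ] BarnesWall.Euc d) ∈ R) ∧
        (∀ (g : BarnesWall.autNormalizer L R) (x y : R),
          (y : BarnesWall.Euc d ≃ₗᵢ[ℝ] BarnesWall.Euc d) = g * x * g⁻¹ →
            σ y = (π g : BarnesWall.QSpace d ≃ₗ[ZMod 2] BarnesWall.QSpace d) (σ x))) := by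
  refine ⟨?_, fun L R h => ?_⟩
  · obtain ⟨n, rfl⟩ := Nat.exists_eq_add_of_le' (Nat.one_le_of_lt hd)
    exact BarnesWall.exists_isBWPair n
  · have hd0 : 0 < d := by omega
    have hp := h.isGoodPair
    obtain ⟨hex, hact⟩ := hp.exists_quadratic_action hd0
    exact ⟨hp.stable.1, hex, hp.exists_equiv_BRW0 F hd0, hact⟩
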